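/- Setting. Let $I=[a,b]$, $a<b$, and let $f:I\to I$ belong to the class $\mathcal H$: $f$ is $C^2$; for each $n\ge 1$ the map $f^n$ has a dense orbit in $I$; every periodic point is hyperbolically repelling ($f^n(p)=p$, $n\ge1$, implies $|Df^n(p)|>1$); and $f$ has finitely many critical points, all non-flat (near a critical point $c$ one has $f(x)=f(c)\pm|\psi(x)|^{\ell}$ with $1<\ell<\infty$ and $\psi$ a local $C^2$ diffeomorphism with $\psi(c)=0$). Derivatives at the end points of $I$ are one-sided. Let $\mathcal P_1$ be a partition of $I$ into finitely many maximal intervals of strict monotonicity of $f$ (each turning point belonging to one of the two adjacent intervals), $\mathcal P_0=\{I\}$ and $\mathcal P_n=\bigvee_{i=0}^{n-1}f^{-i}\mathcal P_1$. For $\varphi:I\to\mathbb R$ let $V_n(\varphi)=\sup_{C\in\mathcal P_n}\sup_{x,y\in C}|\varphi(x)-\varphi(y)|\in[0,\infty]$. An inducing scheme $(X,F,\tau)$ over $(I,f)$ consists of a non-degenerate interval $X\subset I$, a countable collection of disjoint intervals $X_i\subset X$ and integers $\tau_i\ge 1$ such that $F|_{X_i}=f^{\tau_i}|_{X_i}$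 maps $X_i$ homeomorphically onto $X$; put $\tau(x)=\tau_i$ for $x\in X_i$. The induced potential is $\Phi(x)=\sum_{k=0}^{\tau(x)-1}\varphi(f^k(x))$ for $x\in\bigcup_iX_i$. The scheme satisfies (SVI) for $\varphi$ if $\sum_{n\ge1}V_n(\Phi)<\infty$, where $V_n(\Phi)=\sup_{C}\sup_{x,y\in C}|\Phi(x)-\Phi(y)|$ over the $n$-cylinders $C=\{x: F^j(x)\in X_{i_j},\ 0\le j<n\}$ of $F$. The Hofbauer tower is the set of pairs $(x,D)$ with $x\in D$ and $D=f^n(C)$ for some $n\ge0$, $C\in\mathcal P_n$, with the map $\hat f(x,D)=(f(x),f(D\cap E))$, where $x\in E\in\mathcal P_1$. We say that $(X,F,\tau)$ corresponds to a first return map on the Hofbauer tower if there are a subset $\hat X$ of the tower with projection $\{x:(x,D)\in\hat X\}=X$ and an open set $U\supset\overline X$ with $U\subset D$ for all $(x,D)\in\hat X$, such that for all $i$ and all $(x,D)\in\hat X$ with $x\in X_i$ the first return time of $(x,D)$ to $\hat X$ under $\hat f$ is $\tau_i$. Lemma. Let $f\in\mathcal H$ and $\varphi:I\to\mathbb R$.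 (a) If $\sum_n nV_n(\varphi)<\infty$, then (SVI) holds for every inducing scheme such that each $X_i$ is contained in an element of $\mathcal P_{\tau_i}$ (this is automatic if the $X_i$ are open); if moreover $\varphi$ is continuous, (SVI) holds for every inducing scheme. (b) Suppose that every critical point of $f$ in the interior of $I$ is a turning point (a local extremum). Let $\varphi$ be $\alpha$-Hölder continuous for some $\alpha>0$, and let $(X,F,\tau)$ be an inducing scheme that corresponds to a first return map on the Hofbauer tower and satisfies $\sup_i\sum_{k=0}^{\tau_i-1}|f^k(X_i)|^\alpha<\infty$, where $|\cdot|$ denotes length. Then (SVI) holds for this scheme. -/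

import Mathlib

open Set MeasureTheory Topology
open scoped ENNReal NNReal

/-! Maps of a compact interval -/

/-- The critical points of `f` on `I = [a, b]` (one-sided derivatives at the end points). -/
def criticalSet (f : ℝ → ℝ) (a b : ℝ) : Set ℝ :=
  {c | c ∈ Icc a b ∧ derivWithin f (Icc a b) c = 0}

/-- Non-flatness of a critical point `c`: near `c`, `f x = f c ± |ψ x| ^ ℓ`, where `1 < ℓ < ∞` and
`ψ` is a local `C²` diffeomorphism with `ψ c = 0`. -/
def IsNonflatAt (f : ℝ → ℝ) (a b c : ℝ) : Prop :=
  ∃ (l : ℝ) (ψ : ℝ → ℝ), 1 < l ∧ ContDiffAt ℝ 2 ψ c ∧ ψ c = 0 ∧ deriv ψ c ≠ 0 ∧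
    ∀ᶠ x in 𝓝[Icc a b] c, |f x - f c| = |ψ x| ^ l

/-- The class `ℋ` of smooth interval maps: `C²` self-maps of `I = [a, b]` such that every iterate
`f^n`, `n ≥ 1`, has a dense orbit, all periodic points are hyperbolically repelling, and there are
finitely many critical points, all of them non-flat. -/
structure IsClassH (f : ℝ → ℝ) (a b : ℝ) : Prop where
  mapsTo : MapsTo f (Icc a b) (Icc a b)
  contDiffOn : ContDiffOn ℝ 2 f (Icc a b)
  mixing : ∀ n : ℕ, 0 < n → ∃ x ∈ Icc a b,
    Icc a b ⊆ closure (range fun k : ℕ => (f^[n])^[k] x)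
  repelling : ∀ p ∈ Icc a b, ∀ n : ℕ, 0 < n → f^[n] p = p →
    1 < |derivWithin f^[n] (Icc a b) p|
  finite_critical : (criticalSet f a b).Finite
  nonflat : ∀ c ∈ criticalSet f a b, IsNonflatAt f a b c

/-! Partitions, cylinders and variations -/

/-- `P` is a partition of `I` into finitely many maximal intervals of monotonicity of `f`.
Each turning point is the common end point of two adjacent elements, and belongs to one of them;
maximality says that two elements can never be merged to a larger interval of monotonicity. -/
structure IsBranchPartition (f : ℝ → ℝ) (I : Set ℝ) (P : Set (Set ℝ)) : Prop where
  finite : P.Finite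
  nonempty : ∀ C ∈ P, C.Nonempty
  ordConnected : ∀ C ∈ P, C.OrdConnected
  disjoint : P.PairwiseDisjoint id
  sUnion_eq : ⋃₀ P = I
  monotone : ∀ C ∈ P, StrictMonoOn f C ∨ StrictAntiOn f C
  maximal : ∀ C ∈ P, ∀ C' ∈ P, C ≠ C' →
    ¬ ((C ∪ C').OrdConnected ∧ (StrictMonoOn f (C ∪ C') ∨ StrictAntiOn f (C ∪ C')))

/-- The `n`-cylinders of a map `g` on `Y` with respect to a family `P` of disjoint subsets of `Y`:
the nonempty sets `{x ∈ Y | g^j x ∈ C_j for all j < n}` with `C_0, …, C_{n-1} ∈ P`.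
If `P` is a partition of `Y`, they form the partition `⋁_{j < n} g^{-j} P`
(for `n = 0`, the trivial partition). -/
def cylinders (g : ℝ → ℝ) (Y : Set ℝ) (P : Set (Set ℝ)) (n : ℕ) : Set (Set ℝ) :=
  {Z | Z.Nonempty ∧ ∃ c : Fin n → Set ℝ, (∀ j, c j ∈ P) ∧
    Z = {x | x ∈ Y ∧ ∀ j : Fin n, g^[(j : ℕ)] x ∈ c j}}

/-- The `n`-th variation `V_n(ψ) = sup_Z sup_{x, y ∈ Z} |ψ x - ψ y|`, where `Z` runs through the
`n`-cylinders; it may be infinite. -/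
noncomputable def variation (g : ℝ → ℝ) (Y : Set ℝ) (P : Set (Set ℝ)) (ψ : ℝ → ℝ) (n : ℕ) :
    ℝ≥0∞ :=
  ⨆ Z ∈ cylinders g Y P n, ⨆ x ∈ Z, ⨆ y ∈ Z, ENNReal.ofReal |ψ x - ψ y|

/-! Inducing schemes -/

/-- An inducing scheme `(X, F, τ)` over `(I, f)`, with domains `X_i`, `i : ι`. -/
structure InducingScheme (f : ℝ → ℝ) (I : Set ℝ) (ι : Type*) where
  /-- the interval `X` -/
  base : Set ℝ
  /-- the domains `X_i` -/
  dom : ι → Set ℝ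
  /-- the inducing times `τ_i` -/
  tau : ι → ℕ
  base_subset : base ⊆ I
  base_ordConnected : base.OrdConnected
  base_nontrivial : base.Nontrivial
  dom_subset : ∀ i, dom i ⊆ base
  dom_ordConnected : ∀ i, (dom i).OrdConnected
  dom_disjoint : Pairwise fun i j => Disjoint (dom i) (dom j)
  tau_pos : ∀ i, 0 < tau i
  /-- `f^{τ_i}` maps `X_i` homeomorphically onto `X`. -/
  homeo : ∀ i, ∃ e : dom i ≃ₜ base, ∀ x : dom i, (e x : ℝ) = f^[tau i] x

namespace InducingScheme

variable {f : ℝ → ℝ} {I : Set ℝ} {ι : Type*}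

open Classical in
/-- The inducing time `τ x = τ_i` for `x ∈ X_i` (set to `0` outside `⋃ i, X_i`). -/
noncomputable def time (S : InducingScheme f I ι) (x : ℝ) : ℕ :=
  if h : ∃ i, x ∈ S.dom i then S.tau h.choose else 0

theorem time_eq (S : InducingScheme f I ι) {i : ι} {x : ℝ} (hx : x ∈ S.dom i) :
    S.time x = S.tau i := by
  have h : ∃ i, x ∈ S.dom i := ⟨i, hx⟩
  have hi : h.choose = i := by
    by_contra hne
    exact Set.disjoint_left.mp (S.dom_disjoint hne) h.choose_spec hx
  rw [time, dif_pos h, hi]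

/-- The induced map `F x = f^{τ x} x`. -/
noncomputable def map (S : InducingScheme f I ι) (x : ℝ) : ℝ := f^[S.time x] x

/-- The induced potential `Φ x = ∑_{k < τ x} φ (f^k x)`. -/
noncomputable def inducedPotential (S : InducingScheme f I ι) (φ : ℝ → ℝ) (x : ℝ) : ℝ :=
  ∑ k ∈ Finset.range (S.time x), φ (f^[k] x)

/-- Summable variations of the induced potential: `∑_{n ≥ 1} V_n(Φ) < ∞`, with respect to the
cylinders of `F` for the family `{X_i}`. -/
def SVI (S : InducingScheme f I ι) (φ : ℝ → ℝ) : Prop :=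
  ∑' n : ℕ, variation S.map S.base (range S.dom) (S.inducedPotential φ) (n + 1) < ⊤

/-- Each `X_i` lies in a single branch of `f^{τ_i}`, that is, in an element of `P_{τ_i}`. -/
def IsSubordinate (S : InducingScheme f I ι) (P : Set (Set ℝ)) : Prop :=
  ∀ i, ∃ Z ∈ cylinders f I P (S.tau i), S.dom i ⊆ Z

end InducingScheme

/-! The Hofbauer tower -/

/-- The domains `D = f^n(C)`, where `C` is an `n`-cylinder, `n ≥ 0`. -/
def hofbauerDomains (f : ℝ → ℝ) (I : Set ℝ) (P : Set (Set ℝ)) : Set (Set ℝ) :=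
  {D | ∃ n : ℕ, ∃ C ∈ cylinders f I P n, D = f^[n] '' C}

/-- The Hofbauer tower: pairs `(x, D)` with `x ∈ D` and `D` a domain. -/
def hofbauerTower (f : ℝ → ℝ) (I : Set ℝ) (P : Set (Set ℝ)) : Set (ℝ × Set ℝ) :=
  {q | q.2 ∈ hofbauerDomains f I P ∧ q.1 ∈ q.2}

/-- The tower map `(x, D) ↦ (f x, D')`. If `D = f^n(C)`, `x` lies in the element `E` of `P`, and
`C' = C ∩ f^{-n}(E)` is the `(n+1)`-cylinder with `x ∈ f^n(C')`, then
`D' = f^{n+1}(C') = f(D ∩ E)`. -/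
def hofbauerMap (f : ℝ → ℝ) (P : Set (Set ℝ)) (q : ℝ × Set ℝ) : ℝ × Set ℝ :=
  (f q.1, f '' (q.2 ∩ ⋃₀ {E | E ∈ P ∧ q.1 ∈ E}))

/-- The scheme corresponds to the first return map to a set `Xhat` in the Hofbauer tower which lies
over `X` and is compactly contained in the domains that it meets: for every point of `Xhat` over
`X_i`, the first return time to `Xhat` is `τ_i`. -/
def InducingScheme.CorrespondsToFirstReturn {f : ℝ → ℝ} {I : Set ℝ} {ι : Type*}
    (S : InducingScheme f I ι) (P : Set (Set ℝ)) : Prop :=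
  ∃ Xhat : Set (ℝ × Set ℝ), Xhat ⊆ hofbauerTower f I P ∧ Prod.fst '' Xhat = S.base ∧
    (∃ U : Set ℝ, IsOpen U ∧ closure S.base ⊆ U ∧ ∀ q ∈ Xhat, U ⊆ q.2) ∧
    ∀ q ∈ Xhat, ∀ i, q.1 ∈ S.dom i →
      IsLeast {n : ℕ | 0 < n ∧ (hofbauerMap f P)^[n] q ∈ Xhat} (S.tau i)

/-! Part (a) is a counting argument. Let two points lie in a common `(n+1)`-cylinder of `F` with
first inducing time `τ` and total time `T`, so `T ≥ τ + n`. For `k < τ` their `k`-th iterates lie in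
a common `(T-k)`-cylinder of `f`. The indices `T-k` are distinct and at least `n+1`, so `V_{n+1}(Φ)
≤ ∑_j V_{n+1+j}(φ)`, and summing over `n` counts `V_m(φ)` exactly `m` times (`svi_of_forall`). If
the `X_i` need not lie in single branches, injectivity of the iterates and maximality of the
partition still put interior points into common branches, and continuity of `φ` reaches the end
points.

Part (b) rests on exponential decay of the lengths of the cylinders of `F`. If these are `O(θ^n)`
and `f^k ∘ g_i` is Lipschitz on the closure of `X` with constant `O(|f^k X_i|)`, where `g_i` is the
inverse of the branch on `X_i`, then Hölder continuity bounds the variation of `Φ` by `O(θ^{αn}) ∑_k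
|f^k X_i|^α`.

Distortion: a return in the tower lands on a level containing `U`, so all `g_i` extend to one
neighbourhood `(A, B)` of the closure of `X` (`CorrespondsToFirstReturn.exists_isInverseBranch`).
The iterates of an extended branch stay monotone, hence avoid the turning points. Between critical
points non-flatness writes `|f'|` as a log-concave weight times the exponential of a Lipschitz
function, so cross-ratios are controlled (`exists_crossRatio_le`). As `∑_k |f^k X_i|` is bounded, a
Koebe argument gives distortion `exp (K' l)` at scale `l` and the Lipschitz bounds
(`IsCrossRatioChain.exists_distortion`, `IsCrossRatioChain.exists_lipschitz`).

Hyperbolicity: the extended branches need not map `(A, B)` into itself, so contraction is not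
automatic. It follows by an argument in the style of Mañé from three facts: images have disjoint
interiors, cylinders shrink uniformly (dense orbits of all iterates exclude intervals with all
iterates injective), and periodic points are hyperbolic. Long periodic orbits have uniformly small
multipliers (`periodic_deriv_le`), hence first returns to deep cylinders contract
(`exists_isReturnContracting`). König's lemma leaves finitely many such cylinders to handle, and
inserting them one at a time yields `exists_orbit_deriv_le` and then `exists_length_le`. -/

/-! Iterated function systems of an interval -/

/-- The composition `g (η 0) ∘ ⋯ ∘ g (η (n - 1))`. -/
def seqMap {ι : Type*} (g : ι → ℝ → ℝ) : ℕ → (ℕ → ι) → ℝ → ℝ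
  | 0, _, y => y
  | n + 1, η, y => g (η 0) (seqMap g n (fun k => η (k + 1)) y)

/-- The cocycle over `seqMap g` generated by `D`. -/
def seqDeriv {ι : Type*} (g D : ι → ℝ → ℝ) : ℕ → (ℕ → ι) → ℝ → ℝ
  | 0, _, _ => 1
  | n + 1, η, y => D (η 0) (seqMap g n (fun k => η (k + 1)) y) *
      seqDeriv g D n (fun k => η (k + 1)) y

section
variable {ι : Type*} {g D : ι → ℝ → ℝ}

theorem seqMap_congr {n : ℕ} : ∀ {η ζ : ℕ → ι}, (∀ k < n, η k = ζ k) →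
    seqMap g n η = seqMap g n ζ := by
  induction n with
  | zero => intros; rfl
  | succ n ih =>
    intro η ζ h
    funext y
    simp only [seqMap]
    rw [h 0 (by omega), ih (fun k hk => h (k + 1) (by omega))]

theorem seqDeriv_congr {n : ℕ} : ∀ {η ζ : ℕ → ι}, (∀ k < n, η k = ζ k) →
    seqDeriv g D n η = seqDeriv g D n ζ := by
  induction n with
  | zero => intros; rfl
  | succ n ih =>
    intro η ζ h
    funext y
    simp only [seqDeriv]
    rw [h 0 (by omega), ih (fun k hk => h (k + 1) (by omega)),
      seqMap_congr (fun k hk => h (k + 1) (by omega))]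

theorem seqMap_add (m n : ℕ) : ∀ (η : ℕ → ι) (y : ℝ),
    seqMap g (m + n) η y = seqMap g m η (seqMap g n (fun k => η (k + m)) y) := by
  induction m with
  | zero => intro η y; simp [seqMap]
  | succ m ih =>
    intro η y
    rw [show m + 1 + n = (m + n) + 1 by ring]
    simp only [seqMap]
    rw [ih]
    simp only [add_assoc]

theorem seqDeriv_add (m n : ℕ) : ∀ (η : ℕ → ι) (y : ℝ),
    seqDeriv g D (m + n) η y = seqDeriv g D m η (seqMap g n (fun k => η (k + m)) y) *
      seqDeriv g D n (fun k => η (k + m)) y := by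
  induction m with
  | zero => intro η y; simp [seqDeriv]
  | succ m ih =>
    intro η y
    rw [show m + 1 + n = (m + n) + 1 by ring]
    simp only [seqDeriv]
    rw [ih, seqMap_add]
    simp only [add_assoc, mul_assoc]

/-- A backward orbit of the system: `x n = g (η n) (x (n + 1))`. -/
def IsOrbit (e₀ e₁ : ℝ) (g : ι → ℝ → ℝ) (η : ℕ → ι) (x : ℕ → ℝ) : Prop :=
  ∀ n, x n ∈ Icc e₀ e₁ ∧ x n = g (η n) (x (n + 1))

theorem IsOrbit.shift {e₀ e₁ : ℝ} {η : ℕ → ι} {x : ℕ → ℝ} (h : IsOrbit e₀ e₁ g η x) (m : ℕ) :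
    IsOrbit e₀ e₁ g (fun k => η (k + m)) (fun k => x (k + m)) := fun n => by
  have := h (n + m)
  exact ⟨this.1, by simpa only [add_right_comm] using this.2⟩

theorem IsOrbit.seqMap_eq {e₀ e₁ : ℝ} {n : ℕ} : ∀ {η : ℕ → ι} {x : ℕ → ℝ},
    IsOrbit e₀ e₁ g η x → seqMap g n η (x n) = x 0 := by
  induction n with
  | zero => intros; rfl
  | succ n ih =>
    intro η x h
    simp only [seqMap]
    rw [ih (h.shift 1), ← (h 0).2]

theorem IsOrbit.seqDeriv_eq {e₀ e₁ : ℝ} {n : ℕ} : ∀ {η : ℕ → ι} {x : ℕ → ℝ},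
    IsOrbit e₀ e₁ g η x → seqDeriv g D n η (x n) = ∏ k ∈ Finset.range n, D (η k) (x (k + 1)) := by
  induction n with
  | zero => intros; rfl
  | succ n ih =>
    intro η x h
    simp only [seqDeriv]
    rw [ih (h.shift 1), Finset.prod_range_succ', (h.shift 1).seqMap_eq, mul_comm]

theorem IsOrbit.seqDeriv_add {e₀ e₁ : ℝ} {m n : ℕ} {η : ℕ → ι} {x : ℕ → ℝ}
    (h : IsOrbit e₀ e₁ g η x) : seqDeriv g D (m + n) η (x (m + n)) =
      seqDeriv g D m η (x m) * seqDeriv g D n (fun k => η (k + m)) (x (m + n)) := by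
  have := (h.shift m).seqMap_eq (n := n)
  simp only [zero_add, add_comm n m] at this
  rw [_root_.seqDeriv_add, this]

/-- If `η` has period `q`, a fixed point of the composition along a period starts a periodic
backward orbit. -/
theorem exists_isOrbit_of_fixed {e₀ e₁ : ℝ} (hmap : ∀ i, MapsTo (g i) (Icc e₀ e₁) (Icc e₀ e₁))
    {η : ℕ → ι} {q : ℕ} (hq : 0 < q) (hη : ∀ k, η (k + q) = η k) {p : ℝ}
    (hp : p ∈ Icc e₀ e₁) (hfix : seqMap g q η p = p) :
    ∃ x, IsOrbit e₀ e₁ g η x ∧ (∀ k, x (k + q) = x k) ∧ x 0 = p := by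
  have hmapS : ∀ n (η : ℕ → ι), MapsTo (seqMap g n η) (Icc e₀ e₁) (Icc e₀ e₁) := by
    intro n
    induction n with
    | zero => intro η y hy; exact hy
    | succ n ih => intro η y hy; exact hmap _ (ih _ hy)
  have hmod : ∀ n, η (n % q) = η n := by
    intro n
    have : ∀ t s, η (s + q * t) = η s := by
      intro t
      induction t with
      | zero => intro s; simp
      | succ t ih => intro s; rw [Nat.mul_succ, ← add_assoc, hη, ih]
    conv_rhs => rw [← Nat.mod_add_div n q]
    rw [this]
  -- The point at time `n` is `p` pulled back along the remainder of the current period.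
  refine ⟨fun n => seqMap g (q - n % q) (fun k => η (k + n % q)) p, fun n => ⟨hmapS _ _ hp, ?_⟩,
    fun k => by simp, by simp [hfix]⟩
  have hlt := Nat.mod_lt n hq
  obtain ⟨r, hr⟩ : ∃ r, q - n % q = r + 1 := ⟨q - n % q - 1, by omega⟩
  beta_reduce
  rw [hr]
  simp only [seqMap, zero_add, hmod]
  congr 1
  by_cases h : n % q + 1 < q
  · have h1 : (n + 1) % q = n % q + 1 := by
      rw [Nat.add_mod, Nat.mod_eq_of_lt (show 1 < q by omega), Nat.mod_eq_of_lt h]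
    rw [h1, show q - (n % q + 1) = r by omega]
    simp only [add_assoc, add_comm 1]
  · have h1 : (n + 1) % q = 0 := by
      rw [← Nat.mod_add_mod, show n % q + 1 = q by omega, Nat.mod_self]
    have h2 : r = 0 := by omega
    subst h2
    simp only [h1, Nat.sub_zero, add_zero]
    rw [hfix]; rfl

end

/-! ### Systems with bounded distortion -/

/-- A system of injective self-maps `g i` of `[e₀, e₁]` with disjoint interiors of the images, with
derivatives `D i` of bounded distortion, such that the cylinders shrink and the periodic points are
hyperbolic. -/
structure IsIntervalIFS {ι : Type*} (e₀ e₁ K : ℝ) (g D : ι → ℝ → ℝ) : Prop where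
  lt : e₀ < e₁
  K_nonneg : 0 ≤ K
  mapsTo : ∀ i, MapsTo (g i) (Icc e₀ e₁) (Icc e₀ e₁)
  pos : ∀ i, ∀ x ∈ Icc e₀ e₁, 0 < D i x
  mono : ∀ i, StrictMonoOn (g i) (Icc e₀ e₁) ∨ StrictAntiOn (g i) (Icc e₀ e₁)
  dist_le : ∀ i, ∀ x ∈ Icc e₀ e₁, ∀ y ∈ Icc e₀ e₁, ∀ z ∈ Icc e₀ e₁, ∀ l : ℝ, |x - z| ≤ l →
    |y - z| ≤ l → |g i x - g i y| ≤ Real.exp (K * l) * D i z * |x - y|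
  le_dist : ∀ i, ∀ x ∈ Icc e₀ e₁, ∀ y ∈ Icc e₀ e₁, ∀ z ∈ Icc e₀ e₁, ∀ l : ℝ, |x - z| ≤ l →
    |y - z| ≤ l → D i z * |x - y| ≤ Real.exp (K * l) * |g i x - g i y|
  disjoint : ∀ i j, i ≠ j → Disjoint (g i '' Ioo e₀ e₁) (g j '' Ioo e₀ e₁)
  shrink : ∀ ε > 0, ∃ N : ℕ, ∀ n ≥ N, ∀ η : ℕ → ι, |seqMap g n η e₀ - seqMap g n η e₁| ≤ ε
  hyperbolic : ∀ n > 0, ∀ η : ℕ → ι, ∀ p ∈ Icc e₀ e₁, seqMap g n η p = p →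
    seqDeriv g D n η p < 1

/-- Maps whose distortion on `J` is bounded from above by `A`, relative to the derivative. -/
def DistUpper (S T : ℝ → ℝ) (J : Set ℝ) (A : ℝ) : Prop :=
  ∀ x ∈ J, ∀ y ∈ J, ∀ z ∈ J, |S x - S y| ≤ A * T z * |x - y|

/-- Maps whose distortion on `J` is bounded from below by `A`, relative to the derivative. -/
def DistLower (S T : ℝ → ℝ) (J : Set ℝ) (A : ℝ) : Prop :=
  ∀ x ∈ J, ∀ y ∈ J, ∀ z ∈ J, T z * |x - y| ≤ A * |S x - S y|

namespace IsIntervalIFS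
variable {ι : Type*} {e₀ e₁ K : ℝ} {g D : ι → ℝ → ℝ}

theorem seqMap_mapsTo (h : IsIntervalIFS e₀ e₁ K g D) {n : ℕ} : ∀ {η : ℕ → ι},
    MapsTo (seqMap g n η) (Icc e₀ e₁) (Icc e₀ e₁) := by
  induction n with
  | zero => intro η y hy; exact hy
  | succ n ih => intro η y hy; exact h.mapsTo _ (ih hy)

theorem seqDeriv_pos (h : IsIntervalIFS e₀ e₁ K g D) {n : ℕ} : ∀ {η : ℕ → ι} {y : ℝ},
    y ∈ Icc e₀ e₁ → 0 < seqDeriv g D n η y := by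
  induction n with
  | zero => intros; exact one_pos
  | succ n ih => intro η y hy; exact mul_pos (h.pos _ _ (h.seqMap_mapsTo hy)) (ih hy)

theorem seqMap_mono (h : IsIntervalIFS e₀ e₁ K g D) {n : ℕ} : ∀ {η : ℕ → ι},
    StrictMonoOn (seqMap g n η) (Icc e₀ e₁) ∨ StrictAntiOn (seqMap g n η) (Icc e₀ e₁) := by
  induction n with
  | zero => intro η; exact Or.inl fun _ _ _ _ h => h
  | succ n ih =>
    intro η
    have hm := h.seqMap_mapsTo (n := n) (η := fun k => η (k + 1))
    rcases h.mono (η 0) with h1 | h1 <;> rcases ih (η := fun k => η (k + 1)) with h2 | h2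
    · exact Or.inl (h1.comp h2 hm)
    · exact Or.inr (h1.comp_strictAntiOn h2 hm)
    · exact Or.inr (h1.comp_strictMonoOn h2 hm)
    · exact Or.inl (h1.comp h2 hm)

theorem seqMap_injOn (h : IsIntervalIFS e₀ e₁ K g D) {n : ℕ} {η : ℕ → ι} :
    InjOn (seqMap g n η) (Icc e₀ e₁) :=
  (h.seqMap_mono (n := n) (η := η)).elim StrictMonoOn.injOn StrictAntiOn.injOn

/-- The structure postulates neither continuity nor that `D` is a derivative; the upper distortion
bound alone makes each map Lipschitz. -/
theorem continuousOn (h : IsIntervalIFS e₀ e₁ K g D) (i : ι) : ContinuousOn (g i) (Icc e₀ e₁) := by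
  have hl := h.lt
  set A := Real.exp (K * (e₁ - e₀)) * D i e₀
  have hA : 0 ≤ A := (mul_pos (Real.exp_pos _) (h.pos i e₀ ⟨le_rfl, hl.le⟩)).le
  refine LipschitzOnWith.continuousOn (K := ⟨A, hA⟩) (LipschitzOnWith.of_dist_le_mul ?_)
  intro x hx y hy
  rw [Real.dist_eq, Real.dist_eq]
  refine h.dist_le i x hx y hy e₀ ⟨le_rfl, hl.le⟩ (e₁ - e₀) ?_ ?_ <;> rw [abs_of_nonneg] <;>
    linarith [hx.1, hx.2, hy.1, hy.2]

theorem seqMap_continuousOn (h : IsIntervalIFS e₀ e₁ K g D) {n : ℕ} : ∀ {η : ℕ → ι},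
    ContinuousOn (seqMap g n η) (Icc e₀ e₁) := by
  induction n with
  | zero => intro η; exact continuousOn_id
  | succ n ih => intro η; exact (h.continuousOn (η 0)).comp ih h.seqMap_mapsTo

theorem exists_fixed (h : IsIntervalIFS e₀ e₁ K g D) (n : ℕ) (η : ℕ → ι) :
    ∃ p ∈ Icc e₀ e₁, seqMap g n η p = p := by
  obtain ⟨p, hp, hf⟩ := exists_mem_Icc_isFixedPt_of_mapsTo (h.seqMap_continuousOn (n := n) (η := η))
    h.lt.le h.seqMap_mapsTo
  exact ⟨p, hp, hf⟩

/-- The length of a cylinder bounds the distances in it. -/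
theorem abs_seqMap_sub_le (h : IsIntervalIFS e₀ e₁ K g D) {n : ℕ} {η : ℕ → ι} {x y : ℝ}
    (hx : x ∈ Icc e₀ e₁) (hy : y ∈ Icc e₀ e₁) :
    |seqMap g n η x - seqMap g n η y| ≤ |seqMap g n η e₀ - seqMap g n η e₁| := by
  have h0 : e₀ ∈ Icc e₀ e₁ := ⟨le_rfl, h.lt.le⟩
  have h1 : e₁ ∈ Icc e₀ e₁ := ⟨h.lt.le, le_rfl⟩
  rcases h.seqMap_mono (n := n) (η := η) with hm | hm
  · have a1 := hm.monotoneOn h0 hx hx.1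
    have a2 := hm.monotoneOn h0 hy hy.1
    have a3 := hm.monotoneOn hx h1 hx.2
    have a4 := hm.monotoneOn hy h1 hy.2
    rw [abs_sub_comm (seqMap g n η e₀), abs_of_nonneg (sub_nonneg.2 (a1.trans a3)), abs_le]
    constructor <;> linarith
  · have a1 := hm.antitoneOn h0 hx hx.1
    have a2 := hm.antitoneOn h0 hy hy.1
    have a3 := hm.antitoneOn hx h1 hx.2
    have a4 := hm.antitoneOn hy h1 hy.2
    rw [abs_of_nonneg (sub_nonneg.2 (a3.trans a1)), abs_le]
    constructor <;> linarith

/-- Distortion factors multiply along a composition. Applying the letter `η t` costs `exp (K * l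
t)`, where `l t` bounds the set it acts on, namely the image of `J` under the last `n - (t + 1)`
letters. -/
theorem distUpper_of_sum (h : IsIntervalIFS e₀ e₁ K g D) {n : ℕ} : ∀ {η : ℕ → ι} {J : Set ℝ}
    {l : ℕ → ℝ}, J ⊆ Icc e₀ e₁ → (∀ t < n, ∀ x ∈ J, ∀ y ∈ J,
      |seqMap g (n - (t + 1)) (fun k => η (k + (t + 1))) x -
        seqMap g (n - (t + 1)) (fun k => η (k + (t + 1))) y| ≤ l t) →
    DistUpper (seqMap g n η) (seqDeriv g D n η) J (Real.exp (K * ∑ t ∈ Finset.range n, l t)) := by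
  induction n with
  | zero => intro η J l hJ _ x _ y _ z _; simp [seqMap, seqDeriv]
  | succ n ih =>
    intro η J l hJ hl x hx y hy z hz
    have h1 := ih (η := fun k => η (k + 1)) (J := J) (l := fun t => l (t + 1)) hJ (by
      intro t ht x hx y hy
      have := hl (t + 1) (by omega) x hx y hy
      rw [Nat.add_sub_add_right] at this
      simpa only [add_assoc] using this) x hx y hy z hz
    have h0 := hl 0 (by omega)
    simp only [zero_add, Nat.add_sub_cancel] at h0
    have hm := h.seqMap_mapsTo (n := n) (η := fun k => η (k + 1))
    have h2 := h.dist_le (η 0) _ (hm (hJ hx)) _ (hm (hJ hy)) _ (hm (hJ hz)) (l 0)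
      (h0 x hx z hz) (h0 y hy z hz)
    simp only [seqMap, seqDeriv]
    rw [Finset.sum_range_succ', mul_add, Real.exp_add]
    refine h2.trans ((mul_le_mul_of_nonneg_left h1 ?_).trans_eq (by ring))
    exact (mul_pos (Real.exp_pos _) (h.pos _ _ (hm (hJ hz)))).le

theorem distLower_of_sum (h : IsIntervalIFS e₀ e₁ K g D) {n : ℕ} : ∀ {η : ℕ → ι} {J : Set ℝ}
    {l : ℕ → ℝ}, J ⊆ Icc e₀ e₁ → (∀ t < n, ∀ x ∈ J, ∀ y ∈ J,
      |seqMap g (n - (t + 1)) (fun k => η (k + (t + 1))) x -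
        seqMap g (n - (t + 1)) (fun k => η (k + (t + 1))) y| ≤ l t) →
    DistLower (seqMap g n η) (seqDeriv g D n η) J (Real.exp (K * ∑ t ∈ Finset.range n, l t)) := by
  induction n with
  | zero => intro η J l hJ _ x _ y _ z _; simp [seqMap, seqDeriv]
  | succ n ih =>
    intro η J l hJ hl x hx y hy z hz
    have h1 := ih (η := fun k => η (k + 1)) (J := J) (l := fun t => l (t + 1)) hJ (by
      intro t ht x hx y hy
      have := hl (t + 1) (by omega) x hx y hy
      rw [Nat.add_sub_add_right] at this
      simpa only [add_assoc] using this) x hx y hy z hz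
    have h0 := hl 0 (by omega)
    simp only [zero_add, Nat.add_sub_cancel] at h0
    have hm := h.seqMap_mapsTo (n := n) (η := fun k => η (k + 1))
    have h2 := h.le_dist (η 0) _ (hm (hJ hx)) _ (hm (hJ hy)) _ (hm (hJ hz)) (l 0)
      (h0 x hx z hz) (h0 y hy z hz)
    simp only [seqMap, seqDeriv]
    rw [Finset.sum_range_succ', mul_add, Real.exp_add, mul_assoc, mul_assoc]
    refine (mul_le_mul_of_nonneg_left h1 (h.pos _ _ (hm (hJ hz))).le).trans ?_
    calc _ = Real.exp (K * ∑ k ∈ Finset.range n, l (k + 1)) * (D (η 0)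
          (seqMap g n (fun k => η (k + 1)) z) *
          |seqMap g n (fun k => η (k + 1)) x - seqMap g n (fun k => η (k + 1)) y|) := by ring
      _ ≤ _ := mul_le_mul_of_nonneg_left h2 (Real.exp_pos _).le

theorem distLower_comp {m n : ℕ} {η : ℕ → ι} {J : Set ℝ} {A B : ℝ} (h : IsIntervalIFS e₀ e₁ K g D)
    (hJ : J ⊆ Icc e₀ e₁) (hB : 0 ≤ B)
    (h1 : DistLower (seqMap g m η) (seqDeriv g D m η) (seqMap g n (fun k => η (k + m)) '' J) A)
    (h2 : DistLower (seqMap g n (fun k => η (k + m))) (seqDeriv g D n (fun k => η (k + m))) J B) :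
    DistLower (seqMap g (m + n) η) (seqDeriv g D (m + n) η) J (A * B) := by
  intro x hx y hy z hz
  rw [seqMap_add, seqMap_add, seqDeriv_add]
  have a1 := h1 _ (mem_image_of_mem _ hx) _ (mem_image_of_mem _ hy) _ (mem_image_of_mem _ hz)
  have a2 := h2 x hx y hy z hz
  have hp := (h.seqDeriv_pos (n := m) (η := η)
    (h.seqMap_mapsTo (n := n) (η := fun k => η (k + m)) (hJ hz))).le
  rw [mul_assoc]
  refine (mul_le_mul_of_nonneg_left a2 hp).trans ?_
  rw [mul_left_comm, mul_comm A, mul_assoc]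
  exact mul_le_mul_of_nonneg_left a1 hB

/-- Cylinders of incompatible words have disjoint interiors. -/
theorem disjoint_seqMap (h : IsIntervalIFS e₀ e₁ K g D) {m n k : ℕ} : ∀ {η ζ : ℕ → ι},
    k < m → k < n → η k ≠ ζ k →
    Disjoint (seqMap g m η '' Ioo e₀ e₁) (seqMap g n ζ '' Ioo e₀ e₁) := by
  have hI : ∀ (n : ℕ) (η : ℕ → ι), MapsTo (seqMap g n η) (Ioo e₀ e₁) (Ioo e₀ e₁) := by
    intro n η y hy
    have h0 : e₀ ∈ Icc e₀ e₁ := ⟨le_rfl, h.lt.le⟩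
    have h1 : e₁ ∈ Icc e₀ e₁ := ⟨h.lt.le, le_rfl⟩
    have hm := h.seqMap_mapsTo (n := n) (η := η)
    rcases h.seqMap_mono (n := n) (η := η) with hs | hs
    · exact ⟨(hm h0).1.trans_lt (hs h0 (Ioo_subset_Icc_self hy) hy.1),
        (hs (Ioo_subset_Icc_self hy) h1 hy.2).trans_le (hm h1).2⟩
    · exact ⟨(hm h1).1.trans_lt (hs (Ioo_subset_Icc_self hy) h1 hy.2),
        (hs h0 (Ioo_subset_Icc_self hy) hy.1).trans_le (hm h0).2⟩
  have hzero : ∀ {m n : ℕ} {η ζ : ℕ → ι}, 0 < m → 0 < n → η 0 ≠ ζ 0 →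
      Disjoint (seqMap g m η '' Ioo e₀ e₁) (seqMap g n ζ '' Ioo e₀ e₁) := by
    intro m n η ζ hm hn hne
    obtain ⟨m, rfl⟩ : ∃ m', m = m' + 1 := ⟨m - 1, by omega⟩
    obtain ⟨n, rfl⟩ : ∃ m', n = m' + 1 := ⟨n - 1, by omega⟩
    refine (h.disjoint _ _ hne).mono ?_ ?_ <;>
    · rintro _ ⟨y, hy, rfl⟩
      exact mem_image_of_mem _ (hI _ _ hy)
  induction k generalizing m n with
  | zero => intro η ζ; exact hzero
  | succ k ih =>
    intro η ζ hm hn hne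
    by_cases hne0 : η 0 = ζ 0
    · obtain ⟨m, rfl⟩ : ∃ m', m = m' + 1 := ⟨m - 1, by omega⟩
      obtain ⟨n, rfl⟩ : ∃ m', n = m' + 1 := ⟨n - 1, by omega⟩
      have hd := ih (m := m) (n := n) (η := fun j => η (j + 1)) (ζ := fun j => ζ (j + 1))
        (by omega) (by omega) hne
      rw [Set.disjoint_left] at hd ⊢
      rintro _ ⟨y, hy, rfl⟩ ⟨z, hz, hyz⟩
      simp only [seqMap, ← hne0] at hyz
      have hinj : InjOn (g (η 0)) (Icc e₀ e₁) :=
        (h.mono (η 0)).elim StrictMonoOn.injOn StrictAntiOn.injOn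
      have heq := hinj (h.seqMap_mapsTo (Ioo_subset_Icc_self hz))
        (h.seqMap_mapsTo (Ioo_subset_Icc_self hy)) hyz
      exact hd (mem_image_of_mem _ hy) ⟨z, hz, heq⟩
    · exact hzero (by omega) (by omega) hne0

end IsIntervalIFS

/-- The total length of disjoint open subintervals of `[e₀, e₁]`. -/
theorem sum_abs_sub_le_of_disjoint {κ : Type*} {s : Finset κ} {l r : κ → ℝ} {e₀ e₁ : ℝ}
    (he : e₀ ≤ e₁) (hsub : ∀ t ∈ s, uIoo (l t) (r t) ⊆ Icc e₀ e₁)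
    (hd : ∀ t ∈ s, ∀ t' ∈ s, t ≠ t' → Disjoint (uIoo (l t) (r t)) (uIoo (l t') (r t'))) :
    ∑ t ∈ s, |l t - r t| ≤ e₁ - e₀ := by
  have h1 : volume (⋃ t ∈ s, uIoo (l t) (r t)) = ∑ t ∈ s, volume (uIoo (l t) (r t)) :=
    measure_biUnion_finset (fun t ht t' ht' hne => hd t ht t' ht' hne)
      (fun t _ => measurableSet_Ioo)
  have h2 : volume (⋃ t ∈ s, uIoo (l t) (r t)) ≤ volume (Icc e₀ e₁) :=
    measure_mono (iUnion₂_subset hsub)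
  rw [h1, Real.volume_Icc] at h2
  have h3 : ∀ t, volume (uIoo (l t) (r t)) = ENNReal.ofReal |l t - r t| := fun t => by
    rw [uIoo, Real.volume_Ioo, abs_sub_comm, ← max_sub_min_eq_abs']
    simp [max_comm, min_comm]
  simp only [h3] at h2
  rw [← ENNReal.ofReal_sum_of_nonneg (fun _ _ => abs_nonneg _)] at h2
  exact (ENNReal.ofReal_le_ofReal_iff (sub_nonneg.2 he)).1 h2

/-- `r` is the first return time of `η` to the cylinder of its first `m` letters. -/
def IsFirstReturn {ι : Type*} (η : ℕ → ι) (m r : ℕ) : Prop :=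
  0 < r ∧ (∀ k < m, η (k + r) = η k) ∧ ∀ j, 0 < j → j < r → ∃ k < m, η (k + j) ≠ η k

/-! ### First returns, end points and large derivatives -/

namespace IsIntervalIFS
variable {ι : Type*} {e₀ e₁ K : ℝ} {g D : ι → ℝ → ℝ}

theorem left_mem (h : IsIntervalIFS e₀ e₁ K g D) : e₀ ∈ Icc e₀ e₁ := ⟨le_rfl, h.lt.le⟩

theorem right_mem (h : IsIntervalIFS e₀ e₁ K g D) : e₁ ∈ Icc e₀ e₁ := ⟨h.lt.le, le_rfl⟩

theorem uIoo_subset_image (h : IsIntervalIFS e₀ e₁ K g D) {n : ℕ} {η : ℕ → ι} :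
    uIoo (seqMap g n η e₀) (seqMap g n η e₁) ⊆ seqMap g n η '' Ioo e₀ e₁ := by
  rcases h.seqMap_mono (n := n) (η := η) with hm | hm
  · rw [uIoo_of_lt (hm h.left_mem h.right_mem h.lt)]
    exact intermediate_value_Ioo h.lt.le h.seqMap_continuousOn
  · rw [uIoo_of_gt (hm h.left_mem h.right_mem h.lt)]
    exact intermediate_value_Ioo' h.lt.le h.seqMap_continuousOn

theorem sum_length_le (h : IsIntervalIFS e₀ e₁ K g D) {κ : Type*} {s : Finset κ} {n : κ → ℕ}
    {η : κ → ℕ → ι} (hd : ∀ t ∈ s, ∀ t' ∈ s, t ≠ t' → Disjoint (seqMap g (n t) (η t) '' Ioo e₀ e₁)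
      (seqMap g (n t') (η t') '' Ioo e₀ e₁)) :
    ∑ t ∈ s, |seqMap g (n t) (η t) e₀ - seqMap g (n t) (η t) e₁| ≤ e₁ - e₀ :=
  sum_abs_sub_le_of_disjoint h.lt.le
    (fun _ _ => h.uIoo_subset_image.trans
      ((h.seqMap_mapsTo.mono_left Ioo_subset_Icc_self).image_subset))
    (fun t ht t' ht' hne => (hd t ht t' ht' hne).mono h.uIoo_subset_image h.uIoo_subset_image)

/-- The intermediate images of the cylinder during a first return have disjoint interiors: an
overlap of two of them would be an earlier return. -/
theorem firstReturn_sum_le (h : IsIntervalIFS e₀ e₁ K g D) {η : ℕ → ι} {m r : ℕ}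
    (hr : IsFirstReturn η m r) : ∑ t ∈ Finset.range r,
      |seqMap g (r - (t + 1) + m) (fun k => η (k + (t + 1))) e₀ -
        seqMap g (r - (t + 1) + m) (fun k => η (k + (t + 1))) e₁| ≤ e₁ - e₀ := by
  have key : ∀ i j, i < j → j < r →
      Disjoint (seqMap g (r - (i + 1) + m) (fun k => η (k + (i + 1))) '' Ioo e₀ e₁)
      (seqMap g (r - (j + 1) + m) (fun k => η (k + (j + 1))) '' Ioo e₀ e₁) := by
    intro i j hij hj
    -- The time `r - (j - i)` lies strictly between `0` and `r`, so the first `m` letters fail to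
    -- recur there; the failing letter separates the two cylinders.
    obtain ⟨k, hk, hne⟩ := hr.2.2 (i + 1 + (r - (j + 1))) (by omega) (by omega)
    refine h.disjoint_seqMap (k := r - (j + 1) + k) (by omega) (by omega) ?_
    have := hr.2.1 k hk
    rw [show r - (j + 1) + k + (i + 1) = k + (i + 1 + (r - (j + 1))) by omega,
      show r - (j + 1) + k + (j + 1) = k + r by omega, this]
    exact hne
  refine h.sum_length_le (n := fun t => r - (t + 1) + m) (η := fun t k => η (k + (t + 1))) ?_
  intro i hi j hj hne
  rw [Finset.mem_range] at hi hj
  rcases lt_or_gt_of_ne hne with hlt | hlt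
  · exact key i j hlt hj
  · exact (key j i hlt hi).symm

/-- Because the first `m` letters recur at time `r`, the `m`-cylinder of `η` is also that of `η`
shifted by `r`; its partial images are therefore genuine cylinders of length `r - (t + 1) + m`. -/
theorem firstReturn_abs_le (h : IsIntervalIFS e₀ e₁ K g D) {η : ℕ → ι} {m r : ℕ}
    (hr : IsFirstReturn η m r) : ∀ t < r, ∀ x ∈ seqMap g m η '' Icc e₀ e₁,
      ∀ y ∈ seqMap g m η '' Icc e₀ e₁,
      |seqMap g (r - (t + 1)) (fun k => η (k + (t + 1))) x -
        seqMap g (r - (t + 1)) (fun k => η (k + (t + 1))) y| ≤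
      |seqMap g (r - (t + 1) + m) (fun k => η (k + (t + 1))) e₀ -
        seqMap g (r - (t + 1) + m) (fun k => η (k + (t + 1))) e₁| := by
  rintro t ht _ ⟨x, hx, rfl⟩ _ ⟨y, hy, rfl⟩
  have h1 : seqMap g m η = seqMap g m (fun k => η (k + (r - (t + 1)) + (t + 1))) :=
    seqMap_congr fun k hk => by
      rw [show k + (r - (t + 1)) + (t + 1) = k + r by omega, hr.2.1 k hk]
  rw [h1, ← seqMap_add (g := g) (r - (t + 1)) m (fun k => η (k + (t + 1))),
    ← seqMap_add (g := g) (r - (t + 1)) m (fun k => η (k + (t + 1)))]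
  exact h.abs_seqMap_sub_le hx hy

/-- The constant depends neither on `m` nor on `r`, since the disjoint intermediate images have
total length at most `e₁ - e₀`. -/
theorem firstReturn_distUpper (h : IsIntervalIFS e₀ e₁ K g D) {η : ℕ → ι} {m r : ℕ}
    (hr : IsFirstReturn η m r) : DistUpper (seqMap g r η) (seqDeriv g D r η)
      (seqMap g m η '' Icc e₀ e₁) (Real.exp (K * (e₁ - e₀))) := by
  intro x hx y hy z hz
  refine (h.distUpper_of_sum h.seqMap_mapsTo.image_subset (h.firstReturn_abs_le hr) x hx y hy z
    hz).trans ?_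
  have := (h.seqDeriv_pos (n := r) (η := η) (h.seqMap_mapsTo.image_subset hz)).le
  have := h.K_nonneg
  gcongr
  exact h.firstReturn_sum_le hr

theorem firstReturn_distLower (h : IsIntervalIFS e₀ e₁ K g D) {η : ℕ → ι} {m r : ℕ}
    (hr : IsFirstReturn η m r) : DistLower (seqMap g r η) (seqDeriv g D r η)
      (seqMap g m η '' Icc e₀ e₁) (Real.exp (K * (e₁ - e₀))) := by
  intro x hx y hy z hz
  refine (h.distLower_of_sum h.seqMap_mapsTo.image_subset (h.firstReturn_abs_le hr) x hx y hy z
    hz).trans ?_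
  have := h.K_nonneg
  gcongr
  exact h.firstReturn_sum_le hr

/-- A common point of two different images is interior, and comes from end points. -/
theorem overlap (h : IsIntervalIFS e₀ e₁ K g D) {i j : ι} (hij : i ≠ j) {y z : ℝ}
    (hy : y ∈ Icc e₀ e₁) (hz : z ∈ Icc e₀ e₁) (hyz : g i y = g j z) :
    g i y ∈ Ioo e₀ e₁ ∧ (y = e₀ ∨ y = e₁) := by
  have hmem : ∀ (i : ι) (y : ℝ), y ∈ Icc e₀ e₁ →
      min (g i e₀) (g i e₁) ≤ g i y ∧ g i y ≤ max (g i e₀) (g i e₁) := by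
    intro i y hy
    rcases h.mono i with hm | hm
    · exact ⟨(min_le_left _ _).trans (hm.monotoneOn h.left_mem hy hy.1),
        (hm.monotoneOn hy h.right_mem hy.2).trans (le_max_right _ _)⟩
    · exact ⟨(min_le_right _ _).trans (hm.antitoneOn hy h.right_mem hy.2),
        (hm.antitoneOn h.left_mem hy hy.1).trans (le_max_left _ _)⟩
  have hlt : ∀ i : ι, min (g i e₀) (g i e₁) < max (g i e₀) (g i e₁) := by
    intro i
    rcases h.mono i with hm | hm
    · exact min_lt_max.2 (hm h.left_mem h.right_mem h.lt).ne
    · exact min_lt_max.2 (hm h.left_mem h.right_mem h.lt).ne'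
  have hdis : ∀ x, x ∈ Ioo (min (g i e₀) (g i e₁)) (max (g i e₀) (g i e₁)) →
      x ∉ Ioo (min (g j e₀) (g j e₁)) (max (g j e₀) (g j e₁)) := by
    intro x hx hx'
    have := h.uIoo_subset_image (n := 1) (η := fun _ => i) hx
    have := h.uIoo_subset_image (n := 1) (η := fun _ => j) hx'
    exact Set.disjoint_left.1 (h.disjoint i j hij) ‹_› ‹_›
  have hi := hmem i y hy
  have hj := hmem j z hz
  have hi0 : e₀ ≤ min (g i e₀) (g i e₁) :=
    le_min (h.mapsTo i h.left_mem).1 (h.mapsTo i h.right_mem).1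
  have hj0 : e₀ ≤ min (g j e₀) (g j e₁) :=
    le_min (h.mapsTo j h.left_mem).1 (h.mapsTo j h.right_mem).1
  have hi1 : max (g i e₀) (g i e₁) ≤ e₁ :=
    max_le (h.mapsTo i h.left_mem).2 (h.mapsTo i h.right_mem).2
  have hj1 : max (g j e₀) (g j e₁) ≤ e₁ :=
    max_le (h.mapsTo j h.left_mem).2 (h.mapsTo j h.right_mem).2
  rw [← hyz] at hj
  have hli := hlt i
  have hlj := hlt j
  set x := g i y with hx
  set a := min (g i e₀) (g i e₁) with ha
  set b := max (g i e₀) (g i e₁) with hb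
  set c := min (g j e₀) (g j e₁)
  set d := max (g j e₀) (g j e₁)
  have hcase : max a c < min b d → False := by
    intro hm
    obtain ⟨w, hw1, hw2⟩ := exists_between hm
    rw [max_lt_iff] at hw1
    rw [lt_min_iff] at hw2
    exact hdis w ⟨hw1.1, hw2.1⟩ ⟨hw1.2, hw2.2⟩
  -- Two nondegenerate intervals with disjoint interiors meet only where the upper end of one is the
  -- lower end of the other. Such a point is interior to `[e₀, e₁]`, which contains both.
  have h4 : (x = a ∧ x = d) ∨ (x = b ∧ x = c) := by
    by_contra hcon
    apply hcase
    rw [max_lt_iff, lt_min_iff, lt_min_iff]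
    grind
  have hinj : InjOn (g i) (Icc e₀ e₁) := (h.mono i).elim StrictMonoOn.injOn StrictAntiOn.injOn
  have hend : x = a ∨ x = b → y = e₀ ∨ y = e₁ := by
    intro hxe
    have : x = g i e₀ ∨ x = g i e₁ := by
      rcases hxe with hxe | hxe
      · rcases min_choice (g i e₀) (g i e₁) with hc | hc <;> grind
      · rcases max_choice (g i e₀) (g i e₁) with hc | hc <;> grind
    rcases this with hxe | hxe
    · exact Or.inl (hinj hy h.left_mem hxe)
    · exact Or.inr (hinj hy h.right_mem hxe)
  refine ⟨⟨?_, ?_⟩, hend (h4.imp And.left And.left)⟩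
  · rcases h4 with h4 | h4 <;> linarith [h4.1, h4.2]
  · rcases h4 with h4 | h4 <;> linarith [h4.1, h4.2]

/-- Only end points are mapped to end points. -/
theorem end_of_map_end (h : IsIntervalIFS e₀ e₁ K g D) {i : ι} {y : ℝ} (hy : y ∈ Icc e₀ e₁)
    (hgy : g i y = e₀ ∨ g i y = e₁) : y = e₀ ∨ y = e₁ := by
  by_contra hcon
  push Not at hcon
  have h0 : e₀ < y := lt_of_le_of_ne hy.1 (Ne.symm hcon.1)
  have h1 : y < e₁ := lt_of_le_of_ne hy.2 hcon.2
  have m0 := h.mapsTo i h.left_mem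
  have m1 := h.mapsTo i h.right_mem
  rcases h.mono i with hm | hm
  · have a1 := hm h.left_mem hy h0
    have a2 := hm hy h.right_mem h1
    rcases hgy with hg | hg <;> linarith [m0.1, m1.2]
  · have a1 := hm h.left_mem hy h0
    have a2 := hm hy h.right_mem h1
    rcases hgy with hg | hg <;> linarith [m0.2, m1.1]

/-- The points of a periodic orbit determine their letters. -/
theorem letter_unique (h : IsIntervalIFS e₀ e₁ K g D) {η : ℕ → ι} {x : ℕ → ℝ}
    (ho : IsOrbit e₀ e₁ g η x) {q : ℕ} (hq : 0 < q) (hx : ∀ k, x (k + q) = x k) {n : ℕ} {c : ι}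
    {z : ℝ} (hz : z ∈ Icc e₀ e₁) (hn : x n = g c z) : c = η n := by
  by_contra hne
  -- With two letters available, `x n` is interior and `x (n + 1)` is an end point. All later points
  -- are then end points, and by periodicity `x n` is one of them.
  have h1 := h.overlap (Ne.symm hne) (ho (n + 1)).1 hz ((ho n).2.symm.trans hn)
  rw [← (ho n).2] at h1
  have h2 : ∀ k, x (n + 1 + k) = e₀ ∨ x (n + 1 + k) = e₁ := by
    intro k
    induction k with
    | zero => exact h1.2
    | succ k ih =>
      refine h.end_of_map_end (i := η (n + 1 + k)) (ho _).1 ?_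
      have := (ho (n + 1 + k)).2
      rw [← add_assoc, ← this]
      exact ih
  have h3 := h2 (q - 1)
  rw [show n + 1 + (q - 1) = n + q by omega, hx] at h3
  rcases h3 with h3 | h3
  · exact h1.1.1.ne' h3
  · exact h1.1.2.ne h3

theorem D_le (h : IsIntervalIFS e₀ e₁ K g D) (i : ι) {z z' : ℝ} (hz : z ∈ Icc e₀ e₁)
    (hz' : z' ∈ Icc e₀ e₁) : D i z ≤ Real.exp (2 * K * |z - z'|) * D i z' := by
  rcases eq_or_ne z z' with rfl | hne
  · simp
  have h1 := h.le_dist i z hz z' hz' z hz |z - z'| (by simp) (abs_sub_comm z z' ▸ le_rfl)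
  have h2 := h.dist_le i z hz z' hz' z' hz' |z - z'| le_rfl (by simp)
  have hp : 0 < |z - z'| := abs_pos.2 (sub_ne_zero.2 hne)
  refine le_of_mul_le_mul_right (h1.trans ?_) hp
  refine (mul_le_mul_of_nonneg_left h2 (Real.exp_pos _).le).trans_eq ?_
  rw [show 2 * K * |z - z'| = K * |z - z'| + K * |z - z'| by ring, Real.exp_add]
  ring

/-- Bounded distortion turns a derivative above `κ` at one point into an image of length at least
`c`, and only finitely many images with disjoint interiors can be that long. -/
theorem finite_large (h : IsIntervalIFS e₀ e₁ K g D) {κ : ℝ} (hκ : 0 < κ) :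
    {i | ¬ ∀ y ∈ Icc e₀ e₁, D i y ≤ κ}.Finite := by
  have hl : 0 < e₁ - e₀ := sub_pos.2 h.lt
  set c := κ * (e₁ - e₀) / Real.exp (K * (e₁ - e₀)) with hc
  have hcpos : 0 < c := by positivity
  have hbig : ∀ i, (¬ ∀ y ∈ Icc e₀ e₁, D i y ≤ κ) → c ≤ |g i e₀ - g i e₁| := by
    intro i hi
    push Not at hi
    obtain ⟨y, hy, hD⟩ := hi
    have := h.le_dist i e₀ h.left_mem e₁ h.right_mem y hy (e₁ - e₀)
      (by rw [abs_le]; constructor <;> linarith [hy.1, hy.2])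
      (by rw [abs_le]; constructor <;> linarith [hy.1, hy.2])
    rw [hc, div_le_iff₀' (Real.exp_pos _)]
    refine le_trans ?_ this
    rw [abs_sub_comm, abs_of_pos hl]
    exact mul_le_mul_of_nonneg_right hD.le hl.le
  by_contra hinf
  obtain ⟨N, hN⟩ := exists_nat_gt ((e₁ - e₀) / c)
  obtain ⟨s, hs, hcard⟩ := Set.Infinite.exists_subset_card_eq hinf N
  have h1 := h.sum_length_le (s := s) (n := fun _ => 1) (η := fun i _ => i)
    (fun i _ j _ hij => h.disjoint i j hij)
  have h2 : ∑ i ∈ s, c ≤ ∑ i ∈ s, |seqMap g 1 (fun _ => i) e₀ - seqMap g 1 (fun _ => i) e₁| :=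
    Finset.sum_le_sum fun i hi => hbig i (hs hi)
  rw [Finset.sum_const, hcard, nsmul_eq_mul] at h2
  rw [div_lt_iff₀ hcpos] at hN
  linarith

end IsIntervalIFS

/-! ### Contraction near the end points -/

namespace IsIntervalIFS
variable {ι : Type*} {e₀ e₁ K : ℝ} {g D : ι → ℝ → ℝ}

/-- Weights of the end points for which the maps contract at the end points. -/
theorem exists_end_weight (h : IsIntervalIFS e₀ e₁ K g D) : ∃ w : ℝ → ℝ, 0 < w e₀ ∧ 0 < w e₁ ∧
    ∀ i e e', (e = e₀ ∨ e = e₁) → (e' = e₀ ∨ e' = e₁) → g i e = e' → w e' * D i e < w e := by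
  have huniq : ∀ i j, ∀ e ∈ Icc e₀ e₁, ∀ e' ∈ Icc e₀ e₁, g i e = g j e' →
      (g i e = e₀ ∨ g i e = e₁) → i = j := by
    intro i j e he e' he' hg hend
    by_contra hij
    have := (h.overlap hij he he' hg).1
    rcases hend with hend | hend
    · exact this.1.ne' hend
    · exact this.2.ne hend
  have h1 : ∀ i e, e ∈ Icc e₀ e₁ → g i e = e → D i e < 1 := by
    intro i e he hg
    simpa [seqDeriv, seqMap] using h.hyperbolic 1 one_pos (fun _ => i) e he (by simpa [seqMap])
  have h2 : ∀ i j, g i e₁ = e₀ → g j e₀ = e₁ → D i e₁ * D j e₀ < 1 := by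
    intro i j hi hj
    have := h.hyperbolic 2 two_pos (fun n => if n = 0 then i else j) e₀ h.left_mem
      (by simp [seqMap, hi, hj])
    simpa [seqDeriv, seqMap, hj] using this
  -- The weights are `1` at `e₀` and `t` at `e₁`. A letter sending `e₁` to `e₀` requires `D i e₁ <
  -- t`, one sending `e₀` to `e₁` requires `t * D j e₀ < 1`; each letter is unique, and if both
  -- exist they form a 2-cycle of multiplier less than `1`, which leaves room for `t`.
  obtain ⟨t, ht, hA, hB⟩ : ∃ t > 0, (∀ i, g i e₁ = e₀ → D i e₁ < t) ∧
      (∀ j, g j e₀ = e₁ → t * D j e₀ < 1) := by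
    by_cases hi : ∃ i, g i e₁ = e₀ <;> by_cases hj : ∃ j, g j e₀ = e₁
    · obtain ⟨i, hi⟩ := hi
      obtain ⟨j, hj⟩ := hj
      have hb := h.pos j e₀ h.left_mem
      have ha := h.pos i e₁ h.right_mem
      have hab := h2 i j hi hj
      have hlt : D i e₁ < 1 / D j e₀ := by rwa [lt_div_iff₀ hb]
      obtain ⟨t, ht1, ht2⟩ := exists_between hlt
      refine ⟨t, ha.trans ht1, fun i' hi' => ?_, fun j' hj' => ?_⟩
      · rwa [huniq i' i _ h.right_mem _ h.right_mem (hi'.trans hi.symm) (Or.inl hi')]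
      · rw [huniq j' j _ h.left_mem _ h.left_mem (hj'.trans hj.symm) (Or.inr hj')]
        rwa [lt_div_iff₀ hb] at ht2
    · obtain ⟨i, hi⟩ := hi
      have ha := h.pos i e₁ h.right_mem
      refine ⟨D i e₁ + 1, by linarith, fun i' hi' => ?_, fun j' hj' => absurd ⟨j', hj'⟩ hj⟩
      rw [huniq i' i _ h.right_mem _ h.right_mem (hi'.trans hi.symm) (Or.inl hi')]
      linarith
    · obtain ⟨j, hj⟩ := hj
      have hb := h.pos j e₀ h.left_mem
      refine ⟨1 / (2 * D j e₀), by positivity, fun i' hi' => absurd ⟨i', hi'⟩ hi,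
        fun j' hj' => ?_⟩
      rw [huniq j' j _ h.left_mem _ h.left_mem (hj'.trans hj.symm) (Or.inr hj')]
      field_simp
      norm_num
    · exact ⟨1, one_pos, fun i' hi' => absurd ⟨i', hi'⟩ hi, fun j' hj' => absurd ⟨j', hj'⟩ hj⟩
  have hne : e₁ ≠ e₀ := h.lt.ne'
  refine ⟨fun e => if e = e₀ then 1 else t, by simp, by simp [hne, ht], ?_⟩
  rintro i e e' (rfl | rfl) (rfl | rfl) hg
  · simpa using h1 i _ h.left_mem hg
  · simpa [hne] using hB i hg
  · simpa [hne] using hA i hg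
  · simpa [hne, ht] using h1 i _ h.right_mem hg

/-- Extends the weighted contraction from the end points to their `ε`-neighbourhoods uniformly in
the letter. Letters with derivative at most `κ` satisfy it outright. For each of the finitely many
others, either `g i e = e'` and the strict inequality persists, or `g i e ≠ e'` and for small `ε` no
point qualifies. -/
theorem exists_end_contraction (h : IsIntervalIFS e₀ e₁ K g D) : ∃ (w : ℝ → ℝ) (ε : ℝ),
    0 < w e₀ ∧ 0 < w e₁ ∧ 0 < ε ∧ ε < 1 ∧ ∀ i e e', (e = e₀ ∨ e = e₁) → (e' = e₀ ∨ e' = e₁) →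
      ∀ y ∈ Icc e₀ e₁, |y - e| ≤ ε → |g i y - e'| ≤ ε →
        Real.exp (2 * K * ε) * (w e' * D i y) ≤ (1 - ε) * w e := by
  obtain ⟨w, hw0, hw1, hw⟩ := h.exists_end_weight
  have hwpos : ∀ e, (e = e₀ ∨ e = e₁) → 0 < w e := by rintro e (rfl | rfl) <;> assumption
  have hmem : ∀ e, (e = e₀ ∨ e = e₁) → e ∈ Icc e₀ e₁ := by
    rintro e (rfl | rfl)
    exacts [h.left_mem, h.right_mem]
  have hK := h.K_nonneg
  obtain ⟨κ, hκ, hκ'⟩ : ∃ κ > 0, ∀ e e', (e = e₀ ∨ e = e₁) → (e' = e₀ ∨ e' = e₁) →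
      Real.exp (2 * K) * (w e' * κ) ≤ 1 / 2 * w e := by
    refine ⟨min (w e₀) (w e₁) / (2 * Real.exp (2 * K) * max (w e₀) (w e₁)), ?_, ?_⟩
    · have := lt_min hw0 hw1
      have := lt_max_of_lt_left (c := w e₁) hw0
      positivity
    · intro e e' he he'
      have a1 : min (w e₀) (w e₁) ≤ w e := by rcases he with rfl | rfl <;> simp
      have a2 : w e' ≤ max (w e₀) (w e₁) := by rcases he' with rfl | rfl <;> simp
      have a3 := hwpos e he
      have a4 := lt_max_of_lt_left (c := w e₁) hw0
      have a5 := lt_min hw0 hw1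
      calc _ = w e' * min (w e₀) (w e₁) / (2 * max (w e₀) (w e₁)) := by
            field_simp
        _ ≤ max (w e₀) (w e₁) * w e / (2 * max (w e₀) (w e₁)) := by gcongr
        _ = _ := by field_simp
  have hev : ∀ i ∈ {i | ¬ ∀ y ∈ Icc e₀ e₁, D i y ≤ κ}, ∀ᶠ ε in 𝓝[>] (0 : ℝ),
      ∀ e ∈ ({e₀, e₁} : Set ℝ), ∀ e' ∈ ({e₀, e₁} : Set ℝ), ∀ y ∈ Icc e₀ e₁, |y - e| ≤ ε →
        |g i y - e'| ≤ ε → Real.exp (2 * K * ε) * (w e' * D i y) ≤ (1 - ε) * w e := by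
    intro i _
    rw [Filter.eventually_all_finite (by simp)]
    intro e he
    rw [Filter.eventually_all_finite (by simp)]
    intro e' he'
    by_cases hg : g i e = e'
    · have hc : Filter.Tendsto (fun ε : ℝ => Real.exp (2 * K * ε) *
          (w e' * (Real.exp (2 * K * ε) * D i e)) - (1 - ε) * w e) (𝓝[>] 0)
          (𝓝 (Real.exp (2 * K * 0) * (w e' * (Real.exp (2 * K * 0) * D i e)) - (1 - 0) * w e)) := by
        refine (Continuous.tendsto ?_ 0).mono_left nhdsWithin_le_nhds
        fun_prop
      have hneg : Real.exp (2 * K * 0) * (w e' * (Real.exp (2 * K * 0) * D i e)) -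
          (1 - 0) * w e < 0 := by
        have := hw i e e' he he' hg
        simp only [mul_zero, Real.exp_zero, one_mul, sub_zero]
        linarith
      filter_upwards [hc.eventually (gt_mem_nhds hneg)] with ε hε y hy hye _
      refine le_trans ?_ (sub_neg.1 hε).le
      have a1 := h.D_le i hy (hmem e he)
      have a2 : Real.exp (2 * K * |y - e|) ≤ Real.exp (2 * K * ε) := by gcongr
      have a3 := (h.pos i e (hmem e he)).le
      have a4 := (hwpos e' he').le
      gcongr
      exact a1.trans (mul_le_mul_of_nonneg_right a2 a3)
    · have hpos : 0 < |g i e - e'| / 2 := by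
        have := abs_pos.2 (sub_ne_zero.2 hg)
        positivity
      obtain ⟨δ, hδ, hδ'⟩ := Metric.continuousWithinAt_iff.1
        (h.continuousOn i e (hmem e he)) _ hpos
      filter_upwards [Ioo_mem_nhdsGT (lt_min hδ hpos)] with ε hε y hy hye hge
      exfalso
      have a1 := hδ' hy (by
        rw [Real.dist_eq]
        exact hye.trans_lt (hε.2.trans_le (min_le_left _ _)))
      rw [Real.dist_eq] at a1
      have a2 := abs_sub_le (g i e) (g i y) e'
      rw [abs_sub_comm (g i e) (g i y)] at a2
      have := hε.2.trans_le (min_le_right _ _)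
      linarith
  rw [← Filter.eventually_all_finite (h.finite_large hκ)] at hev
  obtain ⟨ε, hε, hε0⟩ := (hev.and (Ioo_mem_nhdsGT (show (0 : ℝ) < 1 / 2 by norm_num))).exists
  refine ⟨w, ε, hw0, hw1, hε0.1, by linarith [hε0.2], ?_⟩
  intro i e e' he he' y hy hye hge
  by_cases hi : ∀ y ∈ Icc e₀ e₁, D i y ≤ κ
  · have a1 := hκ' e e' he he'
    have a2 := hi y hy
    have a3 := (hwpos e' he').le
    have a4 := (hwpos e he).le
    have a5 := h.pos i y hy
    calc _ ≤ Real.exp (2 * K) * (w e' * κ) := by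
          have : 2 * K * ε ≤ 2 * K := mul_le_of_le_one_right (by positivity) (by linarith [hε0.2])
          gcongr
      _ ≤ 1 / 2 * w e := a1
      _ ≤ _ := by gcongr; linarith [hε0.2]
  · exact hε i hi e he e' he' y hy hye hge

/-- A composition along which all points stay near the end points contracts exponentially. -/
theorem near_ends_abs_le (h : IsIntervalIFS e₀ e₁ K g D) {w : ℝ → ℝ} {ε : ℝ} (hε : ε < 1)
    (hw : ∀ e, (e = e₀ ∨ e = e₁) → 0 < w e)
    (hc : ∀ i e e', (e = e₀ ∨ e = e₁) → (e' = e₀ ∨ e' = e₁) →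
      ∀ y ∈ Icc e₀ e₁, |y - e| ≤ ε → |g i y - e'| ≤ ε →
        Real.exp (2 * K * ε) * (w e' * D i y) ≤ (1 - ε) * w e) {n : ℕ} :
    ∀ {η : ℕ → ι} {J : Set ℝ} {b : ℕ → ℝ}, J ⊆ Icc e₀ e₁ → (∀ t, b t = e₀ ∨ b t = e₁) →
      (∀ t ≤ n, ∀ y ∈ J, |seqMap g (n - t) (fun k => η (k + t)) y - b t| ≤ ε) →
      ∀ x ∈ J, ∀ y ∈ J, w (b 0) * |seqMap g n η x - seqMap g n η y| ≤
        (1 - ε) ^ n * w (b n) * |x - y| := by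
  induction n with
  | zero => intro η J b _ _ _ x _ y _; simp [seqMap]
  | succ n ih =>
    intro η J b hJ hb hnear x hx y hy
    have h1 := ih (η := fun k => η (k + 1)) (b := fun t => b (t + 1)) hJ (fun t => hb _) (by
      intro t ht y hy
      have := hnear (t + 1) (by omega) y hy
      rw [Nat.add_sub_add_right] at this
      simpa only [add_assoc] using this) x hx y hy
    have hm := h.seqMap_mapsTo (n := n) (η := fun k => η (k + 1))
    have hn0 := hnear 0 (by omega) x hx
    have hn1 := hnear 1 (by omega)
    simp only [Nat.sub_zero, add_zero, Nat.add_sub_cancel] at hn0 hn1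
    simp only [seqMap] at hn0 ⊢
    set u := seqMap g n (fun k => η (k + 1)) x
    set v := seqMap g n (fun k => η (k + 1)) y
    -- Both points are within `ε` of the same end point, so one step costs the distortion factor
    -- `exp (2 * K * ε)` that is built into `hc`.
    have huv : |v - u| ≤ 2 * ε := by
      have a1 := abs_sub_le v (b 1) u
      have a2 := hn1 x hx
      have a3 := hn1 y hy
      rw [abs_sub_comm] at a2
      linarith
    have hε0 : 0 ≤ ε := (abs_nonneg _).trans hn0
    have h2 := h.dist_le (η 0) u (hm (hJ hx)) v (hm (hJ hy)) u (hm (hJ hx)) (2 * ε)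
      (by simpa using hε0) huv
    have h3 := hc (η 0) (b 1) (b 0) (hb 1) (hb 0) u (hm (hJ hx)) (hn1 x hx) hn0
    have hw0 := (hw _ (hb 0)).le
    calc _ ≤ w (b 0) * (Real.exp (K * (2 * ε)) * D (η 0) u * |u - v|) := by gcongr
      _ = (Real.exp (2 * K * ε) * (w (b 0) * D (η 0) u)) * |u - v| := by
        rw [show K * (2 * ε) = 2 * K * ε by ring]; ring
      _ ≤ ((1 - ε) * w (b 1)) * |u - v| := by gcongr
      _ = (1 - ε) * (w (b 1) * |u - v|) := by ring
      _ ≤ (1 - ε) * ((1 - ε) ^ n * w (b (n + 1)) * |x - y|) := by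
        refine mul_le_mul_of_nonneg_left ?_ (by linarith)
        simpa [add_comm] using h1
      _ = _ := by ring

theorem near_ends_deriv_le (h : IsIntervalIFS e₀ e₁ K g D) {w : ℝ → ℝ} {ε : ℝ} (hε0 : 0 < ε)
    (hε : ε < 1) (hw : ∀ e, (e = e₀ ∨ e = e₁) → 0 < w e)
    (hc : ∀ i e e', (e = e₀ ∨ e = e₁) → (e' = e₀ ∨ e' = e₁) →
      ∀ y ∈ Icc e₀ e₁, |y - e| ≤ ε → |g i y - e'| ≤ ε →
        Real.exp (2 * K * ε) * (w e' * D i y) ≤ (1 - ε) * w e) {n : ℕ} {η : ℕ → ι} {x b : ℕ → ℝ}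
    (ho : IsOrbit e₀ e₁ g η x) (hb : ∀ t, b t = e₀ ∨ b t = e₁)
    (hnear : ∀ t ≤ n, |x t - b t| ≤ ε) :
    w (b 0) * seqDeriv g D n η (x n) ≤ (1 - ε) ^ n * w (b n) := by
  rw [ho.seqDeriv_eq]
  induction n with
  | zero => simp
  | succ n ih =>
    have h1 := ih (fun t ht => hnear t (by omega))
    have h3 := hc (η n) (b (n + 1)) (b n) (hb _) (hb _) (x (n + 1)) (ho _).1
      (hnear _ le_rfl) (by rw [← (ho n).2]; exact hnear n (by omega))
    have hD := h.pos (η n) _ (ho (n + 1)).1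
    have hexp : 1 ≤ Real.exp (2 * K * ε) :=
      Real.one_le_exp (mul_nonneg (mul_nonneg two_pos.le h.K_nonneg) hε0.le)
    have hwn := hw _ (hb n)
    rw [Finset.prod_range_succ, ← mul_assoc]
    calc _ ≤ (1 - ε) ^ n * w (b n) * D (η n) (x (n + 1)) := by gcongr
      _ = (1 - ε) ^ n * (w (b n) * D (η n) (x (n + 1))) := by ring
      _ ≤ (1 - ε) ^ n * (Real.exp (2 * K * ε) * (w (b n) * D (η n) (x (n + 1)))) := by
        refine mul_le_mul_of_nonneg_left ?_ (pow_nonneg (by linarith) n)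
        exact le_mul_of_one_le_left (mul_pos hwn hD).le hexp
      _ ≤ (1 - ε) ^ n * ((1 - ε) * w (b (n + 1))) := by gcongr
      _ = _ := by ring

end IsIntervalIFS

/-! ### Multipliers of long periodic orbits -/

namespace IsIntervalIFS
variable {ι : Type*} {e₀ e₁ K : ℝ} {g D : ι → ℝ → ℝ}

/-- A point of a periodic orbit in a cylinder around another point of the orbit. -/
theorem eq_of_mem_cylinder (h : IsIntervalIFS e₀ e₁ K g D) {η : ℕ → ι} {x : ℕ → ℝ}
    (ho : IsOrbit e₀ e₁ g η x) {q : ℕ} (hq : 0 < q) (hx : ∀ k, x (k + q) = x k) {k : ℕ} :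
    ∀ {n m : ℕ} {y : ℝ}, y ∈ Icc e₀ e₁ → x n = seqMap g k (fun j => η (j + m)) y →
      y = x (n + k) ∧ ∀ j < k, η (j + n) = η (j + m) := by
  induction k with
  | zero => intro n m y _ hy; exact ⟨hy.symm, fun j hj => absurd hj (by omega)⟩
  | succ k ih =>
    intro n m y hy hxn
    simp only [seqMap, zero_add] at hxn
    have h1 := h.letter_unique ho hq hx (h.seqMap_mapsTo hy) hxn
    have hinj : InjOn (g (η n)) (Icc e₀ e₁) :=
      (h.mono _).elim StrictMonoOn.injOn StrictAntiOn.injOn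
    have h2 : x (n + 1) = seqMap g k (fun j => η (j + 1 + m)) y := by
      refine hinj (ho _).1 (h.seqMap_mapsTo hy) ?_
      rw [← (ho n).2, hxn, h1]
    have h3 := ih (n := n + 1) (m := m + 1) hy (by
      rw [h2]
      simp only [add_assoc, add_comm m 1])
    refine ⟨by rw [h3.1]; congr 1; ring, fun j hj => ?_⟩
    rcases j with _ | j
    · simpa using h1.symm
    · have := h3.2 j (by omega)
      rw [show j + 1 + n = j + (n + 1) by ring, show j + 1 + m = j + (m + 1) by ring, this]

/-- The pulled back intervals may overlap, but each contains only one orbit point, `x t`. Cut at `x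
t`, the left parts are pairwise disjoint and so are the right parts: an overlap of two left parts
would put the smaller orbit point inside the other interval. Hence the factor `2`. -/
theorem isolated_sum_le (h : IsIntervalIFS e₀ e₁ K g D) {η : ℕ → ι} {x : ℕ → ℝ}
    (ho : IsOrbit e₀ e₁ g η x) {q : ℕ} (hx : ∀ k, x (k + q) = x k) (hinj : InjOn x (Iio q))
    {c : ℝ} (hc : c ≤ e₁) (h0 : x 0 < c) (hB : ∀ n, x n < c → x n = x 0) :
    ∑ t ∈ Finset.range q, |seqMap g (q - t) (fun k => η (k + t)) e₀ -
      seqMap g (q - t) (fun k => η (k + t)) c| ≤ 2 * (e₁ - e₀) := by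
  have hcI : c ∈ Icc e₀ e₁ := ⟨(ho 0).1.1.trans h0.le, hc⟩
  have hec : e₀ < c := (ho 0).1.1.trans_lt h0
  set S : ℕ → ℝ → ℝ := fun t => seqMap g (q - t) (fun k => η (k + t)) with hS
  have hxS : ∀ t < q, x t = S t (x 0) := by
    intro t ht
    have h1 := (ho.shift t).seqMap_eq (n := q - t)
    have h2 : x (q - t + t) = x 0 := by rw [Nat.sub_add_cancel ht.le, ← hx 0, zero_add]
    simp only [h2, zero_add] at h1
    exact h1.symm
  have honly : ∀ t < q, ∀ n, ∀ y ∈ Ico e₀ c, x n = S t y → x n = x t := by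
    intro t ht n y hy hn
    have hy' : y ∈ Icc e₀ e₁ := ⟨hy.1, hy.2.le.trans hc⟩
    have h1 := (h.eq_of_mem_cylinder ho (by omega) hx hy' hn).1
    have h2 := hB (n + (q - t)) (h1 ▸ hy.2)
    rw [hn, h1, h2, ← hxS t ht]
  have hmono : ∀ t, StrictMonoOn (S t) (Icc e₀ e₁) ∨ StrictAntiOn (S t) (Icc e₀ e₁) :=
    fun t => h.seqMap_mono
  have hcont : ∀ t, ContinuousOn (S t) (Icc e₀ c) := fun t =>
    h.seqMap_continuousOn.mono (Icc_subset_Icc_right hc)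
  have himg : ∀ t, uIoo (S t e₀) (S t c) ⊆ S t '' Ioo e₀ c := by
    intro t
    rcases hmono t with hm | hm
    · rw [uIoo_of_lt (hm h.left_mem hcI hec)]
      exact intermediate_value_Ioo hec.le (hcont t)
    · rw [uIoo_of_gt (hm h.left_mem hcI hec)]
      exact intermediate_value_Ioo' hec.le (hcont t)
  have hbetween : ∀ t < q, min (S t e₀) (S t c) ≤ x t ∧ x t ≤ max (S t e₀) (S t c) := by
    intro t ht
    rw [hxS t ht]
    rcases hmono t with hm | hm
    · exact ⟨(min_le_left _ _).trans (hm.monotoneOn h.left_mem (ho 0).1 (ho 0).1.1),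
        (hm.monotoneOn (ho 0).1 hcI h0.le).trans (le_max_right _ _)⟩
    · exact ⟨(min_le_right _ _).trans (hm.antitoneOn (ho 0).1 hcI h0.le),
        (hm.antitoneOn h.left_mem (ho 0).1 (ho 0).1.1).trans (le_max_left _ _)⟩
  have hsub : ∀ t, uIoo (S t e₀) (S t c) ⊆ Icc e₀ e₁ := fun t => (himg t).trans (by
    rintro _ ⟨y, hy, rfl⟩
    exact h.seqMap_mapsTo ⟨hy.1.le, hy.2.le.trans hc⟩)
  have hleft : ∀ t < q, uIoo (min (S t e₀) (S t c)) (x t) ⊆ uIoo (S t e₀) (S t c) := by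
    intro t ht
    rw [uIoo, uIoo, min_eq_left (hbetween t ht).1, max_eq_right (hbetween t ht).1]
    exact Ioo_subset_Ioo_right (hbetween t ht).2
  have hright : ∀ t < q, uIoo (x t) (max (S t e₀) (S t c)) ⊆ uIoo (S t e₀) (S t c) := by
    intro t ht
    rw [uIoo, uIoo, min_eq_left (hbetween t ht).2, max_eq_right (hbetween t ht).2]
    exact Ioo_subset_Ioo_left (hbetween t ht).1
  have hnot : ∀ t < q, ∀ t' < q, t ≠ t' → x t ∉ uIoo (S t' e₀) (S t' c) := by
    intro t ht t' ht' hne hmem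
    obtain ⟨y, hy, hyx⟩ := himg t' hmem
    exact hne (hinj ht ht' (honly t' ht' t y ⟨hy.1.le, hy.2⟩ hyx.symm))
  have hL : ∑ t ∈ Finset.range q, |min (S t e₀) (S t c) - x t| ≤ e₁ - e₀ := by
    refine sum_abs_sub_le_of_disjoint h.lt.le
      (fun t ht => (hleft t (Finset.mem_range.1 ht)).trans (hsub t)) ?_
    have key : ∀ t < q, ∀ t' < q, x t < x t' →
        Disjoint (uIoo (min (S t e₀) (S t c)) (x t)) (uIoo (min (S t' e₀) (S t' c)) (x t')) := by
      intro t ht t' ht' hlt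
      rw [Set.disjoint_left]
      intro y hy hy'
      refine hnot t ht t' ht' (by rintro rfl; exact hlt.false) (hleft t' ht' ?_)
      rw [uIoo, min_eq_left (hbetween t ht).1, max_eq_right (hbetween t ht).1] at hy
      rw [uIoo, min_eq_left (hbetween t' ht').1, max_eq_right (hbetween t' ht').1] at hy' ⊢
      exact ⟨hy'.1.trans hy.2, hlt⟩
    intro t ht t' ht' hne
    rw [Finset.mem_range] at ht ht'
    rcases lt_or_gt_of_ne (fun he => hne (hinj ht ht' he)) with hlt | hlt
    · exact key t ht t' ht' hlt
    · exact (key t' ht' t ht hlt).symm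
  have hR : ∑ t ∈ Finset.range q, |x t - max (S t e₀) (S t c)| ≤ e₁ - e₀ := by
    refine sum_abs_sub_le_of_disjoint h.lt.le
      (fun t ht => (hright t (Finset.mem_range.1 ht)).trans (hsub t)) ?_
    have key : ∀ t < q, ∀ t' < q, x t < x t' →
        Disjoint (uIoo (x t) (max (S t e₀) (S t c))) (uIoo (x t') (max (S t' e₀) (S t' c))) := by
      intro t ht t' ht' hlt
      rw [Set.disjoint_left]
      intro y hy hy'
      refine hnot t' ht' t ht (by rintro rfl; exact hlt.false) (hright t ht ?_)
      rw [uIoo, min_eq_left (hbetween t ht).2, max_eq_right (hbetween t ht).2] at hy ⊢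
      rw [uIoo, min_eq_left (hbetween t' ht').2, max_eq_right (hbetween t' ht').2] at hy'
      exact ⟨hlt, hy'.1.trans hy.2⟩
    intro t ht t' ht' hne
    rw [Finset.mem_range] at ht ht'
    rcases lt_or_gt_of_ne (fun he => hne (hinj ht ht' he)) with hlt | hlt
    · exact key t ht t' ht' hlt
    · exact (key t' ht' t ht hlt).symm
  have hsum : ∀ t ∈ Finset.range q, |S t e₀ - S t c| =
      |min (S t e₀) (S t c) - x t| + |x t - max (S t e₀) (S t c)| := by
    intro t ht
    have hb := hbetween t (Finset.mem_range.1 ht)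
    rw [abs_sub_comm, ← max_sub_min_eq_abs', abs_of_nonpos (by linarith), abs_of_nonpos (by linarith),
      max_comm, min_comm]
    ring
  rw [Finset.sum_congr rfl hsum, Finset.sum_add_distrib]
  linarith

/-- Of the constant `3`, two units come from `isolated_sum_le` and one from the interval `[e₀, c)`
itself, which is the term with index `q`. -/
theorem isolated_distLower (h : IsIntervalIFS e₀ e₁ K g D) {η : ℕ → ι} {x : ℕ → ℝ}
    (ho : IsOrbit e₀ e₁ g η x) {q : ℕ} (hx : ∀ k, x (k + q) = x k) (hinj : InjOn x (Iio q))
    {c : ℝ} (hc : c ≤ e₁) (h0 : x 0 < c) (hB : ∀ n, x n < c → x n = x 0) {s : ℕ} (hs : s ≤ q) :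
    DistLower (seqMap g (q - s) (fun k => η (k + s))) (seqDeriv g D (q - s) (fun k => η (k + s)))
      (Ico e₀ c) (Real.exp (K * (3 * (e₁ - e₀)))) := by
  have hcI : c ∈ Icc e₀ e₁ := ⟨(ho 0).1.1.trans h0.le, hc⟩
  have hsub : Ico e₀ c ⊆ Icc e₀ e₁ := fun y hy => ⟨hy.1, hy.2.le.trans hc⟩
  set L : ℕ → ℝ := fun t => |seqMap g (q - t) (fun k => η (k + t)) e₀ -
      seqMap g (q - t) (fun k => η (k + t)) c| with hL
  have hLq : L q ≤ e₁ - e₀ := by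
    simp only [hL, Nat.sub_self, seqMap]
    rw [abs_sub_comm, abs_of_nonneg (by linarith [hcI.1])]
    linarith
  have hsum : ∑ t ∈ Finset.range (q - s), L (s + t + 1) ≤ 3 * (e₁ - e₀) := by
    calc ∑ t ∈ Finset.range (q - s), L (s + t + 1)
        = ∑ t ∈ Finset.Ico (s + 1) (q + 1), L t := by
          rw [Finset.sum_Ico_eq_sum_range]
          refine Finset.sum_congr (by congr 1; omega) fun t _ => by congr 1; ring
      _ ≤ ∑ t ∈ Finset.range (q + 1), L t :=
          Finset.sum_le_sum_of_subset_of_nonneg (fun t ht => by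
            rw [Finset.mem_Ico] at ht
            exact Finset.mem_range.2 ht.2) (fun _ _ _ => abs_nonneg _)
      _ ≤ _ := by
          rw [Finset.sum_range_succ]
          linarith [h.isolated_sum_le ho hx hinj hc h0 hB]
  intro a ha b hb z hz
  refine (h.distLower_of_sum (l := fun t => L (s + t + 1)) hsub ?_ a ha b hb z hz).trans ?_
  · intro t ht u hu v hv
    simp only [hL]
    rw [show q - (s + t + 1) = q - s - (t + 1) by omega]
    simp only [add_assoc, add_comm (t + 1) s]
    have key : ∀ {f : ℝ → ℝ}, (StrictMonoOn f (Icc e₀ e₁) ∨ StrictAntiOn f (Icc e₀ e₁)) →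
        |f u - f v| ≤ |f e₀ - f c| := by
      rintro f (hm | hm)
      · have a1 := hm.monotoneOn h.left_mem (hsub hu) hu.1
        have a2 := hm.monotoneOn h.left_mem (hsub hv) hv.1
        have a3 := hm.monotoneOn (hsub hu) hcI hu.2.le
        have a4 := hm.monotoneOn (hsub hv) hcI hv.2.le
        rw [abs_sub_comm (f e₀), abs_of_nonneg (sub_nonneg.2 (a1.trans a3)), abs_le]
        constructor <;> linarith
      · have a1 := hm.antitoneOn h.left_mem (hsub hu) hu.1
        have a2 := hm.antitoneOn h.left_mem (hsub hv) hv.1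
        have a3 := hm.antitoneOn (hsub hu) hcI hu.2.le
        have a4 := hm.antitoneOn (hsub hv) hcI hv.2.le
        rw [abs_of_nonneg (sub_nonneg.2 (a3.trans a1)), abs_le]
        constructor <;> linarith
    exact key h.seqMap_mono
  · have := h.K_nonneg
    gcongr

end IsIntervalIFS

/-- The forward images of a set `B` along a sequence of branches. -/
def forwardSet {ι : Type*} (e₀ e₁ : ℝ) (g : ι → ℝ → ℝ) (η : ℕ → ι) (B : Set ℝ) : ℕ → Set ℝ
  | 0 => B
  | s + 1 => {y | y ∈ Icc e₀ e₁ ∧ g (η s) y ∈ forwardSet e₀ e₁ g η B s}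

theorem prod_range_add_of_periodic {f : ℕ → ℝ} {q : ℕ} (hf : ∀ k, f (k + q) = f k) (s : ℕ) :
    ∏ k ∈ Finset.range q, f (k + s) = ∏ k ∈ Finset.range q, f k := by
  induction s with
  | zero => rfl
  | succ s ih =>
    rw [← ih]
    rcases q with _ | q
    · rfl
    · rw [Finset.prod_range_succ, Finset.prod_range_succ' (fun k => f (k + s))]
      congr 1
      · exact Finset.prod_congr rfl fun k _ => by rw [add_right_comm k 1 s, add_assoc]
      · rw [show q + (s + 1) = 0 + s + (q + 1) by ring, hf]

theorem IsOrbit.seqDeriv_rotate {ι : Type*} {e₀ e₁ : ℝ} {g D : ι → ℝ → ℝ} {η : ℕ → ι} {x : ℕ → ℝ}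
    (ho : IsOrbit e₀ e₁ g η x) {q : ℕ} (hη : ∀ k, η (k + q) = η k) (hx : ∀ k, x (k + q) = x k)
    (s : ℕ) : seqDeriv g D q (fun k => η (k + s)) (x s) = seqDeriv g D q η (x q) := by
  have e1 := (ho.shift s).seqDeriv_eq (D := D) (n := q)
  rw [show x (q + s) = x s by rw [add_comm, hx]] at e1
  rw [ho.seqDeriv_eq, e1]
  simp only [add_right_comm _ 1 s]
  refine prod_range_add_of_periodic (f := fun k => D (η k) (x (k + 1))) (fun k => ?_) s
  rw [hη, show k + q + 1 = k + 1 + q by ring, hx]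

namespace IsIntervalIFS
variable {ι : Type*} {e₀ e₁ K : ℝ} {g D : ι → ℝ → ℝ}

theorem seqMap_mem_forwardSet {η : ℕ → ι} {B : Set ℝ} {k : ℕ} : ∀ {t : ℕ} {y : ℝ},
    y ∈ forwardSet e₀ e₁ g η B (t + k) →
      seqMap g k (fun j => η (j + t)) y ∈ forwardSet e₀ e₁ g η B t := by
  induction k with
  | zero => intro t y hy; exact hy
  | succ k ih =>
    intro t y hy
    have h1 := ih (t := t + 1) (y := y) (by rwa [show t + 1 + k = t + (k + 1) by ring])
    simp only [seqMap, zero_add]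
    have h2 := h1.2
    simpa only [add_assoc, add_comm 1 t] using h2

theorem ordConnected_forwardSet (h : IsIntervalIFS e₀ e₁ K g D) {η : ℕ → ι} {B : Set ℝ}
    (hB : B.OrdConnected) (s : ℕ) : (forwardSet e₀ e₁ g η B s).OrdConnected := by
  induction s with
  | zero => exact hB
  | succ s ih =>
    refine ⟨fun a ha b hb y hy => ?_⟩
    have hyI : y ∈ Icc e₀ e₁ := ⟨ha.1.1.trans hy.1, hy.2.trans hb.1.2⟩
    refine ⟨hyI, ?_⟩
    rcases h.mono (η s) with hm | hm
    · exact ih.out ha.2 hb.2 ⟨hm.monotoneOn ha.1 hyI hy.1, hm.monotoneOn hyI hb.1 hy.2⟩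
    · exact ih.out hb.2 ha.2 ⟨hm.antitoneOn hyI hb.1 hy.2, hm.antitoneOn ha.1 hyI hy.1⟩

/-- The image of `[e₀, e₁]` under `g (η s)` contains `x s`. On the side of `e`, its end lies between
`x s` and `e`, hence in the interval of step `s`, and its preimage is an end point in the next one.
So a forward image with a point far from this end point is long. -/
theorem end_mem_forwardSet (h : IsIntervalIFS e₀ e₁ K g D) {η : ℕ → ι} {x : ℕ → ℝ} {B : Set ℝ}
    (ho : IsOrbit e₀ e₁ g η x) (hB : B.OrdConnected) (hBI : B ⊆ Icc e₀ e₁) (h0 : x 0 ∈ B)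
    (he : e₀ ∈ B) (s : ℕ) : forwardSet e₀ e₁ g η B s ⊆ Icc e₀ e₁ ∧
      x s ∈ forwardSet e₀ e₁ g η B s ∧
      ∃ e, (e = e₀ ∨ e = e₁) ∧ e ∈ forwardSet e₀ e₁ g η B s := by
  induction s with
  | zero => exact ⟨hBI, h0, e₀, Or.inl rfl, he⟩
  | succ s ih =>
    obtain ⟨hI, hxs, e, he, hes⟩ := ih
    have hx : g (η s) (x (s + 1)) = x s := (ho s).2.symm
    have hxI := (ho (s + 1)).1
    refine ⟨fun y hy => hy.1, ⟨hxI, hx ▸ hxs⟩, ?_⟩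
    have hoc := h.ordConnected_forwardSet (η := η) hB s
    have m0 := h.mapsTo (η s) h.left_mem
    have m1 := h.mapsTo (η s) h.right_mem
    rcases h.mono (η s) with hm | hm
    · have a1 := hm.monotoneOn h.left_mem hxI hxI.1
      have a2 := hm.monotoneOn hxI h.right_mem hxI.2
      rw [hx] at a1 a2
      rcases he with rfl | rfl
      · exact ⟨_, Or.inl rfl, h.left_mem, hoc.out hes hxs ⟨m0.1, a1⟩⟩
      · exact ⟨_, Or.inr rfl, h.right_mem, hoc.out hxs hes ⟨a2, m1.2⟩⟩
    · have a1 := hm.antitoneOn h.left_mem hxI hxI.1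
      have a2 := hm.antitoneOn hxI h.right_mem hxI.2
      rw [hx] at a1 a2
      rcases he with rfl | rfl
      · exact ⟨_, Or.inr rfl, h.right_mem, hoc.out hes hxs ⟨m1.1, a2⟩⟩
      · exact ⟨_, Or.inl rfl, h.left_mem, hoc.out hxs hes ⟨a1, m0.2⟩⟩

theorem geom_sum_reflect_le {ε C : ℝ} (hε : 0 < ε) (hε1 : ε < 1) (hC : 0 ≤ C) (n : ℕ) :
    ∑ t ∈ Finset.range n, (1 - ε) ^ (n - (t + 1)) * C ≤ C / ε := by
  rw [← Finset.sum_mul, div_eq_inv_mul]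
  refine mul_le_mul_of_nonneg_right ?_ hC
  have h1 := Finset.sum_range_reflect (fun j => (1 - ε) ^ j) n
  have h2 : ∑ t ∈ Finset.range n, (1 - ε) ^ (n - (t + 1)) = ∑ j ∈ Finset.range n, (1 - ε) ^ j := by
    rw [← h1]
    refine Finset.sum_congr rfl fun j _ => by congr 1; omega
  rw [h2]
  have h4 := mul_neg_geom_sum (1 - ε) n
  rw [sub_sub_cancel] at h4
  rw [← one_div, le_div_iff₀ hε, mul_comm, h4]
  have := pow_nonneg (show 0 ≤ 1 - ε by linarith) n
  linarith

/-- The multipliers of long periodic orbits are uniformly small: minimal point first. -/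
theorem periodic_deriv_le_aux (h : IsIntervalIFS e₀ e₁ K g D) : ∀ δ > 0, ∃ R : ℕ, ∀ q ≥ R,
    ∀ (η : ℕ → ι) (x : ℕ → ℝ), IsOrbit e₀ e₁ g η x → (∀ k, η (k + q) = η k) →
      (∀ k, x (k + q) = x k) → InjOn x (Iio q) → (∀ k, x 0 ≤ x k) →
      seqDeriv g D q η (x q) ≤ δ := by
  intro δ hδ
  obtain ⟨w, ε, hw0, hw1, hε, hε1, hc⟩ := h.exists_end_contraction
  have hw : ∀ e, (e = e₀ ∨ e = e₁) → 0 < w e := by rintro e (rfl | rfl) <;> assumption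
  set C := max (w e₀) (w e₁) / min (w e₀) (w e₁) with hC
  have hmin := lt_min hw0 hw1
  have hmax := lt_max_of_lt_left (c := w e₁) hw0
  have hCpos : 0 < C := div_pos hmax hmin
  have hratio : ∀ e e', (e = e₀ ∨ e = e₁) → (e' = e₀ ∨ e' = e₁) → w e ≤ C * w e' := by
    intro e e' he he'
    have a1 : w e ≤ max (w e₀) (w e₁) := by rcases he with rfl | rfl <;> simp
    have a2 : min (w e₀) (w e₁) ≤ w e' := by rcases he' with rfl | rfl <;> simp
    rw [hC, div_mul_eq_mul_div, le_div_iff₀ hmin]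
    exact mul_le_mul a1 a2 hmin.le hmax.le
  have hl : 0 < e₁ - e₀ := sub_pos.2 h.lt
  -- The three factors account for the isolated part of the orbit, the part near the end points, and
  -- the single step leaving their neighbourhoods.
  set A := Real.exp (K * (3 * (e₁ - e₀))) *
    (Real.exp (K * (C * (e₁ - e₀) / ε)) * Real.exp (K * (e₁ - e₀))) with hA
  have hApos : 0 < A := by positivity
  obtain ⟨N, hN⟩ := h.shrink (δ * ε / A) (by positivity)
  obtain ⟨N', hN'⟩ := exists_pow_lt_of_lt_one (show 0 < δ / C by positivity)
    (show 1 - ε < 1 by linarith)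
  refine ⟨max (max N N') 2, fun q hq η x ho hη hx hinj hmin0 => ?_⟩
  have hq2 : 2 ≤ q := (le_max_right _ _).trans hq
  have hqN : N ≤ q := (le_max_left _ _).trans ((le_max_left _ _).trans hq)
  have hqN' : N' ≤ q := (le_max_right _ _).trans ((le_max_left _ _).trans hq)
  have hxq : x q = x 0 := by simpa using hx 0
  have hxmod : ∀ n, x n = x (n % q) := by
    intro n
    exact (Function.Periodic.map_mod_nat (f := x) hx n).symm
  -- the next point of the orbit
  have hne : (Finset.Ioo 0 q).Nonempty := ⟨1, by simp; omega⟩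
  obtain ⟨m, hm, hmle⟩ := Finset.exists_min_image (Finset.Ioo 0 q) x hne
  rw [Finset.mem_Ioo] at hm
  set c := x m with hcdef
  have hcle : c ≤ e₁ := (ho m).1.2
  have h0c : x 0 < c := lt_of_le_of_ne (hmin0 m) fun he =>
    hm.1.ne (hinj (show 0 < q by omega) hm.2 he)
  have honly : ∀ n, x n < c → x n = x 0 := by
    intro n hn
    rw [hxmod] at hn ⊢
    rcases Nat.eq_zero_or_pos (n % q) with h0 | h0
    · rw [h0]
    · exact absurd (hmle (n % q) (Finset.mem_Ioo.2 ⟨h0, Nat.mod_lt _ (by omega)⟩)) hn.not_ge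
  -- Cut at the next point `c` of the orbit, `B` contains `x 0` as its only orbit point. Its forward
  -- images are followed until one is no longer within `ε` of a single end point.
  set B := Ico e₀ c with hBdef
  have hBI : B ⊆ Icc e₀ e₁ := fun y hy => ⟨hy.1, hy.2.le.trans hcle⟩
  set E := forwardSet e₀ e₁ g η B with hE
  have hEprop := h.end_mem_forwardSet ho ordConnected_Ico hBI ⟨(ho 0).1.1, h0c⟩
    ⟨le_rfl, (ho 0).1.1.trans_lt h0c⟩
  by_cases hall : ∀ s ≤ q, ∃ e, (e = e₀ ∨ e = e₁) ∧ ∀ y ∈ E s, |y - e| ≤ ε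
  · -- the whole orbit is close to the end points
    choose b' hb' hnear' using hall
    set b : ℕ → ℝ := fun s => if hs : s ≤ q then b' s hs else e₀ with hb
    have hbend : ∀ s, b s = e₀ ∨ b s = e₁ := by
      intro s
      simp only [hb]
      split_ifs with hs
      · exact hb' s hs
      · exact Or.inl rfl
    have h1 := h.near_ends_deriv_le hε hε1 hw hc (n := q) ho hbend (fun t ht => by
      simp only [hb, dif_pos ht]
      exact hnear' t ht _ (hEprop t).2.1)
    have h2 : (1 - ε) ^ q ≤ δ / C :=
      (pow_le_pow_of_le_one (by linarith) (by linarith) hqN').trans hN'.le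
    have h3 := hratio (b q) (b 0) (hbend _) (hbend _)
    have h4 := hw _ (hbend 0)
    have h5 : w (b 0) * seqDeriv g D q η (x q) ≤ w (b 0) * δ := by
      refine h1.trans ?_
      calc (1 - ε) ^ q * w (b q) ≤ δ / C * (C * w (b 0)) := by
            gcongr
            exact (hw _ (hbend q)).le
        _ = _ := by field_simp
    exact le_of_mul_le_mul_left h5 h4
  · classical
    -- the first large forward image
    have hex : ∃ s, s ≤ q ∧ ¬ ∃ e, (e = e₀ ∨ e = e₁) ∧ ∀ y ∈ E s, |y - e| ≤ ε := by
      push Not at hall ⊢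
      exact hall
    obtain ⟨hsq, hbig⟩ := Nat.find_spec hex
    have hlt : ∀ t < Nat.find hex, ∃ e, (e = e₀ ∨ e = e₁) ∧ ∀ y ∈ E t, |y - e| ≤ ε := by
      intro t ht
      by_contra hcon
      exact Nat.find_min hex ht ⟨by omega, hcon⟩
    generalize Nat.find hex = s at hsq hbig hlt
    obtain ⟨hEI, hxs, e, he, heE⟩ := hEprop s
    obtain ⟨y, hyE, hyε⟩ : ∃ y ∈ E s, ε < |y - e| := by
      by_contra hcon
      push Not at hcon
      exact hbig ⟨e, he, hcon⟩
    have hlow2 : DistLower (seqMap g s η) (seqDeriv g D s η) (E s)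
        (Real.exp (K * (C * (e₁ - e₀) / ε)) * Real.exp (K * (e₁ - e₀))) := by
      have hK := h.K_nonneg
      rcases s with _ | n
      · intro a _ b _ z _
        simp only [seqMap, seqDeriv, one_mul]
        rw [← Real.exp_add]
        exact le_mul_of_one_le_left (abs_nonneg _) (Real.one_le_exp (by positivity))
      · refine h.distLower_comp (m := n) (n := 1) hEI (Real.exp_pos _).le ?_ ?_
        · -- near the end points
          have hJ : seqMap g 1 (fun k => η (k + n)) '' E (n + 1) ⊆ E n := by
            rintro _ ⟨u, hu, rfl⟩
            exact seqMap_mem_forwardSet hu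
          have hJI : seqMap g 1 (fun k => η (k + n)) '' E (n + 1) ⊆ Icc e₀ e₁ :=
            hJ.trans (hEprop n).1
          choose b' hb' hnear' using hlt
          set b : ℕ → ℝ := fun s => if hs : s < n + 1 then b' s hs else e₀ with hb
          have hbend : ∀ s, b s = e₀ ∨ b s = e₁ := by
            intro s
            simp only [hb]
            split_ifs with hs
            · exact hb' s hs
            · exact Or.inl rfl
          have hnear : ∀ t ≤ n, ∀ u ∈ seqMap g 1 (fun k => η (k + n)) '' E (n + 1),
              |seqMap g (n - t) (fun k => η (k + t)) u - b t| ≤ ε := by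
            intro t ht u hu
            simp only [hb, dif_pos (show t < n + 1 by omega)]
            refine hnear' t (by omega) _ (seqMap_mem_forwardSet ?_)
            rw [show t + (n - t) = n by omega]
            exact hJ hu
          intro u hu v hv z hz
          -- Near the end points the weighted lengths contract geometrically, so they have a sum
          -- independent of the period.
          refine (h.distLower_of_sum (l := fun t => (1 - ε) ^ (n - (t + 1)) * (C * (e₁ - e₀))) hJI
            ?_ u hu v hv z hz).trans ?_
          · intro t ht u hu v hv
            have h1 := h.near_ends_abs_le hε1 hw hc (n := n - (t + 1))
              (η := fun k => η (k + (t + 1))) (b := fun k => b (k + (t + 1))) hJI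
              (fun k => hbend _) (by
                intro t' ht' u hu
                have := hnear (t + 1 + t') (by omega) u hu
                rw [show n - (t + 1 + t') = n - (t + 1) - t' by omega] at this
                simpa only [add_assoc, add_comm, add_left_comm] using this) u hu v hv
            simp only [zero_add] at h1
            have hwb := hw _ (hbend (t + 1))
            refine le_of_mul_le_mul_left (h1.trans ?_) hwb
            have h2 := hratio (b (n - (t + 1) + (t + 1))) (b (t + 1)) (hbend _) (hbend _)
            have h3 : |u - v| ≤ e₁ - e₀ := by
              have := hJI hu
              have := hJI hv
              rw [abs_le]
              constructor <;> linarith [(hJI hu).1, (hJI hu).2, (hJI hv).1, (hJI hv).2]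
            have h4 : 0 ≤ (1 - ε) ^ (n - (t + 1)) := pow_nonneg (by linarith) _
            calc _ ≤ (1 - ε) ^ (n - (t + 1)) * (C * w (b (t + 1))) * (e₁ - e₀) := by gcongr
              _ = _ := by ring
          · gcongr
            exact geom_sum_reflect_le hε hε1 (by positivity) n
        · -- one more step
          intro u hu v hv z hz
          refine (h.distLower_of_sum (n := 1) (l := fun _ => e₁ - e₀) hEI ?_ u hu v hv z hz).trans ?_
          · intro t ht u hu v hv
            obtain rfl : t = 0 := by omega
            simp only [zero_add, Nat.sub_self, seqMap]
            rw [_root_.abs_le]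
            constructor <;> linarith [(hEI hu).1, (hEI hu).2, (hEI hv).1, (hEI hv).2]
          · simp
    have hηq : (fun k => η (k + (q - s) + s)) = η := by
      funext k
      rw [show k + (q - s) + s = k + q by omega, hη]
    have hlow1 : DistLower (seqMap g (q - s) (fun k => η (k + s)))
        (seqDeriv g D (q - s) (fun k => η (k + s)))
        (seqMap g s (fun k => η (k + (q - s) + s)) '' E s) (Real.exp (K * (3 * (e₁ - e₀)))) := by
      intro u hu v hv z hz
      have himg : seqMap g s (fun k => η (k + (q - s) + s)) '' E s ⊆ Ico e₀ c := by
        rw [hηq]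
        rintro _ ⟨u, hu, rfl⟩
        exact seqMap_mem_forwardSet (t := 0) (by rwa [zero_add])
      exact h.isolated_distLower ho hx hinj hcle h0c honly hsq u (himg hu) v (himg hv) z (himg hz)
    have hlow := h.distLower_comp (m := q - s) (n := s) (η := fun k => η (k + s)) hEI
      (B := Real.exp (K * (C * (e₁ - e₀) / ε)) *
        Real.exp (K * (e₁ - e₀))) (by positivity) hlow1 (by rw [hηq]; exact hlow2)
    -- The points `y` and `e` are more than `ε` apart, yet the composition along a full period
    -- brings them within `δ * ε / A`; the lower distortion bound converts this into a bound for the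
    -- multiplier.
    have h1 := hlow y hyE e heE (x s) hxs
    rw [Nat.sub_add_cancel hsq] at h1
    have hrot := ho.seqDeriv_rotate (D := D) hη hx s
    rw [hrot] at h1
    have h2 : |seqMap g q (fun k => η (k + s)) y - seqMap g q (fun k => η (k + s)) e| ≤ δ * ε / A :=
      (h.abs_seqMap_sub_le (hEI hyE) (hEI heE)).trans (hN q hqN _)
    have h3 : seqDeriv g D q η (x q) * ε ≤ δ * ε := by
      have hp := (h.seqDeriv_pos (n := q) (η := η) (ho q).1).le
      calc _ ≤ seqDeriv g D q η (x q) * |y - e| := by gcongr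
        _ ≤ A * (δ * ε / A) := h1.trans (mul_le_mul_of_nonneg_left h2 hApos.le)
        _ = _ := by field_simp
    exact le_of_mul_le_mul_right h3 hε

/-- The multipliers of long periodic orbits are uniformly small. -/
theorem periodic_deriv_le (h : IsIntervalIFS e₀ e₁ K g D) : ∀ δ > 0, ∃ R : ℕ, ∀ q ≥ R,
    ∀ (η : ℕ → ι) (x : ℕ → ℝ), IsOrbit e₀ e₁ g η x → (∀ k, η (k + q) = η k) →
      (∀ k, x (k + q) = x k) → InjOn x (Iio q) → seqDeriv g D q η (x q) ≤ δ := by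
  intro δ hδ
  obtain ⟨R, hR⟩ := h.periodic_deriv_le_aux δ hδ
  refine ⟨max R 1, fun q hq η x ho hη hx hinj => ?_⟩
  have hq1 : 0 < q := (le_max_right R 1).trans hq
  have hmod : ∀ n, x n = x (n % q) := fun n =>
    (Function.Periodic.map_mod_nat (f := x) hx n).symm
  obtain ⟨l, -, hl⟩ := Finset.exists_min_image (Finset.range q) x ⟨0, Finset.mem_range.2 hq1⟩
  rw [← ho.seqDeriv_rotate hη hx l]
  have h1 := hR q ((le_max_left R 1).trans hq) _ _ (ho.shift l)
    (fun k => by rw [add_right_comm, hη]) (fun k => by rw [add_right_comm, hx]) ?_ ?_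
  · rwa [add_comm q l, hx] at h1
  · intro i hi j hj hij
    simp only at hij
    rw [hmod (i + l), hmod (j + l)] at hij
    have h2 : (i + l) % q = (j + l) % q := hinj (Nat.mod_lt _ hq1) (Nat.mod_lt _ hq1) hij
    exact Nat.ModEq.eq_of_lt_of_lt (Nat.ModEq.add_right_cancel' l h2) hi hj
  · intro k
    simp only [zero_add]
    rw [hmod (k + l)]
    exact hl _ (Finset.mem_range.2 (Nat.mod_lt _ hq1))

end IsIntervalIFS

/-! ### Contraction of first returns -/

/-- The first returns to the cylinder of the first `m` letters of `η` contract by `ρ`. -/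
def IsReturnContracting {ι : Type*} (e₀ e₁ : ℝ) (g D : ι → ℝ → ℝ) (η : ℕ → ι) (m : ℕ) (ρ : ℝ) :
    Prop :=
  ∀ ζ : ℕ → ι, (∀ k < m, ζ k = η k) → ∀ r, IsFirstReturn ζ m r →
    ∀ y ∈ seqMap g m ζ '' Icc e₀ e₁, seqDeriv g D r ζ y ≤ ρ

namespace IsIntervalIFS
variable {ι : Type*} {e₀ e₁ K : ℝ} {g D : ι → ℝ → ℝ}

/-- Both distortion bounds are applied to the two ends of the cylinder; comparing them relates the
derivatives at any two of its points. -/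
theorem seqDeriv_le_of_dist {n m : ℕ} {η : ℕ → ι} (h : IsIntervalIFS e₀ e₁ K g D) {A y p : ℝ}
    (hA : 0 ≤ A)
    (h1 : DistUpper (seqMap g n η) (seqDeriv g D n η) (seqMap g m η '' Icc e₀ e₁) A)
    (h2 : DistLower (seqMap g n η) (seqDeriv g D n η) (seqMap g m η '' Icc e₀ e₁) A)
    (hy : y ∈ seqMap g m η '' Icc e₀ e₁) (hp : p ∈ seqMap g m η '' Icc e₀ e₁) :
    seqDeriv g D n η y ≤ A ^ 2 * seqDeriv g D n η p := by
  have ha := mem_image_of_mem (seqMap g m η) h.left_mem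
  have hb := mem_image_of_mem (seqMap g m η) h.right_mem
  have hne : seqMap g m η e₀ ≠ seqMap g m η e₁ := fun he =>
    h.lt.ne (h.seqMap_injOn h.left_mem h.right_mem he)
  have hpos := abs_pos.2 (sub_ne_zero.2 hne)
  refine le_of_mul_le_mul_right ((h2 _ ha _ hb y hy).trans ?_) hpos
  refine (mul_le_mul_of_nonneg_left (h1 _ ha _ hb p hp) hA).trans_eq (by ring)

/-- A first return closes up to a periodic word. Its periodic orbit is injective because the return
is the first one, so the multiplier is small when `r` is large, and bounded distortion carries the
bound to the whole cylinder. -/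
theorem long_return (h : IsIntervalIFS e₀ e₁ K g D) : ∃ R : ℕ, ∀ (ζ : ℕ → ι) (m r : ℕ), R ≤ r →
    IsFirstReturn ζ m r → ∀ y ∈ seqMap g m ζ '' Icc e₀ e₁, seqDeriv g D r ζ y ≤ 1 / 2 := by
  set A := Real.exp (K * (e₁ - e₀))
  have hA : 0 < A := Real.exp_pos _
  obtain ⟨R, hR⟩ := h.periodic_deriv_le (1 / (2 * A ^ 2)) (by positivity)
  refine ⟨R, fun ζ m r hr hret y hy => ?_⟩
  have hr0 := hret.1
  set ξ : ℕ → ι := fun k => ζ (k % r) with hξ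
  have hξr : ∀ k, ξ (k + r) = ξ k := fun k => by simp [hξ]
  have hagree : ∀ k, k < r + m → ξ k = ζ k := by
    intro k
    induction k using Nat.strong_induction_on with
    | _ k ih =>
      intro hk
      rcases lt_or_ge k r with hlt | hge
      · simp [hξ, Nat.mod_eq_of_lt hlt]
      · obtain ⟨j, rfl⟩ := Nat.exists_eq_add_of_le' hge
        rw [hξr, ih j (by omega) (by omega), hret.2.1 j (by omega)]
  obtain ⟨p, hpI, hp⟩ := h.exists_fixed r ξ
  obtain ⟨x, ho, hx, hx0⟩ := exists_isOrbit_of_fixed h.mapsTo hr0 hξr hpI hp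
  -- Equal orbit points have equal letters, which would make the first `m` letters recur already at
  -- time `r - (j - i) < r`.
  have hinj' : ∀ i j, i < j → j < r → x i ≠ x j := by
    intro i j hij hj he
    have h1 := (ho.shift j).seqMap_eq (n := r + m)
    rw [zero_add, ← he] at h1
    have h2 := (h.eq_of_mem_cylinder ho hr0 hx (ho _).1 h1.symm).2
    obtain ⟨k, hk, hne⟩ := hret.2.2 (i + (r - j)) (by omega) (by omega)
    apply hne
    have h3 := h2 (r - j + k) (by omega)
    rw [show r - j + k + j = k + r by omega, hξr, hagree k (by omega),
      hagree _ (by omega)] at h3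
    rw [← h3]
    congr 1
    omega
  have hinj : InjOn x (Iio r) := by
    intro i hi j hj he
    by_contra hne
    rcases lt_or_gt_of_ne hne with hlt | hlt
    · exact hinj' i j hlt hj he
    · exact hinj' j i hlt hi he.symm
  have h1 := hR r hr ξ x ho hξr hx hinj
  rw [seqDeriv_congr (fun k hk => hagree k (by omega))] at h1
  have hpC : x r ∈ seqMap g m ζ '' Icc e₀ e₁ := by
    have h2 := ho.seqMap_eq (n := m)
    rw [seqMap_congr (fun k hk => hagree k (by omega))] at h2
    have h3 : x r = x 0 := by simpa using hx 0
    rw [h3, ← h2]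
    exact mem_image_of_mem _ (ho m).1
  refine (h.seqDeriv_le_of_dist hA.le (h.firstReturn_distUpper hret) (h.firstReturn_distLower hret)
    hy hpC).trans ?_
  calc _ ≤ A ^ 2 * (1 / (2 * A ^ 2)) := by gcongr
    _ = 1 / 2 := by field_simp

/-- The `r` intermediate images of a deep cylinder are uniformly short, so the distortion along the
period tends to `1` and the hyperbolic multiplier at the fixed point decides. -/
theorem periodic_return (h : IsIntervalIFS e₀ e₁ K g D) {η : ℕ → ι} {r : ℕ} (hr : 0 < r)
    (hη : ∀ k, η (k + r) = η k) : ∃ ρ < 1, ∃ N, ∀ m ≥ N, ∀ y ∈ seqMap g m η '' Icc e₀ e₁,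
      seqDeriv g D r η y ≤ ρ := by
  obtain ⟨p, hpI, hp⟩ := h.exists_fixed r η
  obtain ⟨x, ho, hx, hx0⟩ := exists_isOrbit_of_fixed h.mapsTo hr hη hpI hp
  have hD := h.hyperbolic r hr η p hpI hp
  obtain ⟨ρ, hρ1, hρ2⟩ := exists_between hD
  obtain ⟨ε, hε, hε0⟩ : ∃ ε : ℝ, Real.exp (K * (r * ε)) ^ 2 * seqDeriv g D r η p ≤ ρ ∧ 0 < ε := by
    have hc : Filter.Tendsto (fun ε : ℝ => Real.exp (K * (r * ε)) ^ 2 * seqDeriv g D r η p)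
        (𝓝[>] 0) (𝓝 (Real.exp (K * (r * 0)) ^ 2 * seqDeriv g D r η p)) := by
      refine (Continuous.tendsto ?_ 0).mono_left nhdsWithin_le_nhds
      fun_prop
    simp only [mul_zero, Real.exp_zero, one_pow, one_mul] at hc
    obtain ⟨ε, h1, h2⟩ := ((hc.eventually (gt_mem_nhds hρ1)).and self_mem_nhdsWithin).exists
    exact ⟨ε, h1.le, h2⟩
  obtain ⟨N, hN⟩ := h.shrink ε hε0
  refine ⟨ρ, hρ2, N, fun m hm y hy => ?_⟩
  have hl : ∀ t < r, ∀ x ∈ seqMap g m η '' Icc e₀ e₁, ∀ y ∈ seqMap g m η '' Icc e₀ e₁,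
      |seqMap g (r - (t + 1)) (fun k => η (k + (t + 1))) x -
        seqMap g (r - (t + 1)) (fun k => η (k + (t + 1))) y| ≤ ε := by
    rintro t ht _ ⟨x, hx, rfl⟩ _ ⟨y, hy, rfl⟩
    have h1 : seqMap g m η = seqMap g m (fun k => η (k + (r - (t + 1)) + (t + 1))) :=
      seqMap_congr fun k hk => by
        rw [show k + (r - (t + 1)) + (t + 1) = k + r by omega, hη]
    rw [h1, ← seqMap_add (g := g) (r - (t + 1)) m (fun k => η (k + (t + 1))),
      ← seqMap_add (g := g) (r - (t + 1)) m (fun k => η (k + (t + 1)))]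
    exact (h.abs_seqMap_sub_le hx hy).trans (hN _ (by omega) _)
  have hu := h.distUpper_of_sum (l := fun _ => ε) h.seqMap_mapsTo.image_subset hl
  have hd := h.distLower_of_sum (l := fun _ => ε) h.seqMap_mapsTo.image_subset hl
  simp only [Finset.sum_const, Finset.card_range, nsmul_eq_mul] at hu hd
  refine (h.seqDeriv_le_of_dist (Real.exp_pos _).le hu hd hy ?_).trans hε
  have h2 := ho.seqMap_eq (n := m)
  rw [← hx0, ← h2]
  exact mem_image_of_mem _ (ho m).1

/-- Return times at least `R` are covered by `long_return`. Each of the finitely many shorter times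
`r` is either a period of `η`, covered by `periodic_return`, or impossible as a return time once `m`
is large. -/
theorem exists_isReturnContracting (h : IsIntervalIFS e₀ e₁ K g D) (η : ℕ → ι) :
    ∃ m, ∃ ρ < 1, IsReturnContracting e₀ e₁ g D η m ρ := by
  obtain ⟨R, hR⟩ := h.long_return
  have key : ∀ R : ℕ, ∃ ρ < 1, ∃ N : ℕ, ∀ m ≥ N, ∀ ζ : ℕ → ι, (∀ k < m, ζ k = η k) → ∀ r < R,
      IsFirstReturn ζ m r → ∀ y ∈ seqMap g m ζ '' Icc e₀ e₁, seqDeriv g D r ζ y ≤ ρ := by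
    intro R
    induction R with
    | zero => exact ⟨0, one_pos, 0, fun m _ ζ _ r hr => absurd hr (by omega)⟩
    | succ r ih =>
      obtain ⟨ρ, hρ, N, hN⟩ := ih
      obtain ⟨ρ', hρ', N', hN'⟩ : ∃ ρ < 1, ∃ N : ℕ, ∀ m ≥ N, ∀ ζ : ℕ → ι, (∀ k < m, ζ k = η k) →
          IsFirstReturn ζ m r → ∀ y ∈ seqMap g m ζ '' Icc e₀ e₁, seqDeriv g D r ζ y ≤ ρ := by
        rcases Nat.eq_zero_or_pos r with rfl | hr0
        · exact ⟨0, one_pos, 0, fun m _ ζ _ hret => absurd hret.1 (by omega)⟩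
        by_cases hper : ∀ k, η (k + r) = η k
        · obtain ⟨ρ, hρ, N, hN⟩ := h.periodic_return hr0 hper
          refine ⟨ρ, hρ, max N r, fun m hm ζ hζ _ y hy => ?_⟩
          have hrm : r ≤ m := (le_max_right _ _).trans hm
          rw [seqDeriv_congr (fun k hk => hζ k (by omega))]
          rw [seqMap_congr hζ] at hy
          exact hN m ((le_max_left _ _).trans hm) y hy
        · push Not at hper
          obtain ⟨k, hk⟩ := hper
          refine ⟨0, one_pos, k + r + 1, fun m hm ζ hζ hret => absurd ?_ hk⟩
          rw [← hζ _ (by omega), ← hζ k (by omega), hret.2.1 k (by omega)]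
      refine ⟨max ρ ρ', max_lt hρ hρ', max N N', fun m hm ζ hζ t ht hret y hy => ?_⟩
      rcases Nat.lt_succ_iff_lt_or_eq.1 ht with hlt | rfl
      · exact (hN m ((le_max_left _ _).trans hm) ζ hζ t hlt hret y hy).trans (le_max_left _ _)
      · exact (hN' m ((le_max_right _ _).trans hm) ζ hζ hret y hy).trans (le_max_right _ _)
  obtain ⟨ρ, hρ, N, hN⟩ := key R
  refine ⟨N, max ρ (1 / 2), max_lt hρ (by norm_num), fun ζ hζ r hret y hy => ?_⟩
  rcases lt_or_ge r R with hlt | hge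
  · exact (hN N le_rfl ζ hζ r hlt hret y hy).trans (le_max_left _ _)
  · exact (hR ζ N r hge hret y hy).trans (le_max_right _ _)

end IsIntervalIFS

/-! ### Uniform exponential contraction -/

/-- König's lemma for a property `T` of finite words, all extensions but finitely many of each word
having the property. -/
theorem exists_bound_of_forall_exists_prefix {ι : Type*} {T : (ℕ → ι) → ℕ → Prop}
    (hcongr : ∀ {η ζ : ℕ → ι} {n : ℕ}, (∀ k < n, η k = ζ k) → T η n → T ζ n)
    (hfin : ∀ η n, {i | ¬ T (Function.update η n i) (n + 1)}.Finite)
    (hT : ∀ η, ∃ n, T η n) : ∃ N, ∀ η, ∃ n ≤ N, T η n := by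
  by_contra hcon
  push Not at hcon
  obtain ⟨η₀, -⟩ := hcon 0
  -- The first `n` letters are good if they extend to words avoiding `T` for arbitrarily long. Only
  -- finitely many next letters avoid `T`, so if none were good, the largest of their bounds would
  -- contradict goodness.
  set Good : (ℕ → ι) → ℕ → Prop := fun η n =>
    ∀ N, ∃ ζ : ℕ → ι, (∀ k < n, ζ k = η k) ∧ ∀ k ≤ N, ¬ T ζ k with hGood
  have hstep : ∀ η n, Good η n → ∃ i, Good (Function.update η n i) (n + 1) := by
    intro η n hg
    by_contra hno
    push Not at hno
    simp only [hGood] at hno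
    push Not at hno
    choose M hM using hno
    obtain ⟨B, hB⟩ := ((hfin η n).image M).bddAbove
    obtain ⟨ζ, hζ, hζT⟩ := hg (max B (n + 1))
    have hag : ∀ k < n + 1, ζ k = Function.update η n (ζ n) k := by
      intro k hk
      rcases Nat.lt_succ_iff_lt_or_eq.1 hk with hlt | rfl
      · rw [Function.update_of_ne hlt.ne, hζ k hlt]
      · simp
    have hmem : ζ n ∈ {i | ¬ T (Function.update η n i) (n + 1)} := fun ht =>
      hζT (n + 1) (le_max_right _ _) (hcongr (fun k hk => (hag k hk).symm) ht)
    obtain ⟨k, hk, hkT⟩ := hM (ζ n) ζ hag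
    exact hζT k (hk.trans ((hB (mem_image_of_mem M hmem)).trans (le_max_left _ _))) hkT
  have : Nonempty ι := ⟨η₀ 0⟩
  choose! c hc using hstep
  set ω : ℕ → ℕ → ι := fun n => Nat.rec η₀ (fun n η => Function.update η n (c η n)) n with hω
  have hωs : ∀ n, ω (n + 1) = Function.update (ω n) n (c (ω n) n) := fun n => rfl
  have hgood : ∀ n, Good (ω n) n := by
    intro n
    induction n with
    | zero =>
      intro N
      obtain ⟨ζ, hζ⟩ := hcon N
      exact ⟨ζ, fun k hk => absurd hk (by omega), hζ⟩
    | succ n ih => rw [hωs]; exact hc _ _ ih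
  have hstable : ∀ n k, ω (k + 1 + n) k = ω (k + 1) k := by
    intro n k
    induction n with
    | zero => rfl
    | succ n ih =>
      rw [← add_assoc, hωs, Function.update_of_ne (by omega), ih]
  obtain ⟨n, hn⟩ := hT (fun k => ω (k + 1) k)
  obtain ⟨ζ, hζ, hζT⟩ := hgood n n
  refine hζT n le_rfl (hcongr (fun k hk => ?_) hn)
  rw [hζ k hk]
  obtain ⟨j, rfl⟩ := Nat.exists_eq_add_of_le hk
  exact (hstable j k).symm

/-- Combines a contraction by a fixed factor, useful for short times, with an exponential estimate
carrying a constant, useful for long ones. With `s = √θ` one factor `s ^ l` absorbs `A` when `l ≥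
L`; for `l < L` Bernoulli's inequality gives `ρ ≤ (1 - κ) ^ L`. -/
theorem exists_rate {ρ θ A : ℝ} (hρ : ρ < 1) (hθ0 : 0 < θ) (hθ : θ < 1) (hA : 0 < A) :
    ∃ σ < 1, θ ≤ σ ∧ ∀ l : ℕ, ∀ d : ℝ, d ≤ ρ → d ≤ A * θ ^ l → d ≤ σ ^ l := by
  set s := Real.sqrt θ with hs
  have hs0 : 0 < s := Real.sqrt_pos.2 hθ0
  have hss : s * s = θ := Real.mul_self_sqrt hθ0.le
  have hs1 : s < 1 := by nlinarith
  obtain ⟨L, hL⟩ := exists_pow_lt_of_lt_one (show 0 < 1 / A by positivity) hs1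
  set κ := min ((1 - ρ) / (L + 1)) (1 / 2) with hκ
  have hL1 : (0 : ℝ) < L + 1 := by positivity
  have hκ0 : 0 < κ := lt_min (div_pos (by linarith) hL1) (by norm_num)
  have hκ2 : κ ≤ 1 / 2 := min_le_right _ _
  have hκ1 : κ * (L + 1) ≤ 1 - ρ := by
    rw [← le_div_iff₀ hL1]
    exact min_le_left _ _
  have hρL : ρ ≤ (1 - κ) ^ L := by
    have := one_add_mul_le_pow (show (-2 : ℝ) ≤ -κ by linarith) L
    rw [← sub_eq_add_neg] at this
    nlinarith
  refine ⟨max s (1 - κ), max_lt hs1 (by linarith), le_max_of_le_left (by nlinarith),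
    fun l d hd1 hd2 => ?_⟩
  rcases lt_or_ge l L with hlt | hge
  · calc d ≤ (1 - κ) ^ L := hd1.trans hρL
      _ ≤ (1 - κ) ^ l := pow_le_pow_of_le_one (by linarith) (by linarith) hlt.le
      _ ≤ _ := pow_le_pow_left₀ (by linarith) (le_max_right _ _) _
  · have h1 : A * s ^ l ≤ 1 := by
      have : s ^ l ≤ 1 / A := (pow_le_pow_of_le_one hs0.le hs1.le hge).trans hL.le
      rwa [le_div_iff₀ hA, mul_comm] at this
    calc d ≤ A * θ ^ l := hd2
      _ = (A * s ^ l) * s ^ l := by rw [← hss, mul_pow]; ring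
      _ ≤ 1 * s ^ l := by gcongr
      _ = s ^ l := one_mul _
      _ ≤ _ := pow_le_pow_left₀ hs0.le (le_max_left _ _) _

namespace IsIntervalIFS
variable {ι : Type*} {e₀ e₁ K : ℝ} {g D : ι → ℝ → ℝ}

theorem D_le_exp (h : IsIntervalIFS e₀ e₁ K g D) (i : ι) {y : ℝ} (hy : y ∈ Icc e₀ e₁) :
    D i y ≤ Real.exp (K * (e₁ - e₀)) := by
  have hl : 0 < e₁ - e₀ := sub_pos.2 h.lt
  have h1 := h.le_dist i e₁ h.right_mem e₀ h.left_mem y hy (e₁ - e₀)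
    (by rw [_root_.abs_le]; constructor <;> linarith [hy.1, hy.2])
    (by rw [_root_.abs_le]; constructor <;> linarith [hy.1, hy.2])
  have h2 : |g i e₁ - g i e₀| ≤ e₁ - e₀ := by
    have a1 := h.mapsTo i h.left_mem
    have a2 := h.mapsTo i h.right_mem
    rw [_root_.abs_le]
    constructor <;> linarith [a1.1, a1.2, a2.1, a2.2]
  rw [abs_of_pos hl] at h1
  refine le_of_mul_le_mul_right (h1.trans ?_) hl
  exact mul_le_mul_of_nonneg_left h2 (Real.exp_pos _).le

theorem seqDeriv_le_pow (h : IsIntervalIFS e₀ e₁ K g D) {n : ℕ} : ∀ {η : ℕ → ι} {y : ℝ},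
    y ∈ Icc e₀ e₁ → seqDeriv g D n η y ≤ Real.exp (K * (e₁ - e₀)) ^ n := by
  induction n with
  | zero => intro η y _; simp [seqDeriv]
  | succ n ih =>
    intro η y hy
    simp only [seqDeriv]
    rw [pow_succ']
    exact mul_le_mul (h.D_le_exp _ (h.seqMap_mapsTo hy)) (ih hy) (h.seqDeriv_pos hy).le
      (Real.exp_pos _).le

/-- The first `n` letters expand by at most `Λ ^ n`, so any new innermost letter with derivative at
most `1 / (2 * Λ ^ n)` gives contraction. This is the finite branching needed for König's lemma. -/
theorem finite_not_contracting (h : IsIntervalIFS e₀ e₁ K g D) (η : ℕ → ι) (n : ℕ) :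
    {i | ¬ ∀ y ∈ Icc e₀ e₁, seqDeriv g D (n + 1) (Function.update η n i) y ≤ 1 / 2}.Finite := by
  set Λ := Real.exp (K * (e₁ - e₀)) with hΛ
  have hΛ0 : 0 < Λ := Real.exp_pos _
  refine (h.finite_large (κ := 1 / (2 * Λ ^ n)) (by positivity)).subset fun i hi hsmall => hi ?_
  intro y hy
  rw [_root_.seqDeriv_add]
  simp only [seqDeriv, seqMap, zero_add, Function.update_self, mul_one]
  have h1 := h.seqDeriv_le_pow (n := n) (η := Function.update η n i) (h.mapsTo i hy)
  have h2 := hsmall y hy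
  calc _ ≤ Λ ^ n * (1 / (2 * Λ ^ n)) :=
        mul_le_mul h1 h2 (h.pos i y hy).le (by positivity)
    _ = 1 / 2 := by field_simp

/-- Finitely many words represent all those without a contracting prefix. -/
theorem exists_finite_representatives (h : IsIntervalIFS e₀ e₁ K g D) (n : ℕ) :
    ∃ F : Set (ℕ → ι), F.Finite ∧ ∀ η : ℕ → ι,
      (∀ k ≤ n, ¬ ∀ y ∈ Icc e₀ e₁, seqDeriv g D k η y ≤ 1 / 2) → ∃ ζ ∈ F, ∀ k < n, η k = ζ k := by
  induction n with
  | zero =>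
    by_cases hne : Nonempty (ℕ → ι)
    · obtain ⟨η₀⟩ := hne
      exact ⟨{η₀}, finite_singleton _, fun η _ => ⟨η₀, rfl, fun k hk => absurd hk (by omega)⟩⟩
    · exact ⟨∅, finite_empty, fun η _ => absurd ⟨η⟩ hne⟩
  | succ n ih =>
    obtain ⟨F, hF, hFη⟩ := ih
    refine ⟨⋃ ζ ∈ F, (fun i => Function.update ζ n i) ''
      {i | ¬ ∀ y ∈ Icc e₀ e₁, seqDeriv g D (n + 1) (Function.update ζ n i) y ≤ 1 / 2},
      hF.biUnion fun ζ _ => (h.finite_not_contracting ζ n).image _, fun η hη => ?_⟩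
    obtain ⟨ζ, hζ, hag⟩ := hFη η fun k hk => hη k (by omega)
    have hag' : ∀ k < n + 1, η k = Function.update ζ n (η n) k := by
      intro k hk
      rcases Nat.lt_succ_iff_lt_or_eq.1 hk with hlt | rfl
      · rw [Function.update_of_ne hlt.ne, hag k hlt]
      · simp
    refine ⟨Function.update ζ n (η n), ?_, hag'⟩
    refine mem_iUnion₂.2 ⟨ζ, hζ, η n, ?_, rfl⟩
    have := hη (n + 1) le_rfl
    rwa [seqDeriv_congr hag'] at this

theorem orbit_deriv_le_of_contracting (h : IsIntervalIFS e₀ e₁ K g D) {N : ℕ} (hN : 0 < N) :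
    ∃ C θ : ℝ, 1 ≤ C ∧ 0 < θ ∧ θ < 1 ∧ ∀ (n : ℕ) (η : ℕ → ι) (x : ℕ → ℝ), IsOrbit e₀ e₁ g η x →
      (∀ j < n, ∃ k ≤ N, ∀ y ∈ Icc e₀ e₁, seqDeriv g D k (fun t => η (t + j)) y ≤ 1 / 2) →
      seqDeriv g D n η (x n) ≤ C * θ ^ n := by
  set Λ := Real.exp (K * (e₁ - e₀)) with hΛ
  have hΛ1 : 1 ≤ Λ := Real.one_le_exp (mul_nonneg h.K_nonneg (sub_pos.2 h.lt).le)
  -- Chosen so that `θ ^ N ≥ 1 / 2`: a contracting block of length `k ≤ N` then contributes at most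
  -- `θ ^ k`.
  set θ : ℝ := 1 - 1 / (2 * N) with hθ
  have hN1 : (1 : ℝ) ≤ N := by exact_mod_cast hN
  have hN2 : 1 / (2 * (N : ℝ)) ≤ 1 / 2 := by
    rw [div_le_div_iff₀ (by positivity) (by norm_num)]
    linarith
  have hN3 : 0 < 1 / (2 * (N : ℝ)) := by positivity
  have hθ0 : 0 < θ := by linarith
  have hθ1 : θ < 1 := by linarith
  have hθN : 1 / 2 ≤ θ ^ N := by
    have := one_add_mul_le_pow (show (-2 : ℝ) ≤ -(1 / (2 * (N : ℝ))) by linarith) N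
    rw [← sub_eq_add_neg] at this
    refine le_trans (le_of_eq ?_) this
    field_simp
    ring
  have hΛN : 1 ≤ Λ ^ N := one_le_pow₀ hΛ1
  refine ⟨2 * Λ ^ N, θ, by linarith, hθ0, hθ1, fun n => ?_⟩
  induction n using Nat.strong_induction_on with
  | _ n ih =>
    intro η x ho hgood
    rcases le_or_gt n N with hle | hgt
    · have h1 := h.seqDeriv_le_pow (n := n) (η := η) (ho n).1
      have h2 : Λ ^ n ≤ Λ ^ N := pow_le_pow_right₀ hΛ1 hle
      have h3 : θ ^ N ≤ θ ^ n := pow_le_pow_of_le_one hθ0.le hθ1.le hle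
      calc _ ≤ Λ ^ N := h1.trans h2
        _ = 2 * Λ ^ N * (1 / 2) := by ring
        _ ≤ _ := by gcongr; exact hθN.trans h3
    · obtain ⟨k, hk, hkD⟩ := hgood 0 (by omega)
      have hk0 : 0 < k := by
        rcases Nat.eq_zero_or_pos k with rfl | hk0
        · have := hkD e₀ h.left_mem
          simp only [seqDeriv] at this
          norm_num at this
        · exact hk0
      obtain ⟨m, rfl⟩ : ∃ m, n = k + m := ⟨n - k, by omega⟩
      rw [ho.seqDeriv_add]
      have h1 := hkD (x k) (ho k).1
      have h2 := ih m (by omega) _ _ (ho.shift k) (fun j hj => by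
        obtain ⟨t, ht, htD⟩ := hgood (j + k) (by omega)
        exact ⟨t, ht, by simpa only [add_assoc] using htD⟩)
      rw [add_comm m k] at h2
      simp only [add_zero] at h1
      have h3 : θ ^ N ≤ θ ^ k := pow_le_pow_of_le_one hθ0.le hθ1.le hk
      have hp := (h.seqDeriv_pos (n := m) (η := fun t => η (t + k)) (ho (k + m)).1).le
      calc _ ≤ 1 / 2 * (2 * Λ ^ N * θ ^ m) := mul_le_mul h1 h2 hp (by norm_num)
        _ ≤ θ ^ k * (2 * Λ ^ N * θ ^ m) := by gcongr; exact hθN.trans h3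
        _ = _ := by rw [pow_add]; ring

/-- The orbit is cut at its visits to the cylinder of `ζ`. Between consecutive visits the derivative
is at most `ρ`, by contraction of first returns, and at most `A * θ ^ l`, since only the first step
visits the cylinder; `exists_rate` merges these into `σ ^ l` without a constant, so the excursions
can be multiplied. Only the initial and final pieces contribute constants. -/
theorem orbit_deriv_le_insert (h : IsIntervalIFS e₀ e₁ K g D) {Q : (ℕ → ι) → Prop}
    {C θ : ℝ} (hC : 1 ≤ C) (hθ0 : 0 < θ) (hθ : θ < 1)
    (hQ : ∀ (n : ℕ) (η : ℕ → ι) (x : ℕ → ℝ), IsOrbit e₀ e₁ g η x →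
      (∀ j < n, Q fun t => η (t + j)) → seqDeriv g D n η (x n) ≤ C * θ ^ n)
    {ζ : ℕ → ι} {m : ℕ} {ρ : ℝ} (hρ : ρ < 1) (hret : IsReturnContracting e₀ e₁ g D ζ m ρ) :
    ∃ C θ : ℝ, 1 ≤ C ∧ 0 < θ ∧ θ < 1 ∧ ∀ (n : ℕ) (η : ℕ → ι) (x : ℕ → ℝ), IsOrbit e₀ e₁ g η x →
      (∀ j < n, Q (fun t => η (t + j)) ∨ ∀ k < m, η (k + j) = ζ k) →
      seqDeriv g D n η (x n) ≤ C * θ ^ n := by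
  set Λ := Real.exp (K * (e₁ - e₀)) with hΛ
  have hΛ1 : 1 ≤ Λ := Real.one_le_exp (mul_nonneg h.K_nonneg (sub_pos.2 h.lt).le)
  have hΛ0 : 0 < Λ := Real.exp_pos _
  set A := Λ * C / θ with hA
  have hApos : 0 < A := by positivity
  have hA1 : 1 ≤ A := by
    rw [hA, le_div_iff₀ hθ0]
    nlinarith
  obtain ⟨σ, hσ1, hθσ, hσ⟩ := exists_rate hρ hθ0 hθ hApos
  have hσ0 : 0 < σ := hθ0.trans_le hθσ
  -- one step and then no visits
  have hone : ∀ (n : ℕ) (η : ℕ → ι) (x : ℕ → ℝ), 0 < n → IsOrbit e₀ e₁ g η x →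
      (∀ j, 0 < j → j < n → Q fun t => η (t + j)) → seqDeriv g D n η (x n) ≤ A * θ ^ n := by
    intro n η x hn ho hq
    obtain ⟨n, rfl⟩ : ∃ k, n = 1 + k := ⟨n - 1, by omega⟩
    rw [ho.seqDeriv_add]
    have h1 : seqDeriv g D 1 η (x 1) ≤ Λ := by
      simpa using h.seqDeriv_le_pow (n := 1) (η := η) (ho 1).1
    have h2 := hQ n _ _ (ho.shift 1) fun j hj => by
      simpa only [add_assoc] using hq (j + 1) (by omega) (by omega)
    rw [add_comm n 1] at h2
    have hp := (h.seqDeriv_pos (n := n) (η := fun t => η (t + 1)) (ho (1 + n)).1).le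
    calc _ ≤ Λ * (C * θ ^ n) := mul_le_mul h1 h2 hp hΛ0.le
      _ = A * θ ^ (1 + n) := by rw [hA, pow_add]; field_simp
  have hstart : ∀ (n : ℕ) (η : ℕ → ι) (x : ℕ → ℝ), IsOrbit e₀ e₁ g η x →
      (∀ k < m, η k = ζ k) → (∀ j < n, Q (fun t => η (t + j)) ∨ ∀ k < m, η (k + j) = ζ k) →
      seqDeriv g D n η (x n) ≤ A * σ ^ n := by
    intro n
    induction n using Nat.strong_induction_on with
    | _ n ih =>
      intro η x ho h0 hgood
      rcases Nat.eq_zero_or_pos n with rfl | hn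
      · simpa [seqDeriv] using hA1
      classical
      by_cases hex : ∃ j, 0 < j ∧ j < n ∧ ∀ k < m, η (k + j) = ζ k
      · obtain ⟨hj0, hjn, hjv⟩ := Nat.find_spec hex
        have hmin : ∀ t, 0 < t → t < Nat.find hex → ¬ ∀ k < m, η (k + t) = ζ k := fun t ht0 ht hk =>
          Nat.find_min hex ht ⟨ht0, ht.trans hjn, hk⟩
        generalize Nat.find hex = j at hj0 hjn hjv hmin
        have hfr : IsFirstReturn η m j := by
          refine ⟨hj0, fun k hk => by rw [hjv k hk, h0 k hk], fun t ht0 ht => ?_⟩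
          have := hmin t ht0 ht
          push Not at this
          obtain ⟨k, hk, hne⟩ := this
          exact ⟨k, hk, by rwa [h0 k hk]⟩
        have hmem : x j ∈ seqMap g m η '' Icc e₀ e₁ := by
          have h1 := (ho.shift j).seqMap_eq (n := m)
          rw [zero_add] at h1
          have hcg : seqMap g m (fun k => η (k + j)) = seqMap g m η :=
            seqMap_congr fun k hk => by rw [hjv k hk, h0 k hk]
          rw [← h1, hcg]
          exact mem_image_of_mem _ (ho _).1
        have h1 := hret η h0 j hfr (x j) hmem
        have h2 := hone j η x hj0 ho fun t ht0 ht =>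
          (hgood t (ht.trans hjn)).resolve_right (hmin t ht0 ht)
        have h3 := hσ j _ h1 h2
        obtain ⟨l, rfl⟩ : ∃ l, n = j + l := ⟨n - j, by omega⟩
        rw [ho.seqDeriv_add]
        have h4 := ih l (by omega) _ _ (ho.shift j) hjv fun t ht => by
          simpa only [add_assoc] using hgood (t + j) (by omega)
        rw [add_comm l j] at h4
        have hp := (h.seqDeriv_pos (n := l) (η := fun t => η (t + j)) (ho (j + l)).1).le
        calc _ ≤ σ ^ j * (A * σ ^ l) := mul_le_mul h3 h4 hp (by positivity)
          _ = _ := by rw [pow_add]; ring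
      · push Not at hex
        refine (hone n η x hn ho fun t ht0 ht => (hgood t ht).resolve_right ?_).trans ?_
        · obtain ⟨k, hk, hne⟩ := hex t ht0 ht
          exact fun hall => hne (hall k hk)
        · gcongr
  refine ⟨C * A, σ, one_le_mul_of_one_le_of_one_le hC hA1, hσ0, hσ1, fun n η x ho hgood => ?_⟩
  classical
  by_cases hex : ∃ j, j < n ∧ ∀ k < m, η (k + j) = ζ k
  · obtain ⟨hjn, hjv⟩ := Nat.find_spec hex
    have hmin : ∀ t, t < Nat.find hex → ¬ ∀ k < m, η (k + t) = ζ k := fun t ht hk =>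
      Nat.find_min hex ht ⟨ht.trans hjn, hk⟩
    generalize Nat.find hex = j at hjn hjv hmin
    obtain ⟨l, rfl⟩ : ∃ l, n = j + l := ⟨n - j, by omega⟩
    rw [ho.seqDeriv_add]
    have h1 := hQ j η x ho fun t ht => (hgood t (ht.trans hjn)).resolve_right (hmin t ht)
    have h4 := hstart l _ _ (ho.shift j) hjv fun t ht => by
      simpa only [add_assoc] using hgood (t + j) (by omega)
    rw [add_comm l j] at h4
    have hp := (h.seqDeriv_pos (n := l) (η := fun t => η (t + j)) (ho (j + l)).1).le
    calc _ ≤ (C * θ ^ j) * (A * σ ^ l) := mul_le_mul h1 h4 hp (by positivity)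
      _ ≤ (C * σ ^ j) * (A * σ ^ l) := by gcongr
      _ = _ := by rw [pow_add]; ring
  · push Not at hex
    refine (hQ n η x ho fun t ht => (hgood t ht).resolve_right ?_).trans ?_
    · obtain ⟨k, hk, hne⟩ := hex t ht
      exact fun hall => hne (hall k hk)
    · have hle : C ≤ C * A := le_mul_of_one_le_right (by linarith) hA1
      gcongr

/-- Uniform hyperbolicity on backward orbits. -/
theorem exists_orbit_deriv_le (h : IsIntervalIFS e₀ e₁ K g D) :
    ∃ C θ : ℝ, 1 ≤ C ∧ 0 < θ ∧ θ < 1 ∧ ∀ (n : ℕ) (η : ℕ → ι) (x : ℕ → ℝ), IsOrbit e₀ e₁ g η x →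
      seqDeriv g D n η (x n) ≤ C * θ ^ n := by
  set T₁ : (ℕ → ι) → ℕ → Prop := fun η n => ∀ y ∈ Icc e₀ e₁, seqDeriv g D n η y ≤ 1 / 2 with hT₁
  set T₂ : (ℕ → ι) → ℕ → Prop := fun η n => ∃ ρ < 1, IsReturnContracting e₀ e₁ g D η n ρ with hT₂
  have hc1 : ∀ {η ζ : ℕ → ι} {n : ℕ}, (∀ k < n, η k = ζ k) → T₁ η n → T₁ ζ n := by
    intro η ζ n hag ht y hy
    rw [← seqDeriv_congr hag]
    exact ht y hy
  have hc2 : ∀ {η ζ : ℕ → ι} {n : ℕ}, (∀ k < n, η k = ζ k) → T₂ η n → T₂ ζ n := by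
    rintro η ζ n hag ⟨ρ, hρ, ht⟩
    exact ⟨ρ, hρ, fun ξ hξ => ht ξ fun k hk => (hξ k hk).trans (hag k hk).symm⟩
  obtain ⟨N, hN⟩ := exists_bound_of_forall_exists_prefix (T := fun η n => T₁ η n ∨ T₂ η n)
    (fun hag ht => ht.imp (hc1 hag) (hc2 hag))
    (fun η n => (h.finite_not_contracting η n).subset fun i hi hcon => hi (Or.inl hcon))
    (fun η => (h.exists_isReturnContracting η).imp fun n hn => Or.inr hn)
  choose F hF hFη using h.exists_finite_representatives
  -- Words whose prefixes do not contract up to their first good time have finitely many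
  -- representatives. These exceptional cylinders are inserted one at a time.
  set V : Set ((ℕ → ι) × ℕ) := {v | v.2 ≤ N ∧ v.1 ∈ F v.2 ∧ T₂ v.1 v.2} with hV
  have hVfin : V.Finite := by
    refine ((finite_Iic N).biUnion fun n _ => (hF n).prod (finite_singleton n)).subset ?_
    rintro ⟨ζ, n⟩ ⟨h1, h2, -⟩
    exact mem_iUnion₂.2 ⟨n, h1, h2, rfl⟩
  have key : ∀ W : Set ((ℕ → ι) × ℕ), W.Finite → (∀ v ∈ W, T₂ v.1 v.2) →
      ∃ C θ : ℝ, 1 ≤ C ∧ 0 < θ ∧ θ < 1 ∧ ∀ (n : ℕ) (η : ℕ → ι) (x : ℕ → ℝ), IsOrbit e₀ e₁ g η x →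
        (∀ j < n, (∃ k ≤ N + 1, T₁ (fun t => η (t + j)) k) ∨
          ∃ v ∈ W, ∀ k < v.2, η (k + j) = v.1 k) → seqDeriv g D n η (x n) ≤ C * θ ^ n := by
    intro W hW
    induction W, hW using Set.Finite.induction_on with
    | empty =>
      intro _
      obtain ⟨C, θ, h1, h2, h3, h4⟩ := h.orbit_deriv_le_of_contracting (Nat.succ_pos N)
      refine ⟨C, θ, h1, h2, h3, fun n η x ho hg => h4 n η x ho fun j hj => ?_⟩
      exact (hg j hj).resolve_right (by simp)
    | @insert v W _ _ ih =>
      intro hT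
      obtain ⟨C, θ, h1, h2, h3, h4⟩ := ih fun v hv => hT v (mem_insert_of_mem _ hv)
      obtain ⟨ρ, hρ, hret⟩ := hT v (mem_insert _ _)
      obtain ⟨C', θ', h1', h2', h3', h4'⟩ := h.orbit_deriv_le_insert
        (Q := fun η => (∃ k ≤ N + 1, T₁ η k) ∨ ∃ v ∈ W, ∀ k < v.2, η k = v.1 k) h1 h2 h3 h4 hρ hret
      refine ⟨C', θ', h1', h2', h3', fun n η x ho hg => h4' n η x ho fun j hj => ?_⟩
      rcases hg j hj with hg | ⟨u, hu, hk⟩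
      · exact Or.inl (Or.inl hg)
      · rcases mem_insert_iff.1 hu with rfl | hu
        · exact Or.inr hk
        · exact Or.inl (Or.inr ⟨u, hu, hk⟩)
  obtain ⟨C, θ, h1, h2, h3, h4⟩ := key V hVfin fun v hv => hv.2.2
  refine ⟨C, θ, h1, h2, h3, fun n η x ho => h4 n η x ho fun j _ => ?_⟩
  classical
  have hex : ∃ k, T₁ (fun t => η (t + j)) k ∨ T₂ (fun t => η (t + j)) k :=
    (hN _).imp fun k hk => hk.2
  obtain ⟨k₀, hk₀, hk₀T⟩ := hN fun t => η (t + j)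
  have hle := (Nat.find_min' hex hk₀T).trans hk₀
  have hspec := Nat.find_spec hex
  have hmin : ∀ t < Nat.find hex, ¬ T₁ (fun t => η (t + j)) t := fun t ht hc =>
    Nat.find_min hex ht (Or.inl hc)
  generalize Nat.find hex = k at hle hspec hmin
  by_cases hT : T₁ (fun t => η (t + j)) k
  · exact Or.inl ⟨k, by omega, hT⟩
  · right
    obtain ⟨ζ, hζ, hag⟩ := hFη k (fun t => η (t + j)) fun t ht => by
      rcases ht.lt_or_eq with hlt | rfl
      · exact hmin t hlt
      · exact hT
    exact ⟨(ζ, k), ⟨hle, hζ, hc2 hag (hspec.resolve_left hT)⟩, hag⟩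

/-- The lengths of the cylinders decay exponentially. -/
theorem exists_length_le (h : IsIntervalIFS e₀ e₁ K g D) : ∃ C θ : ℝ, 0 < C ∧ 0 < θ ∧ θ < 1 ∧
    ∀ (n : ℕ) (η : ℕ → ι), |seqMap g n η e₀ - seqMap g n η e₁| ≤ C * θ ^ n := by
  obtain ⟨C, θ, hC, hθ0, hθ1, hD⟩ := h.exists_orbit_deriv_le
  have hK := h.K_nonneg
  have hl : 0 < e₁ - e₀ := sub_pos.2 h.lt
  -- This choice makes the induction below close: lengths bounded by `2 * C * ε * θ ^ k` have a sum
  -- for which the distortion is at most `2`.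
  obtain ⟨ε, hε, hε0⟩ : ∃ ε : ℝ, Real.exp (K * (2 * C * ε / (1 - θ))) ≤ 2 ∧ 0 < ε := by
    have hc : Filter.Tendsto (fun ε : ℝ => Real.exp (K * (2 * C * ε / (1 - θ))))
        (𝓝[>] 0) (𝓝 (Real.exp (K * (2 * C * 0 / (1 - θ))))) := by
      refine (Continuous.tendsto ?_ 0).mono_left nhdsWithin_le_nhds
      fun_prop
    simp only [mul_zero, zero_div, Real.exp_zero] at hc
    obtain ⟨ε, h1, h2⟩ := ((hc.eventually (gt_mem_nhds one_lt_two)).and self_mem_nhdsWithin).exists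
    exact ⟨ε, h1.le, h2⟩
  obtain ⟨m, hm⟩ := h.shrink ε hε0
  have key : ∀ (n : ℕ) (η : ℕ → ι),
      |seqMap g (n + m) η e₀ - seqMap g (n + m) η e₁| ≤ 2 * C * ε * θ ^ n := by
    intro n η
    -- a periodic orbit with the given initial word
    set q := n + m + 1 with hq
    set ξ : ℕ → ι := fun k => η (k % q) with hξ
    have hξq : ∀ k, ξ (k + q) = ξ k := fun k => by simp [hξ]
    have hag : ∀ k < n + m, ξ k = η k := fun k hk => by
      simp [hξ, Nat.mod_eq_of_lt (show k < q by omega)]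
    rw [← seqMap_congr hag]
    obtain ⟨p, hpI, hp⟩ := h.exists_fixed q ξ
    obtain ⟨x, ho, hx, hx0⟩ := exists_isOrbit_of_fixed h.mapsTo (by omega) hξq hpI hp
    set J : Set ℝ := seqMap g m (fun k => ξ (k + n)) '' Icc e₀ e₁ with hJ
    have hJI : J ⊆ Icc e₀ e₁ := h.seqMap_mapsTo.image_subset
    have hJε : ∀ u ∈ J, ∀ v ∈ J, |u - v| ≤ ε := by
      rintro _ ⟨u, hu, rfl⟩ _ ⟨v, hv, rfl⟩
      exact (h.abs_seqMap_sub_le hu hv).trans (hm m le_rfl _)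
    have hxJ : x n ∈ J := by
      have h1 := (ho.shift n).seqMap_eq (n := m)
      rw [zero_add] at h1
      rw [← h1]
      exact mem_image_of_mem _ (ho _).1
    have hind : ∀ k t, t + k = n → ∀ u ∈ J, ∀ v ∈ J,
        |seqMap g k (fun j => ξ (j + t)) u - seqMap g k (fun j => ξ (j + t)) v| ≤
          2 * C * ε * θ ^ k := by
      intro k
      induction k using Nat.strong_induction_on with
      | _ k ih =>
        intro t htk u hu v hv
        -- The bounds for the shorter compositions control the distortion of the present one;
        -- multiplied by the derivative at the orbit point `x n` they give the next bound.
        have h1 := h.distUpper_of_sum (n := k) (η := fun j => ξ (j + t))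
          (l := fun s => 2 * C * ε * θ ^ (k - (s + 1))) hJI (by
            intro s hs u hu v hv
            have := ih (k - (s + 1)) (by omega) (t + (s + 1)) (by omega) u hu v hv
            simpa only [add_assoc, add_comm, add_left_comm] using this) u hu v hv (x n) hxJ
        have h2 : ∑ s ∈ Finset.range k, 2 * C * ε * θ ^ (k - (s + 1)) ≤ 2 * C * ε / (1 - θ) := by
          have := geom_sum_reflect_le (ε := 1 - θ) (C := 2 * C * ε) (by linarith) (by linarith)
            (by positivity) k
          rw [sub_sub_cancel] at this
          refine le_trans (le_of_eq ?_) this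
          exact Finset.sum_congr rfl fun s _ => by ring
        have h3 := hD k _ _ (ho.shift t)
        rw [add_comm k t, htk] at h3
        have hp := (h.seqDeriv_pos (n := k) (η := fun j => ξ (j + t)) (ho n).1).le
        calc _ ≤ _ := h1
          _ ≤ 2 * (C * θ ^ k) * ε := by
            have a1 : Real.exp (K * ∑ s ∈ Finset.range k, 2 * C * ε * θ ^ (k - (s + 1))) ≤ 2 :=
              le_trans (by gcongr) hε
            have a2 := hJε u hu v hv
            gcongr
          _ = _ := by ring
    rw [seqMap_add, seqMap_add]
    have := hind n 0 (by omega) _ (mem_image_of_mem _ h.left_mem) _ (mem_image_of_mem _ h.right_mem)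
    simpa only [add_zero] using this
  refine ⟨max (2 * C * ε) (e₁ - e₀) / θ ^ m, θ, by positivity, hθ0, hθ1, fun n η => ?_⟩
  rcases le_or_gt m n with hle | hgt
  · obtain ⟨k, rfl⟩ := Nat.exists_eq_add_of_le' hle
    refine (key k η).trans ?_
    rw [pow_add, div_mul_eq_mul_div, le_div_iff₀ (by positivity), ← mul_assoc]
    gcongr
    exact le_max_left _ _
  · have h1 : |seqMap g n η e₀ - seqMap g n η e₁| ≤ e₁ - e₀ := by
      have a1 := h.seqMap_mapsTo (n := n) (η := η) h.left_mem
      have a2 := h.seqMap_mapsTo (n := n) (η := η) h.right_mem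
      rw [_root_.abs_le]
      constructor <;> linarith [a1.1, a1.2, a2.1, a2.2]
    refine h1.trans ?_
    rw [div_mul_eq_mul_div, le_div_iff₀ (by positivity)]
    have h2 : θ ^ m ≤ θ ^ n := pow_le_pow_of_le_one hθ0.le hθ1.le hgt.le
    exact mul_le_mul (le_max_right _ _) h2 (by positivity) (by positivity)

end IsIntervalIFS

/-! ### Variations and cylinders -/

theorem ofReal_abs_sub_le_variation {g : ℝ → ℝ} {Y : Set ℝ} {P : Set (Set ℝ)} {ψ : ℝ → ℝ} {n : ℕ}
    {u v : ℝ} (hu : u ∈ Y) (hv : v ∈ Y)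
    (h : ∀ k < n, ∃ E ∈ P, g^[k] u ∈ E ∧ g^[k] v ∈ E) :
    ENNReal.ofReal |ψ u - ψ v| ≤ variation g Y P ψ n := by
  choose c hcP hcu hcv using fun j : Fin n => h j j.2
  have hZ : {x | x ∈ Y ∧ ∀ j : Fin n, g^[(j : ℕ)] x ∈ c j} ∈ cylinders g Y P n :=
    ⟨⟨u, hu, hcu⟩, c, hcP, rfl⟩
  exact le_iSup₂_of_le _ hZ (le_iSup₂_of_le u ⟨hu, hcu⟩ (le_iSup₂_of_le v ⟨hv, hcv⟩ le_rfl))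

theorem exists_mem_of_mem_cylinders {g : ℝ → ℝ} {Y : Set ℝ} {P : Set (Set ℝ)} {n : ℕ} {Z : Set ℝ}
    (hZ : Z ∈ cylinders g Y P n) {u v : ℝ} (hu : u ∈ Z) (hv : v ∈ Z) {k : ℕ} (hk : k < n) :
    ∃ E ∈ P, g^[k] u ∈ E ∧ g^[k] v ∈ E := by
  obtain ⟨-, c, hc, rfl⟩ := hZ
  exact ⟨c ⟨k, hk⟩, hc _, hu.2 ⟨k, hk⟩, hv.2 ⟨k, hk⟩⟩

theorem IsBranchPartition.neg {f : ℝ → ℝ} {I : Set ℝ} {P : Set (Set ℝ)}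
    (hP : IsBranchPartition f I P) : IsBranchPartition (fun x => -f x) I P where
  finite := hP.finite
  nonempty := hP.nonempty
  ordConnected := hP.ordConnected
  disjoint := hP.disjoint
  sUnion_eq := hP.sUnion_eq
  monotone C hC := (hP.monotone C hC).symm.imp (fun h _ hx _ hy hxy => neg_lt_neg (h hx hy hxy))
    fun h _ hx _ hy hxy => neg_lt_neg (h hx hy hxy)
  maximal C hC C' hC' hne h := hP.maximal C hC C' hC' hne
    ⟨h.1, h.2.symm.imp (fun h _ hx _ hy hxy => neg_lt_neg_iff.1 (h hx hy hxy))
      fun h _ hx _ hy hxy => neg_lt_neg_iff.1 (h hx hy hxy)⟩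

/-- A branch that meets an open interval of increase is itself increasing. -/
theorem strictMonoOn_of_mem_Ioo {f : ℝ → ℝ} {C : Set ℝ} (hC : C.OrdConnected)
    (hm : StrictMonoOn f C ∨ StrictAntiOn f C) {u v p : ℝ} (hf : StrictMonoOn f (Ioo u v))
    (hp : p ∈ Ioo u v) (hpC : p ∈ C) : StrictMonoOn f C := by
  refine hm.elim id fun hanti => ?_
  -- A second point of a decreasing branch would, together with `p`, give a subinterval on which `f`
  -- both increases and decreases. So the branch is a single point and vacuously increasing.
  have hsub : ∀ c ∈ C, c = p := by
    intro c hc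
    rcases lt_trichotomy c p with h | h | h
    · have h1 : (max c ((u + p) / 2)) < p := max_lt h (by linarith [hp.1])
      have h2 : max c ((u + p) / 2) ∈ C := hC.out hc hpC ⟨le_max_left _ _, h1.le⟩
      have h3 : max c ((u + p) / 2) ∈ Ioo u v :=
        ⟨lt_of_lt_of_le (by linarith [hp.1]) (le_max_right _ _), h1.trans hp.2⟩
      exact absurd (hf h3 hp h1) (hanti h2 hpC h1).not_gt
    · exact h
    · have h1 : p < (min c ((v + p) / 2)) := lt_min h (by linarith [hp.2])
      have h2 : min c ((v + p) / 2) ∈ C := hC.out hpC hc ⟨h1.le, min_le_left _ _⟩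
      have h3 : min c ((v + p) / 2) ∈ Ioo u v :=
        ⟨hp.1.trans h1, lt_of_le_of_lt (min_le_right _ _) (by linarith [hp.2])⟩
      exact absurd (hf hp h3 h1) (hanti hpC h2 h1).not_gt
  intro x hx y hy hxy
  rw [hsub x hx, hsub y hy] at hxy
  exact absurd hxy (lt_irrefl _)

/-- If the branch `C` of `p` misses `q`, take among the other branches meeting `[p, q]` the one
whose chosen point `r` is leftmost. No third branch fits between it and `C`, so their union is an
interval, and `f` increases on it, against maximality. -/
theorem IsBranchPartition.exists_mem_of_strictMonoOn {f : ℝ → ℝ} {I : Set ℝ} {P : Set (Set ℝ)}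
    (hP : IsBranchPartition f I P) {u v p q : ℝ} (hI : Ioo u v ⊆ I)
    (hf : StrictMonoOn f (Ioo u v)) (hp : p ∈ Ioo u v) (hq : q ∈ Ioo u v) (hpq : p ≤ q) :
    ∃ E ∈ P, p ∈ E ∧ q ∈ E := by
  have hcov : ∀ z ∈ Ioo u v, ∃ E ∈ P, z ∈ E := fun z hz => by
    have := hI hz
    rw [← hP.sUnion_eq] at this
    exact this
  have hinj : ∀ {A B : Set ℝ} {z : ℝ}, A ∈ P → B ∈ P → z ∈ A → z ∈ B → A = B :=
    fun hA hB hzA hzB => by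
      by_contra hne
      exact Set.disjoint_left.1 (hP.disjoint hA hB hne) hzA hzB
  obtain ⟨C, hCP, hpC⟩ := hcov p hp
  by_contra hcon
  push Not at hcon
  set 𝓕 : Set (Set ℝ) := {E | E ∈ P ∧ E ≠ C ∧ (E ∩ Icc p q).Nonempty} with h𝓕
  have hfin : 𝓕.Finite := hP.finite.subset fun E hE => hE.1
  have hne : 𝓕.Nonempty := by
    obtain ⟨E, hE, hqE⟩ := hcov q hq
    exact ⟨E, hE, fun h => hcon C hCP hpC (h ▸ hqE), q, hqE, hpq, le_rfl⟩
  choose! r hr using fun E (hE : E ∈ 𝓕) => hE.2.2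
  obtain ⟨C', hC', hmin⟩ := hfin.exists_minimalFor r 𝓕 hne
  have hrC' := hr C' hC'
  obtain ⟨hC'P, hC'ne, -⟩ := hC'
  have hrJ : r C' ∈ Ioo u v := ⟨hp.1.trans_le hrC'.2.1, hrC'.2.2.trans_lt hq.2⟩
  have hCo := hP.ordConnected C hCP
  have hCo' := hP.ordConnected C' hC'P
  have hpr : p < r C' := lt_of_le_of_ne hrC'.2.1 fun h => hC'ne (hinj hC'P hCP hrC'.1 (h ▸ hpC))
  have hcr : ∀ c ∈ C, c < r C' := fun c hc => by
    by_contra! h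
    exact hC'ne (hinj hC'P hCP hrC'.1 (hCo.out hpC hc ⟨hpr.le, h⟩))
  have hpc : ∀ c ∈ C', p < c := fun c hc => by
    by_contra! h
    exact hC'ne (hinj hC'P hCP (hCo'.out hc hrC'.1 ⟨h, hpr.le⟩) hpC)
  have hlt : ∀ c ∈ C, ∀ c' ∈ C', c < c' := fun c hc c' hc' => by
    by_contra! h
    exact hC'ne (hinj hC'P hCP hc' (hCo.out hpC hc ⟨(hpc c' hc').le, h⟩))
  have hm := strictMonoOn_of_mem_Ioo hCo (hP.monotone C hCP) hf hp hpC
  have hm' := strictMonoOn_of_mem_Ioo hCo' (hP.monotone C' hC'P) hf hrJ hrC'.1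
  have hbetween : ∀ c ∈ C, ∀ c' ∈ C', Icc c c' ⊆ C ∪ C' := by
    intro c hc c' hc' z hz
    by_cases hzp : z ≤ p
    · exact Or.inl (hCo.out hc hpC ⟨hz.1, hzp⟩)
    by_cases hzr : r C' ≤ z
    · exact Or.inr (hCo'.out hrC'.1 hc' ⟨hzr, hz.2⟩)
    push Not at hzp hzr
    obtain ⟨E, hE, hzE⟩ := hcov z ⟨hp.1.trans hzp, hzr.trans hrJ.2⟩
    by_cases hEC : E = C
    · exact Or.inl (hEC ▸ hzE)
    by_cases hEC' : E = C'
    · exact Or.inr (hEC' ▸ hzE)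
    exfalso
    have hE𝓕 : E ∈ 𝓕 := ⟨hE, hEC, z, hzE, hzp.le, hzr.le.trans hrC'.2.2⟩
    have h1 : r E ≤ r C' := by
      by_contra! h
      exact hEC' (hinj hE hC'P ((hP.ordConnected E hE).out hzE (hr E hE𝓕).1 ⟨hzr.le, h.le⟩) hrC'.1)
    exact hEC' (hinj hE hC'P (hr E hE𝓕).1 ((h1.antisymm (hmin hE𝓕 h1)) ▸ hrC'.1))
  refine hP.maximal C hCP C' hC'P (Ne.symm hC'ne) ⟨⟨?_⟩, Or.inl ?_⟩
  · rintro x (hx | hx) y (hy | hy) z hz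
    · exact Or.inl (hCo.out hx hy hz)
    · exact hbetween x hx y hy hz
    · exact absurd (hz.1.trans hz.2) (hlt y hy x hx).not_ge
    · exact Or.inr (hCo'.out hx hy hz)
  · rintro x (hx | hx) y (hy | hy) hxy
    · exact hm hx hy hxy
    · have h1 : max x p < y := max_lt hxy (hpc y hy)
      have h2 : max x p < r C' := max_lt (hcr x hx) hpr
      have h3 : max x p ∈ C := by rcases max_choice x p with h | h <;> rw [h] <;> assumption
      have h4 : min y (r C') ∈ C' := by
        rcases min_choice y (r C') with h | h <;> rw [h]
        exacts [hy, hrC'.1]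
      have h5 : max x p ∈ Ioo u v := ⟨hp.1.trans_le (le_max_right _ _), h2.trans hrJ.2⟩
      have h6 : max x p < min y (r C') := lt_min h1 h2
      have h7 : min y (r C') ∈ Ioo u v := ⟨h5.1.trans h6, (min_le_right _ _).trans_lt hrJ.2⟩
      calc f x ≤ f (max x p) := hm.monotoneOn hx h3 (le_max_left _ _)
        _ < f (min y (r C')) := hf h5 h7 h6
        _ ≤ f y := hm'.monotoneOn h4 hy (min_le_left _ _)
    · exact absurd hxy (hlt y hy x hx).not_gt
    · exact hm' hx hy hxy

/-- An open interval on which `f` is monotone lies in one branch. -/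
theorem IsBranchPartition.exists_mem_of_mem_Ioo {f : ℝ → ℝ} {I : Set ℝ} {P : Set (Set ℝ)}
    (hP : IsBranchPartition f I P) {u v p q : ℝ} (hI : Ioo u v ⊆ I)
    (hf : StrictMonoOn f (Ioo u v) ∨ StrictAntiOn f (Ioo u v)) (hp : p ∈ Ioo u v)
    (hq : q ∈ Ioo u v) : ∃ E ∈ P, p ∈ E ∧ q ∈ E := by
  wlog hpq : p ≤ q generalizing p q
  · obtain ⟨E, hE, h⟩ := this hq hp (le_of_not_ge hpq)
    exact ⟨E, hE, h.symm⟩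
  rcases hf with hf | hf
  · exact hP.exists_mem_of_strictMonoOn hI hf hp hq hpq
  · exact hP.neg.exists_mem_of_strictMonoOn hI
      (fun _ hx _ hy hxy => neg_lt_neg (hf hx hy hxy)) hp hq hpq

/-! ### Words of an inducing scheme -/

theorem mapsTo_uIcc_of_injOn {h : ℝ → ℝ} {x y : ℝ} (hxy : x ≤ y) (hc : ContinuousOn h (Icc x y))
    (hi : InjOn h (Icc x y)) : MapsTo h (Icc x y) (uIcc (h x) (h y)) := by
  intro z hz
  rcases hc.strictMonoOn_of_injOn_Icc' hxy hi with hm | hm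
  · exact Icc_subset_uIcc ⟨hm.monotoneOn (left_mem_Icc.2 hxy) hz hz.1,
      hm.monotoneOn hz (right_mem_Icc.2 hxy) hz.2⟩
  · exact Icc_subset_uIcc' ⟨hm.antitoneOn hz (right_mem_Icc.2 hxy) hz.2,
      hm.antitoneOn (left_mem_Icc.2 hxy) hz hz.1⟩

namespace InducingScheme

variable {f : ℝ → ℝ} {I : Set ℝ} {ι : Type*}

theorem map_eq (S : InducingScheme f I ι) {i : ι} {x : ℝ} (hx : x ∈ S.dom i) :
    S.map x = f^[S.tau i] x := by
  rw [map, S.time_eq hx]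

theorem mapsTo_dom (S : InducingScheme f I ι) (i : ι) :
    MapsTo f^[S.tau i] (S.dom i) S.base := by
  obtain ⟨e, he⟩ := S.homeo i
  intro x hx
  rw [← he ⟨x, hx⟩]
  exact (e _).2

theorem continuousOn_dom (S : InducingScheme f I ι) (i : ι) :
    ContinuousOn f^[S.tau i] (S.dom i) := by
  obtain ⟨e, he⟩ := S.homeo i
  rw [continuousOn_iff_continuous_domRestrict]
  have : (S.dom i).domRestrict f^[S.tau i] = fun x => (e x : ℝ) := funext fun x => (he x).symm
  rw [this]
  exact continuous_subtype_val.comp e.continuous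

theorem injOn_dom (S : InducingScheme f I ι) (i : ι) : InjOn f^[S.tau i] (S.dom i) := by
  obtain ⟨e, he⟩ := S.homeo i
  intro x hx y hy hxy
  rw [← he ⟨x, hx⟩, ← he ⟨y, hy⟩] at hxy
  exact congrArg Subtype.val (e.injective (Subtype.ext hxy))

theorem surjOn_dom (S : InducingScheme f I ι) (i : ι) :
    SurjOn f^[S.tau i] (S.dom i) S.base := by
  obtain ⟨e, he⟩ := S.homeo i
  intro y hy
  exact ⟨e.symm ⟨y, hy⟩, (e.symm ⟨y, hy⟩).2, by rw [← he, e.apply_symm_apply]⟩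

/-- The total inducing time of the first `n` letters of a word. -/
def wordTime (S : InducingScheme f I ι) (w : ℕ → ι) (n : ℕ) : ℕ :=
  ∑ k ∈ Finset.range n, S.tau (w k)

theorem wordTime_succ (S : InducingScheme f I ι) (w : ℕ → ι) (n : ℕ) :
    S.wordTime w (n + 1) = S.tau (w n) + S.wordTime w n := by
  rw [wordTime, Finset.sum_range_succ, add_comm]; rfl

theorem exists_eq_of_lt_wordTime (S : InducingScheme f I ι) (w : ℕ → ι) {n k : ℕ}
    (hk : k < S.wordTime w n) : ∃ j < n, ∃ r < S.tau (w j), k = r + S.wordTime w j := by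
  induction n with
  | zero => simp [wordTime] at hk
  | succ n ih =>
    by_cases h : k < S.wordTime w n
    · obtain ⟨j, hj, hr⟩ := ih h
      exact ⟨j, hj.trans n.lt_succ_self, hr⟩
    · rw [S.wordTime_succ] at hk
      exact ⟨n, n.lt_succ_self, k - S.wordTime w n, by omega, by omega⟩

theorem tau_add_le_wordTime (S : InducingScheme f I ι) (w : ℕ → ι) (n : ℕ) :
    S.tau (w 0) + n ≤ S.wordTime w (n + 1) := by
  induction n with
  | zero => simp [wordTime]
  | succ n ih =>
    rw [S.wordTime_succ]
    have := S.tau_pos (w (n + 1))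
    omega

/-- `x` follows the word `w` for `n` steps of the induced map. -/
def Follows (S : InducingScheme f I ι) (w : ℕ → ι) (n : ℕ) (x : ℝ) : Prop :=
  ∀ j < n, f^[S.wordTime w j] x ∈ S.dom (w j)

theorem map_iterate_eq (S : InducingScheme f I ι) {w : ℕ → ι} {n : ℕ} {x : ℝ}
    (h : ∀ j < n, S.map^[j] x ∈ S.dom (w j)) : S.map^[n] x = f^[S.wordTime w n] x := by
  induction n with
  | zero => rfl
  | succ n ih =>
    rw [Function.iterate_succ_apply', S.map_eq (h n n.lt_succ_self),
      ih fun j hj => h j (hj.trans n.lt_succ_self), S.wordTime_succ, Function.iterate_add_apply]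

theorem follows_of_map (S : InducingScheme f I ι) {w : ℕ → ι} {n : ℕ} {x : ℝ}
    (h : ∀ j < n, S.map^[j] x ∈ S.dom (w j)) : S.Follows w n x := fun j hj => by
  rw [← S.map_iterate_eq fun k hk => h k (hk.trans hj)]
  exact h j hj

theorem exists_word_of_mem_cylinders (S : InducingScheme f I ι) {n : ℕ} {Z : Set ℝ}
    (hZ : Z ∈ cylinders S.map S.base (range S.dom) (n + 1)) :
    ∃ w : ℕ → ι, ∀ x ∈ Z, S.Follows w (n + 1) x := by
  obtain ⟨-, c, hc, rfl⟩ := hZ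
  choose d hd using hc
  refine ⟨fun k => if h : k < n + 1 then d ⟨k, h⟩ else d 0, fun x hx => S.follows_of_map ?_⟩
  intro j hj
  simp only [hj, dif_pos, hd]
  exact hx.2 ⟨j, hj⟩

theorem Follows.injOn_continuousOn {S : InducingScheme f I ι} {w : ℕ → ι} {n : ℕ} {x y : ℝ}
    (hxy : x ≤ y) (hx : S.Follows w n x) (hy : S.Follows w n y) :
    InjOn f^[S.wordTime w n] (Icc x y) ∧ ContinuousOn f^[S.wordTime w n] (Icc x y) := by
  induction n with
  | zero => exact ⟨fun _ _ _ _ h => h, continuousOn_id⟩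
  | succ n ih =>
    obtain ⟨h1, h2⟩ := ih (fun j hj => hx j (hj.trans n.lt_succ_self))
      fun j hj => hy j (hj.trans n.lt_succ_self)
    have h3 : MapsTo f^[S.wordTime w n] (Icc x y) (S.dom (w n)) :=
      (mapsTo_uIcc_of_injOn hxy h2 h1).mono_right
        ((S.dom_ordConnected _).uIcc_subset (hx n n.lt_succ_self) (hy n n.lt_succ_self))
    rw [S.wordTime_succ, Function.iterate_add]
    exact ⟨(S.injOn_dom _).comp h1 h3, (S.continuousOn_dom _).comp h2 h3⟩

end InducingScheme

/-- On an interval where `f^[n]` is injective, the first `n` iterates of two interior points lie in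
common branches. -/
theorem IsBranchPartition.exists_mem_iterate {f : ℝ → ℝ} {a b : ℝ} {P : Set (Set ℝ)}
    (hP : IsBranchPartition f (Icc a b) P) (hmaps : MapsTo f (Icc a b) (Icc a b))
    (hcont : ContinuousOn f (Icc a b)) {x y : ℝ} (hx : x ∈ Icc a b) (hy : y ∈ Icc a b)
    {n : ℕ} (hinj : InjOn f^[n] (Icc x y)) {u v : ℝ} (hu : u ∈ Ioo x y) (hv : v ∈ Ioo x y)
    {k : ℕ} (hk : k < n) : ∃ E ∈ P, f^[k] u ∈ E ∧ f^[k] v ∈ E := by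
  have hxy : x ≤ y := (hu.1.trans hu.2).le
  have hsub : Icc x y ⊆ Icc a b := Icc_subset_Icc hx.1 hy.2
  have hinjk : ∀ m ≤ n, InjOn f^[m] (Icc x y) := by
    intro m hm
    obtain ⟨l, rfl⟩ : ∃ l, n = l + m := ⟨n - m, by omega⟩
    rw [Function.iterate_add] at hinj
    intro s hs t ht hst
    exact hinj hs ht (congrArg f^[l] hst)
  have hcontk : ∀ m, ContinuousOn f^[m] (Icc x y) := fun m =>
    (hcont.iterate hmaps m).mono hsub
  have hivt : ∀ z ∈ uIcc (f^[k] x) (f^[k] y), ∃ s ∈ Icc x y, f^[k] s = z := by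
    have := intermediate_value_uIcc (f := f^[k]) (a := x) (b := y) (by rw [uIcc_of_le hxy]; exact hcontk k)
    rw [uIcc_of_le hxy] at this
    exact this
  -- Injectivity of `f^[k + 1]` on `[x, y]` makes `f` injective on the image interval of `f^[k]`,
  -- whose interior therefore lies in one branch.
  have hinjf : InjOn f (uIcc (f^[k] x) (f^[k] y)) := by
    intro z hz z' hz' hzz
    obtain ⟨s, hs, rfl⟩ := hivt z hz
    obtain ⟨t, ht, rfl⟩ := hivt z' hz'
    rw [← Function.iterate_succ_apply' f k, ← Function.iterate_succ_apply' f k] at hzz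
    rw [hinjk (k + 1) hk hs ht hzz]
  have hI : uIcc (f^[k] x) (f^[k] y) ⊆ Icc a b := by
    intro z hz
    obtain ⟨s, hs, rfl⟩ := hivt z hz
    exact hmaps.iterate k (hsub hs)
  have hmono := (hcont.mono hI).strictMonoOn_of_injOn_Icc' (min_le_max) hinjf
  have hIoo : Ioo (min (f^[k] x) (f^[k] y)) (max (f^[k] x) (f^[k] y)) ⊆
      uIcc (f^[k] x) (f^[k] y) := Ioo_subset_Icc_self
  have hmem : ∀ s ∈ Ioo x y, f^[k] s ∈ Ioo (min (f^[k] x) (f^[k] y)) (max (f^[k] x) (f^[k] y)) := by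
    intro s hs
    have hxI := left_mem_Icc.2 hxy
    have hyI := right_mem_Icc.2 hxy
    have hsI := Ioo_subset_Icc_self hs
    have h1 := mapsTo_uIcc_of_injOn hxy (hcontk k) (hinjk k hk.le) hsI
    have h2 : f^[k] s ≠ f^[k] x := fun h => hs.1.ne' (hinjk k hk.le hsI hxI h)
    have h3 : f^[k] s ≠ f^[k] y := fun h => hs.2.ne (hinjk k hk.le hsI hyI h)
    refine ⟨lt_of_le_of_ne h1.1 fun h => ?_, lt_of_le_of_ne h1.2 fun h => ?_⟩
    · rcases min_choice (f^[k] x) (f^[k] y) with h' | h' <;> rw [h'] at h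
      exacts [h2 h.symm, h3 h.symm]
    · rcases max_choice (f^[k] x) (f^[k] y) with h' | h' <;> rw [h'] at h
      exacts [h2 h, h3 h]
  exact hP.exists_mem_of_mem_Ioo (hIoo.trans hI)
    (hmono.imp (fun h => h.mono hIoo) fun h => h.mono hIoo) (hmem u hu) (hmem v hv)

/-- At a turning point an end of the interval may be assigned to the neighbouring branch. The bound
holds for interior points and passes to the ends by continuity of `φ ∘ f^[k]`. -/
theorem ofReal_abs_sub_le_variation_of_injOn {f φ : ℝ → ℝ} {a b : ℝ} {P : Set (Set ℝ)}
    (hP : IsBranchPartition f (Icc a b) P) (hmaps : MapsTo f (Icc a b) (Icc a b))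
    (hcont : ContinuousOn f (Icc a b)) (hφ : ContinuousOn φ (Icc a b)) {x y : ℝ}
    (hx : x ∈ Icc a b) (hy : y ∈ Icc a b) (hxy : x ≤ y) {n k : ℕ} (hinj : InjOn f^[n] (Icc x y))
    (hk : k ≤ n) :
    ENNReal.ofReal |φ (f^[k] x) - φ (f^[k] y)| ≤ variation f (Icc a b) P φ (n - k) := by
  rcases hxy.eq_or_lt with rfl | hlt
  · simp
  rcases eq_or_ne (variation f (Icc a b) P φ (n - k)) ⊤ with htop | htop
  · rw [htop]; exact le_top
  have hsub : Icc x y ⊆ Icc a b := Icc_subset_Icc hx.1 hy.2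
  have hψ : ContinuousOn (φ ∘ f^[k]) (Icc x y) :=
    (hφ.comp (hcont.iterate hmaps k) (hmaps.iterate k)).mono hsub
  have hclos : closure (Ioo x y) = Icc x y := closure_Ioo hlt.ne
  have key : ∀ p ∈ closure (Ioo x y ×ˢ Ioo x y),
      |φ (f^[k] p.1) - φ (f^[k] p.2)| ≤ (variation f (Icc a b) P φ (n - k)).toReal := by
    intro p hp
    have hc : ContinuousOn (fun p : ℝ × ℝ => |φ (f^[k] p.1) - φ (f^[k] p.2)|)
        (Icc x y ×ˢ Icc x y) :=
      ((hψ.comp continuousOn_fst fun p hp => hp.1).sub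
        (hψ.comp continuousOn_snd fun p hp => hp.2)).abs
    have hp' : p ∈ Icc x y ×ˢ Icc x y := by rwa [closure_prod_eq, hclos] at hp
    refine ContinuousWithinAt.closure_le hp ((hc p hp').mono
      (prod_mono Ioo_subset_Icc_self Ioo_subset_Icc_self)) continuousWithinAt_const ?_
    rintro ⟨u, v⟩ ⟨hu, hv⟩
    rw [← ENNReal.ofReal_le_iff_le_toReal htop]
    refine ofReal_abs_sub_le_variation (hmaps.iterate k (hsub (Ioo_subset_Icc_self hu)))
      (hmaps.iterate k (hsub (Ioo_subset_Icc_self hv))) fun j hj => ?_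
    rw [← Function.iterate_add_apply, ← Function.iterate_add_apply]
    exact hP.exists_mem_iterate hmaps hcont hx hy hinj hu hv (by omega)
  rw [ENNReal.ofReal_le_iff_le_toReal htop]
  refine key (x, y) ?_
  rw [closure_prod_eq, hclos]
  exact ⟨left_mem_Icc.2 hxy, right_mem_Icc.2 hxy⟩

/-- Exactly `m` pairs `(n, j)` satisfy `n + j + 1 = m`. -/
theorem ENNReal.tsum_tsum_add_succ_le (V : ℕ → ℝ≥0∞) :
    ∑' n, ∑' j, V (n + j + 1) ≤ ∑' n : ℕ, (n : ℝ≥0∞) * V n := by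
  have h1 : ∑' n, ∑' j, V (n + j + 1) = ∑' p : ℕ × ℕ, V (p.1 + p.2 + 1) :=
    (ENNReal.tsum_prod (f := fun n j => V (n + j + 1))).symm
  have h2 : ∑' p : ℕ × ℕ, V (p.1 + p.2 + 1) = ∑' m : ℕ, ((m + 1 : ℕ) : ℝ≥0∞) * V (m + 1) := by
    rw [← (Finset.HasAntidiagonal.sigmaAntidiagonalEquivProd (A := ℕ)).tsum_eq, ENNReal.tsum_sigma']
    refine tsum_congr fun m => ?_
    rw [tsum_fintype]
    calc _ = ∑ _p : Finset.HasAntidiagonal.antidiagonal m, V (m + 1) :=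
          Finset.sum_congr rfl fun p _ => by
            congr 2
            exact Finset.HasAntidiagonal.mem_antidiagonal.1 p.2
      _ = _ := by simp
  rw [h1, h2]
  exact ENNReal.tsum_comp_le_tsum_of_injective (f := fun m : ℕ => m + 1) (add_left_injective 1)
    fun n => (n : ℝ≥0∞) * V n

/-! ### Summable variations of the potential imply (SVI): part (a) -/

namespace InducingScheme

variable {f φ : ℝ → ℝ} {a b : ℝ} {ι : Type*}

/-- The total time is at least `τ + n`, so for `k < τ` the indices `wordTime - k` are distinct and
at least `n + 1`: the sum over `k` is a partial sum of the tail of `V`, however large `τ` is. -/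
theorem svi_of_forall {I : Set ℝ} (S : InducingScheme f I ι) (V : ℕ → ℝ≥0∞)
    (hV : ∑' n : ℕ, (n : ℝ≥0∞) * V n < ⊤)
    (h : ∀ (w : ℕ → ι) (n : ℕ) (x y : ℝ), x ∈ S.base → y ∈ S.base → S.Follows w (n + 1) x →
      S.Follows w (n + 1) y → ∀ k < S.tau (w 0),
      ENNReal.ofReal |φ (f^[k] x) - φ (f^[k] y)| ≤ V (S.wordTime w (n + 1) - k)) :
    S.SVI φ := by
  refine lt_of_le_of_lt (ENNReal.tsum_le_tsum fun n => ?_)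
    ((ENNReal.tsum_tsum_add_succ_le V).trans_lt hV)
  refine iSup₂_le fun Z hZ => iSup₂_le fun x hx => iSup₂_le fun y hy => ?_
  obtain ⟨w, hw⟩ := S.exists_word_of_mem_cylinders hZ
  have hxy : x ∈ S.base ∧ y ∈ S.base := by
    obtain ⟨-, c, -, rfl⟩ := hZ
    exact ⟨hx.1, hy.1⟩
  have hx0 : x ∈ S.dom (w 0) := hw x hx 0 n.succ_pos
  have hy0 : y ∈ S.dom (w 0) := hw y hy 0 n.succ_pos
  have hT := S.tau_add_le_wordTime w n
  calc ENNReal.ofReal |S.inducedPotential φ x - S.inducedPotential φ y|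
      = ENNReal.ofReal |∑ k ∈ Finset.range (S.tau (w 0)), (φ (f^[k] x) - φ (f^[k] y))| := by
        rw [inducedPotential, inducedPotential, S.time_eq hx0, S.time_eq hy0,
          Finset.sum_sub_distrib]
    _ ≤ ENNReal.ofReal (∑ k ∈ Finset.range (S.tau (w 0)), |φ (f^[k] x) - φ (f^[k] y)|) :=
        ENNReal.ofReal_le_ofReal (Finset.abs_sum_le_sum_abs _ _)
    _ = ∑ k ∈ Finset.range (S.tau (w 0)), ENNReal.ofReal |φ (f^[k] x) - φ (f^[k] y)| :=
        ENNReal.ofReal_sum_of_nonneg fun _ _ => abs_nonneg _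
    _ ≤ ∑ k ∈ Finset.range (S.tau (w 0)), V (n + (S.wordTime w (n + 1) - k - (n + 1)) + 1) :=
        Finset.sum_le_sum fun k hk => by
          have hk := Finset.mem_range.1 hk
          have he : n + (S.wordTime w (n + 1) - k - (n + 1)) + 1 = S.wordTime w (n + 1) - k := by
            omega
          rw [he]
          exact h w n x y hxy.1 hxy.2 (hw x hx) (hw y hy) k hk
    _ = ∑ j ∈ (Finset.range (S.tau (w 0))).image
          (fun k => S.wordTime w (n + 1) - k - (n + 1)), V (n + j + 1) := by
        rw [Finset.sum_image]
        intro k hk l hl hkl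
        simp only [Finset.coe_range, mem_Iio] at hk hl hkl
        omega
    _ ≤ ∑' j, V (n + j + 1) := ENNReal.sum_le_tsum _

theorem svi_of_isSubordinate (S : InducingScheme f (Icc a b) ι) {P : Set (Set ℝ)}
    (hmaps : MapsTo f (Icc a b) (Icc a b))
    (hV : ∑' n : ℕ, (n : ℝ≥0∞) * variation f (Icc a b) P φ n < ⊤) (hS : S.IsSubordinate P) :
    S.SVI φ := by
  refine S.svi_of_forall _ hV fun w n x y hx hy hwx hwy k hk => ?_
  refine ofReal_abs_sub_le_variation (hmaps.iterate k (S.base_subset hx))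
    (hmaps.iterate k (S.base_subset hy)) fun j hj => ?_
  rw [← Function.iterate_add_apply, ← Function.iterate_add_apply]
  obtain ⟨l, hl, r, hr, hjk⟩ := S.exists_eq_of_lt_wordTime w (n := n + 1) (k := j + k) (by omega)
  obtain ⟨Z, hZ, hsub⟩ := hS (w l)
  rw [hjk, Function.iterate_add_apply, Function.iterate_add_apply]
  exact exists_mem_of_mem_cylinders hZ (hsub (hwx l hl)) (hsub (hwy l hl)) hr

theorem svi_of_continuousOn (S : InducingScheme f (Icc a b) ι) {P : Set (Set ℝ)}
    (hP : IsBranchPartition f (Icc a b) P) (hmaps : MapsTo f (Icc a b) (Icc a b))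
    (hcont : ContinuousOn f (Icc a b))
    (hV : ∑' n : ℕ, (n : ℝ≥0∞) * variation f (Icc a b) P φ n < ⊤)
    (hφ : ContinuousOn φ (Icc a b)) : S.SVI φ := by
  refine S.svi_of_forall _ hV fun w n x y hx hy hwx hwy k hk => ?_
  wlog hxy : x ≤ y generalizing x y
  · rw [abs_sub_comm]
    exact this y x hy hx hwy hwx (le_of_not_ge hxy)
  exact ofReal_abs_sub_le_variation_of_injOn hP hmaps hcont hφ (S.base_subset hx)
    (S.base_subset hy) hxy (hwx.injOn_continuousOn hxy hwy).1
    (hk.le.trans ((Nat.le_add_right _ _).trans (S.tau_add_le_wordTime w n)))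

end InducingScheme

/-! ### Cross-ratios -/

/-- Two-point estimate for a function whose derivative is midpoint log-concave. -/
theorem mul_sqrt_le_sub_of_logConcave {N W : ℝ → ℝ} {p y : ℝ} (hpy : p ≤ y)
    (hN : ∀ x ∈ Icc p y, HasDerivAt N (W x) x) (hW : ∀ x ∈ Icc p y, 0 ≤ W x)
    (hlc : ∀ s ∈ Icc p y, W p * W y ≤ W s * W (p + y - s)) :
    (y - p) * √(W p * W y) ≤ N y - N p := by
  set m := (p + y) / 2 with hm
  set κ := √(W p * W y) with hκ
  have hmem : ∀ t ∈ Icc 0 ((y - p) / 2), m + t ∈ Icc p y ∧ m - t ∈ Icc p y := fun t ht =>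
    ⟨⟨by linarith [ht.1], by linarith [ht.2]⟩, by linarith [ht.2], by linarith [ht.1]⟩
  have hd : ∀ t ∈ Icc 0 ((y - p) / 2), HasDerivAt
      (fun t => N (m + t) - N (m - t) - 2 * t * κ) (W (m + t) + W (m - t) - 2 * κ) t := by
    intro t ht
    have h1 : HasDerivAt (fun t => N (m + t)) (W (m + t)) t := by
      simpa using (hN _ (hmem t ht).1).comp_const_add m t
    have h2 : HasDerivAt (fun t => N (m - t)) (-W (m - t)) t := by
      simpa using (hN _ (hmem t ht).2).comp_const_sub m t
    have h3 : HasDerivAt (fun t : ℝ => 2 * t * κ) (2 * κ) t := by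
      simpa using ((hasDerivAt_id t).const_mul 2).mul_const κ
    exact ((h1.sub h2).sub h3).congr_deriv (by ring)
  -- The increment over `[m - t, m + t]` grows at rate `W (m + t) + W (m - t)`, which is at least `2
  -- * κ` by the midpoint inequality and the inequality between means.
  have hmono : MonotoneOn (fun t => N (m + t) - N (m - t) - 2 * t * κ) (Icc 0 ((y - p) / 2)) := by
    refine monotoneOn_of_deriv_nonneg (convex_Icc _ _)
      (fun t ht => (hd t ht).continuousAt.continuousWithinAt)
      (fun t ht => (hd t (interior_subset ht)).differentiableAt.differentiableWithinAt)
      fun t ht => ?_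
    have ht := interior_subset ht
    rw [(hd t ht).deriv]
    have h1 := hlc _ (hmem t ht).1
    rw [show p + y - (m + t) = m - t by rw [hm]; ring] at h1
    have ha := hW _ (hmem t ht).1
    have hb := hW _ (hmem t ht).2
    have h2 : κ ≤ (W (m + t) + W (m - t)) / 2 := by
      rw [hκ, Real.sqrt_le_left (by linarith)]
      nlinarith [sq_nonneg (W (m + t) - W (m - t))]
    linarith
  have := hmono (left_mem_Icc.2 (by linarith)) (right_mem_Icc.2 (by linarith))
    (by linarith : (0 : ℝ) ≤ (y - p) / 2)
  simp only [add_zero, sub_zero, mul_zero, zero_mul, sub_self] at this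
  rw [show m + (y - p) / 2 = y by rw [hm]; ring, show m - (y - p) / 2 = p by rw [hm]; ring] at this
  linarith

/-- Log-concave derivative: the cross-ratio `|c - b||d - a| / (|c - a||d - b|)` increases. -/
theorem crossRatio_le_of_logConcave {N W : ℝ → ℝ} {a b c d : ℝ} (hab : a < b) (hbc : b < c)
    (hcd : c < d) (hN : ∀ x ∈ Icc a d, HasDerivAt N (W x) x) (hW : ∀ x ∈ Icc a d, 0 < W x)
    (hlc : ∀ p ∈ Icc a d, ∀ y ∈ Icc a d, ∀ s ∈ Icc p y, W p * W y ≤ W s * W (p + y - s)) :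
    Real.log (N c - N a) - Real.log (c - a) + (Real.log (N d - N b) - Real.log (d - b)) ≤
      Real.log (N c - N b) - Real.log (c - b) + (Real.log (N d - N a) - Real.log (d - a)) := by
  have hpos : ∀ p ∈ Icc a d, ∀ y ∈ Icc a d, p < y → 0 < N y - N p := by
    intro p hp y hy hpy
    have hsub : Icc p y ⊆ Icc a d := Icc_subset_Icc hp.1 hy.2
    refine lt_of_lt_of_le ?_ (mul_sqrt_le_sub_of_logConcave hpy.le (fun x hx => hN x (hsub hx))
      (fun x hx => (hW x (hsub hx)).le) (hlc p hp y hy))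
    exact mul_pos (by linarith) (Real.sqrt_pos.2 (mul_pos (hW p hp) (hW y hy)))
  -- The mixed second derivative of `log ((N y - N p) / (y - p))` is `W y * W p / (N y - N p)² - 1 /
  -- (y - p)²`, nonpositive by the two-point estimate. The claim is its integral over `[a, b] × [c,
  -- d]`.
  have hH : ∀ y ∈ Icc c d, AntitoneOn (fun p => W y / (N y - N p) - 1 / (y - p)) (Icc a b) := by
    intro y hy
    have hyI : y ∈ Icc a d := ⟨by linarith [hy.1], hy.2⟩
    have hd : ∀ p ∈ Icc a b, HasDerivAt (fun p => W y / (N y - N p) - 1 / (y - p))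
        (W y * W p / (N y - N p) ^ 2 - 1 / (y - p) ^ 2) p := by
      intro p hp
      have hpI : p ∈ Icc a d := ⟨hp.1, by linarith [hp.2]⟩
      have hpy : p < y := by linarith [hp.2, hy.1]
      have h1 := ((hN p hpI).const_sub (N y)).inv (hpos p hpI y hyI hpy).ne'
      have h2 := ((hasDerivAt_id p).const_sub y).inv (sub_pos.2 hpy).ne'
      have he : (fun p => W y / (N y - N p) - 1 / (y - p)) =
          fun p => W y * (N y - N p)⁻¹ - (y - p)⁻¹ := by simp only [div_eq_mul_inv, one_mul]
      rw [he]
      exact ((h1.const_mul (W y)).sub h2).congr_deriv (by simp only [id]; ring)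
    refine antitoneOn_of_deriv_nonpos (convex_Icc _ _)
      (fun t ht => (hd t ht).continuousAt.continuousWithinAt)
      (fun t ht => (hd t (interior_subset ht)).differentiableAt.differentiableWithinAt)
      fun p hp => ?_
    have hp := interior_subset hp
    have hpI : p ∈ Icc a d := ⟨hp.1, by linarith [hp.2]⟩
    have hpy : p < y := by linarith [hp.2, hy.1]
    have hsub : Icc p y ⊆ Icc a d := Icc_subset_Icc hpI.1 hyI.2
    rw [(hd p hp).deriv, sub_nonpos, div_le_div_iff₀ (pow_pos (hpos p hpI y hyI hpy) 2)
      (pow_pos (sub_pos.2 hpy) 2), one_mul]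
    have h1 := mul_sqrt_le_sub_of_logConcave hpy.le (fun x hx => hN x (hsub hx))
      (fun x hx => (hW x (hsub hx)).le) (hlc p hpI y hyI)
    have h2 := pow_le_pow_left₀ (mul_nonneg (sub_pos.2 hpy).le (Real.sqrt_nonneg _)) h1 2
    rw [mul_pow, Real.sq_sqrt (mul_pos (hW p hpI) (hW y hyI)).le] at h2
    linarith
  have hd : ∀ p ∈ Icc a b, ∀ y ∈ Icc c d, HasDerivAt
      (fun y => Real.log (N y - N p) - Real.log (y - p)) (W y / (N y - N p) - 1 / (y - p)) y := by
    intro p hp y hy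
    have hpI : p ∈ Icc a d := ⟨hp.1, by linarith [hp.2]⟩
    have hyI : y ∈ Icc a d := ⟨by linarith [hy.1], hy.2⟩
    have hpy : p < y := by linarith [hp.2, hy.1]
    exact (((hN y hyI).sub_const (N p)).log (hpos p hpI y hyI hpy).ne').sub
      (((hasDerivAt_id y).sub_const p).log (sub_pos.2 hpy).ne')
  have ha := left_mem_Icc.2 hab.le
  have hb := right_mem_Icc.2 hab.le
  have hmono : MonotoneOn (fun y => (Real.log (N y - N a) - Real.log (y - a)) -
      (Real.log (N y - N b) - Real.log (y - b))) (Icc c d) := by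
    have hd' := fun y hy => (hd a ha y hy).sub (hd b hb y hy)
    refine monotoneOn_of_deriv_nonneg (convex_Icc _ _)
      (fun t ht => (hd' t ht).continuousAt.continuousWithinAt)
      (fun t ht => (hd' t (interior_subset ht)).differentiableAt.differentiableWithinAt)
      fun y hy => ?_
    have hy := interior_subset hy
    rw [show (fun y => (Real.log (N y - N a) - Real.log (y - a)) -
      (Real.log (N y - N b) - Real.log (y - b))) = (fun y => Real.log (N y - N a) - Real.log (y - a))
      - fun y => Real.log (N y - N b) - Real.log (y - b) from rfl, (hd' y hy).deriv, sub_nonneg]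
    exact hH y hy ha hb hab.le
  have := hmono (left_mem_Icc.2 hcd.le) (right_mem_Icc.2 hcd.le) hcd.le
  simp only at this
  linarith

/-- Log-concave derivative: the cross-ratio `|c - b||d - a| / (|b - a||d - c|)` increases. -/
theorem crossRatio_mul_le_of_logConcave {N W : ℝ → ℝ} {a b c d : ℝ} (hab : a < b) (hbc : b < c)
    (hcd : c < d) (hN : ∀ x ∈ Icc a d, HasDerivAt N (W x) x) (hW : ∀ x ∈ Icc a d, 0 < W x)
    (hlc : ∀ p ∈ Icc a d, ∀ y ∈ Icc a d, ∀ s ∈ Icc p y, W p * W y ≤ W s * W (p + y - s)) :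
    (c - b) * (d - a) * ((N b - N a) * (N d - N c)) ≤
      (N c - N b) * (N d - N a) * ((b - a) * (d - c)) := by
  have hpos : ∀ p ∈ Icc a d, ∀ y ∈ Icc a d, p < y → 0 < N y - N p := by
    intro p hp y hy hpy
    have hsub : Icc p y ⊆ Icc a d := Icc_subset_Icc hp.1 hy.2
    refine lt_of_lt_of_le ?_ (mul_sqrt_le_sub_of_logConcave hpy.le (fun x hx => hN x (hsub hx))
      (fun x hx => (hW x (hsub hx)).le) (hlc p hp y hy))
    exact mul_pos (by linarith) (Real.sqrt_pos.2 (mul_pos (hW p hp) (hW y hy)))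
  have ha : a ∈ Icc a d := ⟨le_rfl, by linarith⟩
  have hb : b ∈ Icc a d := ⟨by linarith, by linarith⟩
  have hc : c ∈ Icc a d := ⟨by linarith, by linarith⟩
  have hd : d ∈ Icc a d := ⟨by linarith, le_rfl⟩
  have hac : a < c := hab.trans hbc
  have hbd : b < d := hbc.trans hcd
  have had : a < d := hac.trans hcd
  have h1 := crossRatio_le_of_logConcave hab hbc hcd hN hW hlc
  have e1 := hpos a ha c hc hac
  have e2 := hpos b hb d hd hbd
  have e3 := hpos b hb c hc hbc
  have e4 := hpos a ha d hd had
  have h2 : Real.log ((N c - N a) * (N d - N b) * ((c - b) * (d - a))) ≤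
      Real.log ((N c - N b) * (N d - N a) * ((c - a) * (d - b))) := by
    rw [Real.log_mul, Real.log_mul, Real.log_mul, Real.log_mul, Real.log_mul, Real.log_mul]
    · linarith
    all_goals
      first
      | exact (sub_pos.2 ‹_›).ne'
      | exact ne_of_gt ‹_›
      | exact (mul_pos ‹_› ‹_›).ne'
      | exact (mul_pos (sub_pos.2 ‹_›) (sub_pos.2 ‹_›)).ne'
  -- The identity `(c-a)(d-b) = (c-b)(d-a) + (b-a)(d-c)`, valid for the points and for their images,
  -- makes the two cross-ratio inequalities equivalent.
  have h3 := (Real.log_le_log_iff (mul_pos (mul_pos e1 e2) (mul_pos (sub_pos.2 hbc)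
    (sub_pos.2 had))) (mul_pos (mul_pos e3 e4) (mul_pos (sub_pos.2 hac) (sub_pos.2 hbd)))).1 h2
  linarith

theorem sub_le_sub_of_hasDerivAt_le {F G F' G' : ℝ → ℝ} {x y : ℝ} (hxy : x ≤ y)
    (hF : ∀ s ∈ Icc x y, HasDerivAt F (F' s) s) (hG : ∀ s ∈ Icc x y, HasDerivAt G (G' s) s)
    (h : ∀ s ∈ Icc x y, F' s ≤ G' s) : F y - F x ≤ G y - G x := by
  have hd := fun s hs => (hG s hs).sub (hF s hs)
  have hmono : MonotoneOn (G - F) (Icc x y) := by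
    refine monotoneOn_of_deriv_nonneg (convex_Icc _ _)
      (fun t ht => (hd t ht).continuousAt.continuousWithinAt)
      (fun t ht => (hd t (interior_subset ht)).differentiableAt.differentiableWithinAt)
      fun t ht => ?_
    rw [(hd t (interior_subset ht)).deriv]
    exact sub_nonneg.2 (h t (interior_subset ht))
  have := hmono (left_mem_Icc.2 hxy) (right_mem_Icc.2 hxy) hxy
  simp only [Pi.sub_apply] at this
  linarith

/-! ### Cross-ratios under power weights -/

/-- The weight `(x - c₁) ^ α * (c₂ - x) ^ β` on the interval `(c₁, c₂)`. -/
noncomputable def endWeight (c₁ c₂ α β x : ℝ) : ℝ := (x - c₁) ^ α * (c₂ - x) ^ β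

section endWeight

variable {c₁ c₂ α β : ℝ}

theorem endWeight_pos {x : ℝ} (hx : x ∈ Ioo c₁ c₂) : 0 < endWeight c₁ c₂ α β x :=
  mul_pos (Real.rpow_pos_of_pos (sub_pos.2 hx.1) _) (Real.rpow_pos_of_pos (sub_pos.2 hx.2) _)

theorem continuous_endWeight (hα : 0 ≤ α) (hβ : 0 ≤ β) : Continuous (endWeight c₁ c₂ α β) :=
  ((continuous_id.sub continuous_const).rpow_const fun _ => Or.inr hα).mul
    ((continuous_const.sub continuous_id).rpow_const fun _ => Or.inr hβ)

/-- Each factor obeys the inequality because `(s-c₁)(p+y-s-c₁) - (p-c₁)(y-c₁) = (s-p)(y-s)`, and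
similarly at `c₂`. -/
theorem endWeight_logConcave (hα : 0 ≤ α) (hβ : 0 ≤ β) {p y s : ℝ} (hp : p ∈ Ioo c₁ c₂)
    (hy : y ∈ Ioo c₁ c₂) (hs : s ∈ Icc p y) :
    endWeight c₁ c₂ α β p * endWeight c₁ c₂ α β y ≤
      endWeight c₁ c₂ α β s * endWeight c₁ c₂ α β (p + y - s) := by
  obtain ⟨hp1, hp2⟩ := hp
  obtain ⟨hy1, hy2⟩ := hy
  obtain ⟨hs1, hs2⟩ := hs
  have h1 : (p - c₁) ^ α * (y - c₁) ^ α ≤ (s - c₁) ^ α * (p + y - s - c₁) ^ α := by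
    rw [← Real.mul_rpow (by linarith) (by linarith), ← Real.mul_rpow (by linarith) (by linarith)]
    exact Real.rpow_le_rpow (mul_nonneg (by linarith) (by linarith))
      (by nlinarith [mul_nonneg (sub_nonneg.2 hs1) (sub_nonneg.2 hs2)]) hα
  have h2 : (c₂ - p) ^ β * (c₂ - y) ^ β ≤ (c₂ - s) ^ β * (c₂ - (p + y - s)) ^ β := by
    rw [← Real.mul_rpow (by linarith) (by linarith), ← Real.mul_rpow (by linarith) (by linarith)]
    exact Real.rpow_le_rpow (mul_nonneg (by linarith) (by linarith))
      (by nlinarith [mul_nonneg (sub_nonneg.2 hs1) (sub_nonneg.2 hs2)]) hβ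
  have h3 := mul_le_mul h1 h2 (mul_nonneg (Real.rpow_nonneg (by linarith) _)
    (Real.rpow_nonneg (by linarith) _)) (mul_nonneg (Real.rpow_nonneg (by linarith) _)
    (Real.rpow_nonneg (by linarith) _))
  unfold endWeight
  linarith

theorem endWeight_le (hα : 0 ≤ α) (hβ : 0 ≤ β) {s c : ℝ} (hs : c₁ < s) (hsc : s ≤ c)
    (h : c₂ - s ≤ 2 * (c₂ - c)) : endWeight c₁ c₂ α β s ≤ 2 ^ β * endWeight c₁ c₂ α β c := by
  have h1 : (s - c₁) ^ α ≤ (c - c₁) ^ α := Real.rpow_le_rpow (by linarith) (by linarith) hα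
  have h2 : (c₂ - s) ^ β ≤ 2 ^ β * (c₂ - c) ^ β := by
    rw [← Real.mul_rpow (by norm_num) (by linarith)]
    exact Real.rpow_le_rpow (by linarith) h hβ
  have h3 := mul_le_mul h1 h2 (Real.rpow_nonneg (by linarith) _) (Real.rpow_nonneg (by linarith) _)
  unfold endWeight
  linarith

theorem le_endWeight (hα : 0 ≤ α) (hβ : 0 ≤ β) {s c : ℝ} (hc : c₁ < c) (hsc : c ≤ s)
    (h : c₂ - c ≤ 2 * (c₂ - s)) : endWeight c₁ c₂ α β c ≤ 2 ^ β * endWeight c₁ c₂ α β s := by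
  have h1 : (c - c₁) ^ α ≤ (s - c₁) ^ α := Real.rpow_le_rpow (by linarith) (by linarith) hα
  have h2 : (c₂ - c) ^ β ≤ 2 ^ β * (c₂ - s) ^ β := by
    rw [← Real.mul_rpow (by norm_num) (by linarith)]
    exact Real.rpow_le_rpow (by linarith) h hβ
  have h3 := mul_le_mul h1 h2 (Real.rpow_nonneg (by linarith) _) (Real.rpow_nonneg (by linarith) _)
  unfold endWeight
  linarith

/-- The increment of a primitive of the weight over two adjacent intervals. -/
theorem endWeight_primitive_le (hα : 0 ≤ α) (hβ : 0 ≤ β) {N : ℝ → ℝ}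
    (hN : ∀ x, HasDerivAt N (endWeight c₁ c₂ α β x) x) {a c d : ℝ} (ha : c₁ < a) (hac : a ≤ c)
    (hcd : c ≤ d) (hd : d ≤ c₂) (h : c - a ≤ d - c) :
    (N c - N a) * (d - c) ≤ 2 * (2 ^ β) ^ 2 * (c - a) * (N d - N c) := by
  set κ : ℝ := 2 ^ β with hκ
  have hκ0 : 0 < κ := Real.rpow_pos_of_pos two_pos _
  set w := endWeight c₁ c₂ α β c with hw
  have h1 : N c - N a ≤ κ * w * (c - a) := by
    have := sub_le_sub_of_hasDerivAt_le hac (fun s _ => hN s)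
      (fun s _ => (hasDerivAt_id s).const_mul (κ * w)) fun s hs => by
        rw [mul_one]; exact endWeight_le hα hβ (ha.trans_le hs.1) hs.2 (by linarith [hs.1])
    simp only [id] at this
    linarith
  -- Only the half of `[c, d]` next to `c` is used: there the distance to `c₂` is at least half of
  -- `c₂ - c`, whereas the weight may vanish at `d`.
  have h2 : w * ((d - c) / 2) ≤ κ * (N ((c + d) / 2) - N c) := by
    have := sub_le_sub_of_hasDerivAt_le (x := c) (y := (c + d) / 2) (by linarith)
      (fun s _ => (hasDerivAt_id s).const_mul w)
      (fun s _ => (hN s).const_mul κ) fun s hs => by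
        rw [mul_one]; exact le_endWeight hα hβ (by linarith) hs.1 (by linarith [hs.2])
    simp only [id] at this
    linarith
  have h3 : N ((c + d) / 2) ≤ N d := by
    have := sub_le_sub_of_hasDerivAt_le (x := (c + d) / 2) (y := d) (by linarith)
      (fun s _ => hasDerivAt_const s (0 : ℝ)) (fun s _ => hN s) fun s hs =>
        mul_nonneg (Real.rpow_nonneg (by linarith [hs.1]) _) (Real.rpow_nonneg (by linarith [hs.2]) _)
    linarith
  have h4 : w * (d - c) ≤ 2 * κ * (N d - N c) := by nlinarith
  calc (N c - N a) * (d - c) ≤ κ * w * (c - a) * (d - c) :=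
        mul_le_mul_of_nonneg_right h1 (by linarith)
    _ = κ * (c - a) * (w * (d - c)) := by ring
    _ ≤ κ * (c - a) * (2 * κ * (N d - N c)) :=
        mul_le_mul_of_nonneg_left h4 (mul_nonneg hκ0.le (by linarith))
    _ = _ := by ring

/-- Cross-ratio estimate for a map with derivative `endWeight * exp u`, `u` Lipschitz. -/
theorem crossRatio_le_of_endWeight (hα : 0 ≤ α) (hβ : 0 ≤ β) {f u : ℝ → ℝ} {K : ℝ} (hK : 0 ≤ K)
    (hf : ∀ x ∈ Ioo c₁ c₂, HasDerivAt f (endWeight c₁ c₂ α β x * Real.exp (u x)) x)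
    (hu : ∀ x ∈ Ioo c₁ c₂, ∀ y ∈ Ioo c₁ c₂, |u x - u y| ≤ K * |x - y|)
    {a b c d : ℝ} (ha : c₁ < a) (hab : a < b) (hbc : b < c) (hcd : c < d) (hd : d < c₂) :
    (c - b) * (d - a) * ((f b - f a) * (f d - f c)) ≤
      Real.exp ((4 * K + 4 * K * (2 ^ β) ^ 2) * (c - a)) *
        ((f c - f b) * (f d - f a) * ((b - a) * (d - c))) := by
  -- The map is compared with a primitive of the log-concave weight. The error must involve the
  -- short length `c - a` only, since later the outer point `d` lies in an extension whose iterates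
  -- have no bounded total length.
  set N : ℝ → ℝ := fun x => ∫ t in a..x, endWeight c₁ c₂ α β t with hNdef
  have hN : ∀ x, HasDerivAt N (endWeight c₁ c₂ α β x) x := fun x =>
    ((continuous_endWeight hα hβ).integral_hasStrictDerivAt a x).hasDerivAt
  have hsub : Icc a d ⊆ Ioo c₁ c₂ := fun x hx => ⟨ha.trans_le hx.1, hx.2.trans_lt hd⟩
  have hmain := crossRatio_mul_le_of_logConcave hab hbc hcd (fun x _ => hN x)
    (fun x hx => endWeight_pos (α := α) (β := β) (hsub hx))
    fun p hp y hy s hs => endWeight_logConcave hα hβ (hsub hp) (hsub hy) hs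
  have hstrict : ∀ x ∈ Icc a d, ∀ y ∈ Icc a d, x < y → 0 < N y - N x ∧ 0 < f y - f x := by
    intro x hx y hy hxy
    have hs : Icc x y ⊆ Ioo c₁ c₂ := (Icc_subset_Icc hx.1 hy.2).trans hsub
    constructor
    · rw [sub_pos]
      refine strictMonoOn_of_deriv_pos (convex_Icc x y) (fun t ht => (hN t).continuousAt.continuousWithinAt)
        (fun t ht => ?_) (left_mem_Icc.2 hxy.le) (right_mem_Icc.2 hxy.le) hxy
      rw [(hN t).deriv]
      exact endWeight_pos (hs (interior_subset ht))
    · rw [sub_pos]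
      refine strictMonoOn_of_deriv_pos (convex_Icc x y)
        (fun t ht => (hf t (hs ht)).continuousAt.continuousWithinAt)
        (fun t ht => ?_) (left_mem_Icc.2 hxy.le) (right_mem_Icc.2 hxy.le) hxy
      rw [(hf t (hs (interior_subset ht))).deriv]
      exact mul_pos (endWeight_pos (hs (interior_subset ht))) (Real.exp_pos _)
  have hcomp : ∀ x ∈ Icc a d, ∀ y ∈ Icc a d, x ≤ y → ∀ z ∈ Icc a d, ∀ L : ℝ,
      (∀ s ∈ Icc x y, |s - z| ≤ L) →
      Real.exp (u z - K * L) * (N y - N x) ≤ f y - f x ∧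
        f y - f x ≤ Real.exp (u z + K * L) * (N y - N x) := by
    intro x hx y hy hxy z hz L hL
    have hs : Icc x y ⊆ Ioo c₁ c₂ := (Icc_subset_Icc hx.1 hy.2).trans hsub
    have hb : ∀ s ∈ Icc x y, u z - K * L ≤ u s ∧ u s ≤ u z + K * L := by
      intro s hs'
      have h1 := (hu s (hs hs') z (hsub hz)).trans (mul_le_mul_of_nonneg_left (hL s hs') hK)
      rw [abs_le] at h1
      constructor <;> linarith [h1.1, h1.2]
    constructor
    · have := sub_le_sub_of_hasDerivAt_le hxy
        (fun s _ => (hN s).const_mul (Real.exp (u z - K * L))) (fun s h => hf s (hs h))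
        fun s h => by
          rw [mul_comm]
          exact mul_le_mul_of_nonneg_left (Real.exp_le_exp.2 (hb s h).1) (endWeight_pos (hs h)).le
      linarith
    · have := sub_le_sub_of_hasDerivAt_le hxy (fun s h => hf s (hs h))
        (fun s _ => (hN s).const_mul (Real.exp (u z + K * L)))
        fun s h => by
          rw [mul_comm (Real.exp _)]
          exact mul_le_mul_of_nonneg_left (Real.exp_le_exp.2 (hb s h).2) (endWeight_pos (hs h)).le
      linarith
  have haI : a ∈ Icc a d := ⟨le_rfl, by linarith⟩
  have hbI : b ∈ Icc a d := ⟨by linarith, by linarith⟩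
  have hcI : c ∈ Icc a d := ⟨by linarith, by linarith⟩
  have hdI : d ∈ Icc a d := ⟨by linarith, le_rfl⟩
  obtain ⟨nab, fab⟩ := hstrict a haI b hbI hab
  obtain ⟨nbc, fbc⟩ := hstrict b hbI c hcI hbc
  obtain ⟨ncd, fcd⟩ := hstrict c hcI d hdI hcd
  obtain ⟨nac, fac⟩ := hstrict a haI c hcI (hab.trans hbc)
  obtain ⟨nad, fad⟩ := hstrict a haI d hdI (hab.trans (hbc.trans hcd))
  set L := c - a with hL
  have hL0 : 0 < L := by linarith
  -- the ratio of the two short intervals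
  have hA : (f b - f a) * (N c - N b) ≤ Real.exp (2 * K * L) * ((f c - f b) * (N b - N a)) := by
    have h1 := (hcomp a haI b hbI hab.le b hbI L fun s hs => by
      rw [abs_le]; constructor <;> linarith [hs.1, hs.2]).2
    have h2 := (hcomp b hbI c hcI hbc.le b hbI L fun s hs => by
      rw [abs_le]; constructor <;> linarith [hs.1, hs.2]).1
    have h3 : Real.exp (u b + K * L) = Real.exp (2 * K * L) * Real.exp (u b - K * L) := by
      rw [← Real.exp_add]; ring_nf
    calc (f b - f a) * (N c - N b) ≤ Real.exp (u b + K * L) * (N b - N a) * (N c - N b) :=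
          mul_le_mul_of_nonneg_right h1 nbc.le
      _ = Real.exp (2 * K * L) * (Real.exp (u b - K * L) * (N c - N b) * (N b - N a)) := by
          rw [h3]; ring
      _ ≤ _ := mul_le_mul_of_nonneg_left (mul_le_mul_of_nonneg_right h2 nab.le) (Real.exp_pos _).le
  -- the ratio of the two long intervals
  set κ : ℝ := 2 ^ β with hκ
  set K₂ := 2 * K + 4 * K * κ ^ 2 with hK₂
  have hB : (N d - N a) * (f d - f c) ≤ Real.exp (K₂ * L) * ((f d - f a) * (N d - N c)) := by
    have h1 := (hcomp a haI c hcI (hab.trans hbc).le c hcI L fun s hs => by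
      rw [abs_le]; constructor <;> linarith [hs.1, hs.2]).1
    have h2 := (hcomp c hcI d hdI hcd.le c hcI (d - c) fun s hs => by
      rw [abs_le]; constructor <;> linarith [hs.1, hs.2]).2
    set A := N c - N a with hA'
    set B := N d - N c with hB'
    set ε := K * (d - a) with hε
    have hε0 : 0 ≤ ε := mul_nonneg hK (by linarith)
    have h3 : Real.exp (-ε) * (A * (f d - f c)) ≤ (f c - f a) * B := by
      calc Real.exp (-ε) * (A * (f d - f c))
          ≤ Real.exp (-ε) * (A * (Real.exp (u c + K * (d - c)) * B)) := by gcongr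
        _ = Real.exp (-ε) * Real.exp (u c + K * (d - c)) * (A * B) := by ring
        _ = Real.exp (u c - K * L) * A * B := by
            rw [← Real.exp_add, show -ε + (u c + K * (d - c)) = u c - K * L by rw [hε, hL]; ring,
              mul_assoc]
        _ ≤ _ := mul_le_mul_of_nonneg_right h1 ncd.le
    -- Only the part `A` is perturbed. If `d - c ≤ L`, then `ε` itself is `O(L)`; otherwise `A` is
    -- such a small fraction of `B` that `ε * A ≤ K₂ * L * B`.
    have h4 : A + B ≤ Real.exp (K₂ * L) * (Real.exp (-ε) * A + B) := by
      rcases le_total (d - c) L with hdc | hdc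
      · have h5 : ε ≤ K₂ * L := by
          have : ε ≤ 2 * K * L := by
            rw [hε]; nlinarith
          have : 0 ≤ 4 * K * κ ^ 2 * L := by positivity
          rw [hK₂, add_mul]; linarith
        have h6 : 1 ≤ Real.exp (K₂ * L) * Real.exp (-ε) := by
          rw [← Real.exp_add]; exact Real.one_le_exp (by linarith)
        have h7 : 1 ≤ Real.exp (K₂ * L) := Real.one_le_exp (by linarith)
        calc A + B = 1 * A + 1 * B := by ring
          _ ≤ Real.exp (K₂ * L) * Real.exp (-ε) * A + Real.exp (K₂ * L) * B := by gcongr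
          _ = _ := by ring
      · have hr := endWeight_primitive_le hα hβ hN ha (hab.trans hbc).le hcd.le hd.le hdc
        rw [← hκ] at hr
        have h5 : ε * A ≤ K₂ * L * B := by
          have e1 : ε * A ≤ 2 * K * (A * (d - c)) := by
            rw [hε]
            have : d - a ≤ 2 * (d - c) := by linarith
            have := mul_le_mul_of_nonneg_right this (mul_nonneg hK nac.le)
            linarith
          have e2 : 2 * K * (A * (d - c)) ≤ 2 * K * (2 * κ ^ 2 * L * B) := by gcongr
          have e3 : 0 ≤ 2 * K * L * B := by positivity
          rw [hK₂]; linarith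
        have h6 : K₂ * L + 1 ≤ Real.exp (K₂ * L) := Real.add_one_le_exp _
        have h7 : 1 ≤ Real.exp (K₂ * L) := Real.one_le_exp (by positivity)
        have h8 : 1 - ε ≤ Real.exp (-ε) := by linarith [Real.add_one_le_exp (-ε)]
        have h9 : (1 - ε) * A ≤ Real.exp (K₂ * L) * Real.exp (-ε) * A := by
          refine mul_le_mul_of_nonneg_right (h8.trans ?_) nac.le
          exact le_mul_of_one_le_left (Real.exp_pos _).le h7
        have h10 := mul_le_mul_of_nonneg_right h6 ncd.le
        linarith
    calc (N d - N a) * (f d - f c) = (A + B) * (f d - f c) := by rw [hA', hB']; ring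
      _ ≤ Real.exp (K₂ * L) * (Real.exp (-ε) * A + B) * (f d - f c) :=
          mul_le_mul_of_nonneg_right h4 fcd.le
      _ = Real.exp (K₂ * L) * (Real.exp (-ε) * (A * (f d - f c)) + B * (f d - f c)) := by ring
      _ ≤ Real.exp (K₂ * L) * ((f c - f a) * B + B * (f d - f c)) := by gcongr
      _ = _ := by ring
  have hP : 0 < (N c - N b) * (N d - N a) := mul_pos nbc nad
  have hQ : 0 < (N b - N a) * (N d - N c) := mul_pos nab ncd
  have hAB := mul_le_mul hA hB (mul_pos nad fcd).le
    (mul_nonneg (Real.exp_pos _).le (mul_pos fbc nab).le)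
  rw [show Real.exp ((4 * K + 4 * K * κ ^ 2) * L) = Real.exp (2 * K * L) * Real.exp (K₂ * L) by
    rw [← Real.exp_add]; congr 1; rw [hK₂]; ring]
  set E := Real.exp (2 * K * L) * Real.exp (K₂ * L) with hE
  have hE0 : 0 < E := mul_pos (Real.exp_pos _) (Real.exp_pos _)
  have h5 : (f b - f a) * (f d - f c) * ((N c - N b) * (N d - N a)) ≤
      E * ((f c - f b) * (f d - f a)) * ((N b - N a) * (N d - N c)) := by
    rw [hE]; linarith
  refine le_of_mul_le_mul_right (a := (N b - N a) * (N d - N c)) ?_ hQ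
  calc (c - b) * (d - a) * ((f b - f a) * (f d - f c)) * ((N b - N a) * (N d - N c))
      = (f b - f a) * (f d - f c) * ((c - b) * (d - a) * ((N b - N a) * (N d - N c))) := by ring
    _ ≤ (f b - f a) * (f d - f c) * ((N c - N b) * (N d - N a) * ((b - a) * (d - c))) :=
        mul_le_mul_of_nonneg_left hmain (mul_pos fab fcd).le
    _ = (f b - f a) * (f d - f c) * ((N c - N b) * (N d - N a)) * ((b - a) * (d - c)) := by ring
    _ ≤ E * ((f c - f b) * (f d - f a)) * ((N b - N a) * (N d - N c)) * ((b - a) * (d - c)) :=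
        mul_le_mul_of_nonneg_right h5 (mul_pos (by linarith) (by linarith)).le
    _ = _ := by ring

end endWeight

theorem ContDiffAt.deriv_of_add_one_le {ψ : ℝ → ℝ} {c : ℝ} {m n : WithTop ℕ∞}
    (h : ContDiffAt ℝ n ψ c) (hmn : m + 1 ≤ n) : ContDiffAt ℝ m (deriv ψ) c := by
  have h1 : deriv ψ = fun x => fderiv ℝ ψ x 1 := funext fun x => fderiv_apply_one_eq_deriv.symm
  rw [h1]
  exact (h.fderiv_right hmn).clm_apply contDiffAt_const

/-- First order expansion of a `C²` function at a simple zero. -/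
theorem exists_bounds_of_simple_zero {ψ : ℝ → ℝ} {c : ℝ} (hψ : ContDiffAt ℝ 2 ψ c) (h0 : ψ c = 0)
    (h1 : deriv ψ c ≠ 0) :
    ∃ m M : ℝ, 0 < m ∧ 0 ≤ M ∧ ∀ᶠ x in 𝓝 c, HasDerivAt ψ (deriv ψ x) x ∧
      HasDerivAt (deriv ψ) (deriv (deriv ψ) x) x ∧ |deriv (deriv ψ) x| ≤ M ∧ m ≤ |deriv ψ x| ∧
      m * |x - c| ≤ |ψ x| ∧ |deriv ψ x * (x - c) - ψ x| ≤ M * |x - c| ^ 2 := by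
  have hψ1 : ContDiffAt ℝ 1 (deriv ψ) c := hψ.deriv_of_add_one_le (by norm_num [one_add_one_eq_two])
  have hψ2 : ContinuousAt (deriv (deriv ψ)) c :=
    (hψ1.deriv_of_add_one_le (m := 0) (by simp)).continuousAt
  set m := |deriv ψ c| / 2 with hm
  have hm0 : 0 < m := half_pos (abs_pos.2 h1)
  set M := |deriv (deriv ψ) c| + 1 with hM
  have hev : ∀ᶠ x in 𝓝 c, HasDerivAt ψ (deriv ψ x) x ∧
      HasDerivAt (deriv ψ) (deriv (deriv ψ) x) x ∧ |deriv (deriv ψ) x| ≤ M ∧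
      |deriv ψ x - deriv ψ c| ≤ m := by
    have e1 := (hψ.eventually (by simp)).mono fun x hx =>
      (hx.differentiableAt (by simp)).hasDerivAt
    have e2 := (hψ1.eventually (by simp)).mono fun x hx =>
      (hx.differentiableAt (by simp)).hasDerivAt
    have e3 : ∀ᶠ x in 𝓝 c, |deriv (deriv ψ) x| < M :=
      hψ2.abs.eventually_lt_const (by rw [hM]; linarith)
    have e4 : ∀ᶠ x in 𝓝 c, |deriv ψ x - deriv ψ c| < m := by
      have : ContinuousAt (fun x => |deriv ψ x - deriv ψ c|) c :=
        (hψ1.continuousAt.sub continuousAt_const).abs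
      exact this.eventually_lt_const (by simpa using hm0)
    filter_upwards [e1, e2, e3, e4] with x a1 a2 a3 a4 using ⟨a1, a2, a3.le, a4.le⟩
  obtain ⟨δ, hδ, hball⟩ := Metric.eventually_nhds_iff_ball.1 hev
  refine ⟨m, M, hm0, by positivity, ?_⟩
  filter_upwards [Metric.ball_mem_nhds c hδ] with x hx
  obtain ⟨d1, d2, d3, d4⟩ := hball x hx
  have hc := Metric.mem_ball_self (x := c) hδ
  have hseg : segment ℝ c x ⊆ Metric.ball c δ := (convex_ball c δ).segment_subset hc hx
  have hlen : ∀ s ∈ segment ℝ c x, |x - s| ≤ |x - c| := by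
    intro s hs
    rw [segment_eq_uIcc] at hs
    rcases le_total c x with h | h
    · rw [uIcc_of_le h] at hs
      rw [abs_of_nonneg, abs_of_nonneg] <;> linarith [hs.1, hs.2]
    · rw [uIcc_of_ge h] at hs
      rw [abs_of_nonpos, abs_of_nonpos] <;> linarith [hs.1, hs.2]
  refine ⟨d1, d2, d3, ?_, ?_, ?_⟩
  · have := abs_sub_abs_le_abs_sub (deriv ψ c) (deriv ψ x)
    rw [abs_sub_comm] at this
    linarith
  · have h2 := (convex_segment c x).norm_image_sub_le_of_norm_hasDerivWithin_le
      (f := fun s => ψ s - deriv ψ c * s) (f' := fun s => deriv ψ s - deriv ψ c) (C := m)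
      (fun s hs => by
        have := ((hball s (hseg hs)).1.sub ((hasDerivAt_id s).const_mul (deriv ψ c)))
        rw [mul_one] at this
        exact this.hasDerivWithinAt)
      (fun s hs => (hball s (hseg hs)).2.2.2) (left_mem_segment ℝ c x) (right_mem_segment ℝ c x)
    rw [Real.norm_eq_abs, Real.norm_eq_abs, h0] at h2
    have h3 : |deriv ψ c * (x - c)| - |ψ x| ≤ |ψ x - deriv ψ c * x - (0 - deriv ψ c * c)| := by
      have := abs_sub_abs_le_abs_sub (deriv ψ c * (x - c)) (ψ x)
      rw [abs_sub_comm] at this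
      refine this.trans (le_of_eq ?_)
      congr 1; ring
    rw [abs_mul, show |deriv ψ c| = 2 * m by rw [hm]; ring] at h3
    linarith
  · have h2 := (convex_segment c x).norm_image_sub_le_of_norm_hasDerivWithin_le
      (f := fun s => ψ s - deriv ψ x * s) (f' := fun s => deriv ψ s - deriv ψ x) (C := M * |x - c|)
      (fun s hs => by
        have := ((hball s (hseg hs)).1.sub ((hasDerivAt_id s).const_mul (deriv ψ x)))
        rw [mul_one] at this
        exact this.hasDerivWithinAt)
      (fun s hs => by
        have h4 := (convex_ball c δ).norm_image_sub_le_of_norm_hasDerivWithin_le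
          (f := deriv ψ) (f' := deriv (deriv ψ)) (C := M)
          (fun t ht => (hball t ht).2.1.hasDerivWithinAt) (fun t ht => (hball t ht).2.2.1)
          hx (hseg hs)
        rw [Real.norm_eq_abs, Real.norm_eq_abs] at h4
        rw [Real.norm_eq_abs]
        refine h4.trans (mul_le_mul_of_nonneg_left ?_ (by positivity))
        rw [abs_sub_comm]; exact hlen s hs)
      (left_mem_segment ℝ c x) (right_mem_segment ℝ c x)
    rw [Real.norm_eq_abs, Real.norm_eq_abs, h0] at h2
    rw [abs_sub_comm]
    calc _ = |ψ x - deriv ψ x * x - (0 - deriv ψ x * c)| := by congr 1; ring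
      _ ≤ _ := h2
      _ = _ := by ring

/-! ### Nonlinearity near critical points -/

section NonlinearityBounds

variable {f : ℝ → ℝ} {a b : ℝ}

theorem ContDiffOn.hasDerivAt_derivWithin_Icc (hf : ContDiffOn ℝ 2 f (Icc a b)) {x : ℝ}
    (hx : x ∈ Ioo a b) : HasDerivAt f (derivWithin f (Icc a b) x) x :=
  (hf.differentiableOn (by simp) x (Ioo_subset_Icc_self hx)).hasDerivWithinAt.hasDerivAt
    (Icc_mem_nhds hx.1 hx.2)

theorem ContDiffOn.derivWithin_Icc (hab : a < b) (hf : ContDiffOn ℝ 2 f (Icc a b)) :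
    ContDiffOn ℝ 1 (derivWithin f (Icc a b)) (Icc a b) :=
  hf.derivWithin (uniqueDiffOn_Icc hab) (by norm_num [one_add_one_eq_two])

theorem ContDiffOn.hasDerivAt_derivWithin_derivWithin_Icc (hab : a < b)
    (hf : ContDiffOn ℝ 2 f (Icc a b)) {x : ℝ} (hx : x ∈ Ioo a b) :
    HasDerivAt (derivWithin f (Icc a b)) (derivWithin (derivWithin f (Icc a b)) (Icc a b) x) x :=
  ((hf.derivWithin_Icc hab).differentiableOn (by simp) x
    (Ioo_subset_Icc_self hx)).hasDerivWithinAt.hasDerivAt (Icc_mem_nhds hx.1 hx.2)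

/-- The nonlinearity `f'' / f'` is bounded near points which are not critical. -/
theorem exists_nonlinearity_le (hab : a < b) (hf : ContDiffOn ℝ 2 f (Icc a b)) {c : ℝ}
    (hc : c ∈ Icc a b) (hcr : c ∉ criticalSet f a b) :
    ∃ K, ∀ᶠ x in 𝓝[Icc a b] c,
      |derivWithin (derivWithin f (Icc a b)) (Icc a b) x / derivWithin f (Icc a b) x| ≤ K := by
  have h1 := hf.derivWithin_Icc hab
  have h2 : ContinuousOn (derivWithin (derivWithin f (Icc a b)) (Icc a b)) (Icc a b) :=
    h1.continuousOn_derivWithin (uniqueDiffOn_Icc hab) le_rfl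
  have h3 : derivWithin f (Icc a b) c ≠ 0 := fun h => hcr ⟨hc, h⟩
  have h4 := ((h2 c hc).div (h1.continuousOn c hc) h3).abs
  exact ⟨_, (h4.eventually_lt_const (lt_add_one _)).mono fun x hx => hx.le⟩

/-- Near a non-flat critical point `c`, the nonlinearity is `α / (x - c)` up to a bounded term. -/
theorem IsNonflatAt.exists_nonlinearity_sub_le (hab : a < b) (hf : ContDiffOn ℝ 2 f (Icc a b))
    {c : ℝ} (hnf : IsNonflatAt f a b c) :
    ∃ α K : ℝ, 0 ≤ α ∧ ∀ᶠ x in 𝓝 c, x ∈ Ioo a b → x ≠ c →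
      |derivWithin (derivWithin f (Icc a b)) (Icc a b) x / derivWithin f (Icc a b) x -
        α / (x - c)| ≤ K := by
  obtain ⟨l, ψ, hl, hψ, hψ0, hψ1, hev⟩ := hnf
  obtain ⟨m, M, hm, hM, hb⟩ := exists_bounds_of_simple_zero hψ hψ0 hψ1
  set f₁ := derivWithin f (Icc a b) with hf₁
  set f₂ := derivWithin f₁ (Icc a b) with hf₂
  refine ⟨l - 1, (l - 1) * (M / m) + M / m, by linarith, ?_⟩
  have hgood := (hb.and (eventually_nhdsWithin_iff.1 hev)).eventually_nhds
  filter_upwards [hgood] with x hx hxI hxc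
  have hlogeq : ∀ᶠ y in 𝓝 x, HasDerivAt (fun y => Real.log (f y - f c)) (f₁ y / (f y - f c)) y ∧
      HasDerivAt (fun y => l * Real.log (ψ y)) (l * (deriv ψ y / ψ y)) y ∧
      Real.log (f y - f c) = l * Real.log (ψ y) ∧ f y - f c ≠ 0 ∧ ψ y ≠ 0 := by
    filter_upwards [hx, isOpen_Ioo.mem_nhds hxI, isOpen_ne.mem_nhds hxc] with y hy hyI hyc
    obtain ⟨⟨d1, d2, d3, d4, d5, d6⟩, d7⟩ := hy
    have hψy : ψ y ≠ 0 := abs_pos.1 (lt_of_lt_of_le (mul_pos hm (abs_pos.2 (sub_ne_zero.2 hyc))) d5)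
    have hfy : |f y - f c| = |ψ y| ^ l := d7 (Ioo_subset_Icc_self hyI)
    have hfy0 : f y - f c ≠ 0 := abs_pos.1 (by rw [hfy]; exact Real.rpow_pos_of_pos (abs_pos.2 hψy) _)
    refine ⟨((hf.hasDerivAt_derivWithin_Icc hyI).sub_const _).log hfy0, (d1.log hψy).const_mul l,
      ?_, hfy0, hψy⟩
    rw [← Real.log_abs, hfy, Real.log_rpow (abs_pos.2 hψy), Real.log_abs]
  have hEq : f₁ =ᶠ[𝓝 x] fun y => (f y - f c) * (l * (deriv ψ y / ψ y)) := by
    filter_upwards [hlogeq.eventually_nhds] with y hy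
    have h1 := hy.self_of_nhds
    have h2 : (fun y => Real.log (f y - f c)) =ᶠ[𝓝 y] fun y => l * Real.log (ψ y) :=
      hy.mono fun z hz => hz.2.2.1
    have h3 := h1.1.unique (h1.2.1.congr_of_eventuallyEq h2)
    rw [← h3, mul_div_cancel₀ _ h1.2.2.2.1]
  obtain ⟨-, -, -, hfx0, hψx⟩ := hlogeq.self_of_nhds
  obtain ⟨⟨d1, d2, d3, d4, d5, d6⟩, -⟩ := hx.self_of_nhds
  have hψ'x : deriv ψ x ≠ 0 := abs_pos.1 (hm.trans_le d4)
  have hder := (((hf.hasDerivAt_derivWithin_Icc hxI).sub_const (f c)).mul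
    ((d2.div d1 hψx).const_mul l)).congr_of_eventuallyEq hEq
  have h2 := (hf.hasDerivAt_derivWithin_derivWithin_Icc hab hxI).unique hder
  have h1 : f₁ x = _ := hEq.self_of_nhds
  have hxc' : x - c ≠ 0 := sub_ne_zero.2 hxc
  have hl0 : l ≠ 0 := by linarith
  -- Logarithmic differentiation of `|f - f c| = |ψ| ^ l` gives `f' = (f - f c) l ψ' / ψ`, and once
  -- more `f'' / f' = (l - 1) ψ' / ψ + ψ'' / ψ'`. Two derivatives of `ψ` suffice, and `ψ' / ψ` is `1
  -- / (x - c)` up to a bounded term.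
  have hkey : f₂ x / f₁ x - (l - 1) / (x - c) =
      (l - 1) * ((deriv ψ x * (x - c) - ψ x) / (ψ x * (x - c))) +
        deriv (deriv ψ) x / deriv ψ x := by
    have h2' : f₂ x = _ := h2
    rw [h2', ← hf₁, h1]
    simp only [Pi.div_apply]
    field_simp
    ring
  rw [hkey]
  refine (abs_add_le _ _).trans (add_le_add ?_ ?_)
  · rw [abs_mul, abs_of_pos (by linarith : 0 < l - 1)]
    refine mul_le_mul_of_nonneg_left ?_ (by linarith)
    rw [abs_div, abs_mul, div_le_div_iff₀ (by positivity) hm]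
    calc _ ≤ M * |x - c| ^ 2 * m := by gcongr
      _ = M * (m * |x - c| * |x - c|) := by ring
      _ ≤ M * (|ψ x| * |x - c|) := by gcongr
  · rw [abs_div]
    exact div_le_div₀ hM d3 hm d4

end NonlinearityBounds

/-- Cross-ratio estimate for a map with derivative `endWeight * exp u`, with errors controlled by
either of the two long gaps. -/
theorem crossRatio_le_of_endWeight_both {c₁ c₂ α β : ℝ} (hα : 0 ≤ α) (hβ : 0 ≤ β) {f u : ℝ → ℝ}
    {K : ℝ} (hK : 0 ≤ K)
    (hf : ∀ x ∈ Ioo c₁ c₂, HasDerivAt f (endWeight c₁ c₂ α β x * Real.exp (u x)) x)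
    (hu : ∀ x ∈ Ioo c₁ c₂, ∀ y ∈ Ioo c₁ c₂, |u x - u y| ≤ K * |x - y|) :
    ∃ K' : ℝ, 0 ≤ K' ∧ ∀ a b c d : ℝ, c₁ < a → a < b → b < c → c < d → d < c₂ →
      (c - b) * (d - a) * ((f b - f a) * (f d - f c)) ≤
        Real.exp (K' * (c - a)) * ((f c - f b) * (f d - f a) * ((b - a) * (d - c))) ∧
      (c - b) * (d - a) * ((f b - f a) * (f d - f c)) ≤
        Real.exp (K' * (d - b)) * ((f c - f b) * (f d - f a) * ((b - a) * (d - c))) := by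
  have hmono : ∀ x ∈ Ioo c₁ c₂, ∀ y ∈ Ioo c₁ c₂, x < y → 0 < f y - f x := by
    intro x hx y hy hxy
    have hs : Icc x y ⊆ Ioo c₁ c₂ := fun t ht => ⟨hx.1.trans_le ht.1, ht.2.trans_lt hy.2⟩
    rw [sub_pos]
    refine strictMonoOn_of_deriv_pos (convex_Icc x y)
      (fun t ht => (hf t (hs ht)).continuousAt.continuousWithinAt)
      (fun t ht => ?_) (left_mem_Icc.2 hxy.le) (right_mem_Icc.2 hxy.le) hxy
    rw [(hf t (hs (interior_subset ht))).deriv]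
    exact mul_pos (endWeight_pos (hs (interior_subset ht))) (Real.exp_pos _)
  set K₁ := 4 * K + 4 * K * (2 ^ β) ^ 2 with hK₁
  set K₂ := 4 * K + 4 * K * (2 ^ α) ^ 2 with hK₂
  have h1 : 0 ≤ K₁ := by positivity
  have h2 : 0 ≤ K₂ := by positivity
  refine ⟨K₁ + K₂, by positivity, fun a b c d ha hab hbc hcd hd => ?_⟩
  have hR : 0 ≤ (f c - f b) * (f d - f a) * ((b - a) * (d - c)) :=
    mul_nonneg (mul_nonneg
      (hmono b ⟨by linarith, by linarith⟩ c ⟨by linarith, by linarith⟩ hbc).le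
      (hmono a ⟨by linarith, by linarith⟩ d ⟨by linarith, by linarith⟩ (by linarith)).le)
      (mul_nonneg (by linarith) (by linarith))
  constructor
  · refine (crossRatio_le_of_endWeight hα hβ hK hf hu ha hab hbc hcd hd).trans
      (mul_le_mul_of_nonneg_right (Real.exp_le_exp.2 ?_) hR)
    exact mul_le_mul_of_nonneg_right (by linarith) (by linarith)
  -- Reflection in the origin exchanges `α` with `β` and the two outer points.
  · have hflip : ∀ x ∈ Ioo (-c₂) (-c₁), -x ∈ Ioo c₁ c₂ := fun x hx =>
      ⟨by linarith [hx.2], by linarith [hx.1]⟩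
    have h3 := crossRatio_le_of_endWeight (c₁ := -c₂) (c₂ := -c₁) (α := β) (β := α) hβ hα
      (f := fun x => -f (-x)) (u := fun x => u (-x)) hK (fun x hx => by
        have := (hf (-x) (hflip x hx)).scomp x (hasDerivAt_neg x)
        refine this.neg.congr_deriv ?_
        simp only [endWeight, smul_eq_mul]
        rw [show -c₁ - x = -x - c₁ by ring, show x - -c₂ = c₂ - -x by ring]
        ring)
      (fun x hx y hy => by
        refine (hu _ (hflip x hx) _ (hflip y hy)).trans (le_of_eq ?_)
        rw [show -x - -y = -(x - y) by ring, abs_neg])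
      (a := -d) (b := -c) (c := -b) (d := -a) (by linarith) (by linarith) (by linarith)
      (by linarith) (by linarith)
    simp only [neg_neg] at h3
    calc _ = (-b - -c) * (-a - -d) * ((-f c - -f d) * (-f a - -f b)) := by ring
      _ ≤ _ := h3
      _ = Real.exp (K₂ * (d - b)) * ((f c - f b) * (f d - f a) * ((b - a) * (d - c))) := by
        rw [← hK₂, show -b - -d = d - b by ring]; ring
      _ ≤ _ := mul_le_mul_of_nonneg_right (Real.exp_le_exp.2
        (mul_le_mul_of_nonneg_right (by linarith) (by linarith))) hR

/-! ### Cross-ratios under `f` away from critical points -/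

section CrossRatio

variable {f : ℝ → ℝ} {a b : ℝ}

theorem exists_nonlinearity_sub_le (hab : a < b) (hf : ContDiffOn ℝ 2 f (Icc a b))
    (hnf : ∀ c ∈ criticalSet f a b, IsNonflatAt f a b c) {c : ℝ} (hc : c ∈ Icc a b) :
    ∃ α K : ℝ, 0 ≤ α ∧ ∀ᶠ x in 𝓝 c, x ∈ Ioo a b → x ≠ c →
      |derivWithin (derivWithin f (Icc a b)) (Icc a b) x / derivWithin f (Icc a b) x -
        α / (x - c)| ≤ K := by
  by_cases hcr : c ∈ criticalSet f a b
  · exact (hnf c hcr).exists_nonlinearity_sub_le hab hf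
  · obtain ⟨K, hK⟩ := exists_nonlinearity_le hab hf hc hcr
    refine ⟨0, K, le_rfl, ?_⟩
    filter_upwards [eventually_nhdsWithin_iff.1 hK] with x hx hxI _
    rw [zero_div, sub_zero]
    exact hx (Ioo_subset_Icc_self hxI)

/-- On a component of the complement of the critical set, `log |f'|` is the logarithm of a weight
plus a Lipschitz function. -/
theorem exists_eq_endWeight_mul_exp (hab : a < b) (hf : ContDiffOn ℝ 2 f (Icc a b))
    (hnf : ∀ c ∈ criticalSet f a b, IsNonflatAt f a b c) {c₁ c₂ : ℝ} (hc₁ : c₁ ∈ Icc a b)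
    (hc₂ : c₂ ∈ Icc a b) (hc : c₁ < c₂) (hcr : ∀ x ∈ Ioo c₁ c₂, x ∉ criticalSet f a b) :
    ∃ (α β K : ℝ) (u : ℝ → ℝ), 0 ≤ α ∧ 0 ≤ β ∧ 0 ≤ K ∧
      (∀ x ∈ Ioo c₁ c₂, |derivWithin f (Icc a b) x| = endWeight c₁ c₂ α β x * Real.exp (u x)) ∧
      ∀ x ∈ Ioo c₁ c₂, ∀ y ∈ Ioo c₁ c₂, |u x - u y| ≤ K * |x - y| := by
  obtain ⟨α, K₁, hα, h1⟩ := exists_nonlinearity_sub_le hab hf hnf hc₁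
  obtain ⟨β, K₂, hβ, h2⟩ := exists_nonlinearity_sub_le hab hf hnf hc₂
  set f₁ := derivWithin f (Icc a b) with hf₁
  set f₂ := derivWithin f₁ (Icc a b) with hf₂
  have hIoo : Ioo c₁ c₂ ⊆ Ioo a b := Ioo_subset_Ioo hc₁.1 hc₂.2
  have hne : ∀ x ∈ Ioo c₁ c₂, f₁ x ≠ 0 := fun x hx h =>
    hcr x hx ⟨Ioo_subset_Icc_self (hIoo hx), h⟩
  set u : ℝ → ℝ := fun x => Real.log (f₁ x) - α * Real.log (x - c₁) - β * Real.log (c₂ - x) with hu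
  set v : ℝ → ℝ := fun x => f₂ x / f₁ x - α / (x - c₁) + β / (c₂ - x) with hv
  have hd : ∀ x ∈ Ioo c₁ c₂, HasDerivAt u (v x) x := by
    intro x hx
    have e1 := (hf.hasDerivAt_derivWithin_derivWithin_Icc hab (hIoo hx)).log (hne x hx)
    have e2 := (((hasDerivAt_id x).sub_const c₁).log (sub_pos.2 hx.1).ne').const_mul α
    have e3 := (((hasDerivAt_id x).const_sub c₂).log (sub_pos.2 hx.2).ne').const_mul β
    refine ((e1.sub e2).sub e3).congr_deriv ?_
    simp only [hv, id]
    ring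
  -- The terms subtracted in `v` cancel the poles of `f'' / f'` at `c₁` and `c₂`, so `v` is locally
  -- bounded, hence bounded by compactness.
  have hloc : ∃ K, ∀ x ∈ Icc c₁ c₂, x ∈ Ioo c₁ c₂ → |v x| ≤ K := by
    refine isCompact_Icc.induction_on (p := fun s => ∃ K, ∀ x ∈ s, x ∈ Ioo c₁ c₂ → |v x| ≤ K)
      ⟨0, fun x hx => hx.elim⟩ (fun s t hst ⟨K, hK⟩ => ⟨K, fun x hx => hK x (hst hx)⟩) ?_ ?_
    · rintro s t ⟨K, hK⟩ ⟨L, hL⟩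
      exact ⟨max K L, fun x hx hxI => hx.elim (fun h => (hK x h hxI).trans (le_max_left _ _))
        fun h => (hL x h hxI).trans (le_max_right _ _)⟩
    · intro z hz
      have hL : z ≠ c₁ → ∃ A, ∀ᶠ x in 𝓝 z, |α / (x - c₁)| ≤ A := fun h => by
        have : ContinuousAt (fun x => |α / (x - c₁)|) z :=
          (continuousAt_const.div (continuousAt_id.sub continuousAt_const) (sub_ne_zero.2 h)).abs
        exact ⟨_, (this.eventually_lt_const (lt_add_one _)).mono fun x hx => hx.le⟩
      have hR : z ≠ c₂ → ∃ A, ∀ᶠ x in 𝓝 z, |β / (c₂ - x)| ≤ A := fun h => by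
        have : ContinuousAt (fun x => |β / (c₂ - x)|) z :=
          (continuousAt_const.div (continuousAt_const.sub continuousAt_id)
            (sub_ne_zero.2 h.symm)).abs
        exact ⟨_, (this.eventually_lt_const (lt_add_one _)).mono fun x hx => hx.le⟩
      suffices h : ∃ A, ∀ᶠ x in 𝓝 z, x ∈ Ioo c₁ c₂ → |v x| ≤ A by
        obtain ⟨A, hA⟩ := h
        exact ⟨_, mem_nhdsWithin_of_mem_nhds hA, A, fun x hx hxI => hx hxI⟩
      rcases eq_or_ne z c₁ with rfl | hz1
      · obtain ⟨A, hA⟩ := hR hc.ne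
        refine ⟨K₁ + A, ?_⟩
        filter_upwards [h1, hA] with x hx1 hx2 hxI
        exact (abs_add_le _ _).trans (add_le_add (hx1 (hIoo hxI) hxI.1.ne') hx2)
      rcases eq_or_ne z c₂ with rfl | hz2
      · obtain ⟨A, hA⟩ := hL hc.ne'
        refine ⟨K₂ + A, ?_⟩
        filter_upwards [h2, hA] with x hx1 hx2 hxI
        have : v x = (f₂ x / f₁ x - β / (x - z)) - α / (x - c₁) := by
          simp only [hv]
          rw [show z - x = -(x - z) by ring, div_neg]; ring
        rw [this]
        exact (abs_sub _ _).trans (add_le_add (hx1 (hIoo hxI) hxI.2.ne) hx2)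
      · obtain ⟨A, hA⟩ := hL hz1
        obtain ⟨B, hB⟩ := hR hz2
        have hzI : z ∈ Ioo c₁ c₂ := ⟨lt_of_le_of_ne hz.1 hz1.symm, lt_of_le_of_ne hz.2 hz2⟩
        obtain ⟨K, hK⟩ := exists_nonlinearity_le hab hf (Ioo_subset_Icc_self (hIoo hzI)) (hcr z hzI)
        refine ⟨K + A + B, ?_⟩
        filter_upwards [eventually_nhdsWithin_iff.1 hK, hA, hB] with x hx1 hx2 hx3 hxI
        exact (abs_add_le _ _).trans (add_le_add ((abs_sub _ _).trans
          (add_le_add (hx1 (Ioo_subset_Icc_self (hIoo hxI))) hx2)) hx3)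
  obtain ⟨K, hK⟩ := hloc
  refine ⟨α, β, max K 0, u, hα, hβ, le_max_right _ _, fun x hx => ?_, fun x hx y hy => ?_⟩
  · have p1 := sub_pos.2 hx.1
    have p2 := sub_pos.2 hx.2
    rw [endWeight, Real.rpow_def_of_pos p1, Real.rpow_def_of_pos p2, ← Real.exp_add, ← Real.exp_add]
    simp only [hu]
    rw [show Real.log (x - c₁) * α + Real.log (c₂ - x) * β + (Real.log (f₁ x) -
      α * Real.log (x - c₁) - β * Real.log (c₂ - x)) = Real.log (f₁ x) by ring,
      Real.exp_log_eq_abs (hne x hx)]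
  · have := (convex_Ioo c₁ c₂).norm_image_sub_le_of_norm_hasDerivWithin_le (C := max K 0)
      (fun t ht => (hd t ht).hasDerivWithinAt)
      (fun t ht => (hK t (Ioo_subset_Icc_self ht) ht).trans (le_max_left _ _)) hy hx
    exact this

theorem pos_or_neg_of_continuousOn_ne_zero {g : ℝ → ℝ} {s : Set ℝ} (hs : IsPreconnected s)
    (hg : ContinuousOn g s) (h0 : ∀ x ∈ s, g x ≠ 0) :
    (∀ x ∈ s, 0 < g x) ∨ ∀ x ∈ s, g x < 0 := by
  by_contra! h
  obtain ⟨⟨x, hx, hx0⟩, y, hy, hy0⟩ := h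
  obtain ⟨z, hz, hz0⟩ := hs.intermediate_value hx hy hg ⟨hx0, hy0⟩
  exact h0 z hz hz0

theorem exists_crossRatio_le_component (hab : a < b) (hf : ContDiffOn ℝ 2 f (Icc a b))
    (hnf : ∀ c ∈ criticalSet f a b, IsNonflatAt f a b c) {c₁ c₂ : ℝ} (hc₁ : c₁ ∈ Icc a b)
    (hc₂ : c₂ ∈ Icc a b) (hc : c₁ < c₂) (hcr : ∀ x ∈ Ioo c₁ c₂, x ∉ criticalSet f a b) :
    ∃ K : ℝ, 0 ≤ K ∧ ∀ p q r s : ℝ, c₁ < p → p < q → q < r → r < s → s < c₂ →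
      (r - q) * (s - p) * ((f q - f p) * (f s - f r)) ≤
        Real.exp (K * (r - p)) * ((f r - f q) * (f s - f p) * ((q - p) * (s - r))) ∧
      (r - q) * (s - p) * ((f q - f p) * (f s - f r)) ≤
        Real.exp (K * (s - q)) * ((f r - f q) * (f s - f p) * ((q - p) * (s - r))) := by
  obtain ⟨α, β, K, u, hα, hβ, hK, h1, h2⟩ := exists_eq_endWeight_mul_exp hab hf hnf hc₁ hc₂ hc hcr
  have hIoo : Ioo c₁ c₂ ⊆ Ioo a b := Ioo_subset_Ioo hc₁.1 hc₂.2
  rcases pos_or_neg_of_continuousOn_ne_zero isPreconnected_Ioo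
    ((hf.derivWithin_Icc hab).continuousOn.mono (hIoo.trans Ioo_subset_Icc_self))
    (fun x hx h => hcr x hx ⟨Ioo_subset_Icc_self (hIoo hx), h⟩) with hs | hs
  · exact crossRatio_le_of_endWeight_both hα hβ hK (fun x hx => by
      rw [← h1 x hx, abs_of_pos (hs x hx)]
      exact hf.hasDerivAt_derivWithin_Icc (hIoo hx)) h2
  · obtain ⟨K', hK', h⟩ := crossRatio_le_of_endWeight_both (f := fun x => -f x) hα hβ hK
      (fun x hx => by
        rw [← h1 x hx, abs_of_neg (hs x hx)]
        exact (hf.hasDerivAt_derivWithin_Icc (hIoo hx)).neg) h2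
    refine ⟨K', hK', fun p q r s h1 h2 h3 h4 h5 => ?_⟩
    have h6 := h p q r s h1 h2 h3 h4 h5
    rw [show (-f q - -f p) * (-f s - -f r) = (f q - f p) * (f s - f r) by ring,
      show (-f r - -f q) * (-f s - -f p) = (f r - f q) * (f s - f p) by ring] at h6
    exact h6

/-- Cross-ratio estimate away from the critical set. -/
theorem exists_crossRatio_le (hab : a < b) (hf : ContDiffOn ℝ 2 f (Icc a b))
    (hfin : (criticalSet f a b).Finite) (hnf : ∀ c ∈ criticalSet f a b, IsNonflatAt f a b c) :
    ∃ K : ℝ, 0 ≤ K ∧ ∀ p q r s : ℝ, a < p → p < q → q < r → r < s → s < b →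
      (∀ x ∈ Icc p s, x ∉ criticalSet f a b) →
      (r - q) * (s - p) * ((f q - f p) * (f s - f r)) ≤
        Real.exp (K * (r - p)) * ((f r - f q) * (f s - f p) * ((q - p) * (s - r))) ∧
      (r - q) * (s - p) * ((f q - f p) * (f s - f r)) ≤
        Real.exp (K * (s - q)) * ((f r - f q) * (f s - f p) * ((q - p) * (s - r))) := by
  -- These points cut the interval into finitely many components; the largest of the component
  -- constants is taken.
  set E : Set ℝ := insert a (insert b (criticalSet f a b)) with hE
  have hEfin : E.Finite := (hfin.insert b).insert a
  have hEI : E ⊆ Icc a b := by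
    rintro x (rfl | rfl | hx)
    exacts [left_mem_Icc.2 hab.le, right_mem_Icc.2 hab.le, hx.1]
  have hK : ∀ z : ℝ × ℝ, ∃ K : ℝ, 0 ≤ K ∧ (z.1 ∈ E → z.2 ∈ E → z.1 < z.2 →
      (∀ x ∈ Ioo z.1 z.2, x ∉ criticalSet f a b) → ∀ p q r s : ℝ, z.1 < p → p < q → q < r →
        r < s → s < z.2 →
      (r - q) * (s - p) * ((f q - f p) * (f s - f r)) ≤
        Real.exp (K * (r - p)) * ((f r - f q) * (f s - f p) * ((q - p) * (s - r))) ∧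
      (r - q) * (s - p) * ((f q - f p) * (f s - f r)) ≤
        Real.exp (K * (s - q)) * ((f r - f q) * (f s - f p) * ((q - p) * (s - r)))) := by
    intro z
    by_cases h : z.1 ∈ E ∧ z.2 ∈ E ∧ z.1 < z.2 ∧ ∀ x ∈ Ioo z.1 z.2, x ∉ criticalSet f a b
    · obtain ⟨K, hK, h'⟩ := exists_crossRatio_le_component hab hf hnf (hEI h.1) (hEI h.2.1) h.2.2.1
        h.2.2.2
      exact ⟨K, hK, fun _ _ _ _ => h'⟩
    · exact ⟨0, le_rfl, fun h1 h2 h3 h4 => absurd ⟨h1, h2, h3, h4⟩ h⟩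
  choose κ hκ0 hκ using hK
  obtain ⟨K, hKb⟩ := ((hEfin.prod hEfin).image κ).bddAbove
  refine ⟨max K 0, le_max_right _ _, fun p q r s hp hpq hqr hrs hs hcr => ?_⟩
  obtain ⟨c₁, ⟨hc₁E, hc₁p⟩, hc₁max⟩ := (hEfin.inter_of_left (Iio p)).exists_maximalFor id _
    ⟨a, mem_insert _ _, hp⟩
  obtain ⟨c₂, ⟨hc₂E, hc₂s⟩, hc₂min⟩ := (hEfin.inter_of_left (Ioi s)).exists_minimalFor id _
    ⟨b, mem_insert_of_mem _ (mem_insert _ _), hs⟩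
  have hc₁p' : c₁ < p := hc₁p
  have hc₂s' : s < c₂ := hc₂s
  have hgap : ∀ x ∈ Ioo c₁ c₂, x ∉ criticalSet f a b := by
    intro x hx hxc
    have hxE : x ∈ E := mem_insert_of_mem _ (mem_insert_of_mem _ hxc)
    rcases lt_or_ge x p with h | h
    · exact absurd (hc₁max ⟨hxE, h⟩ hx.1.le) hx.1.not_ge
    rcases lt_or_ge s x with h' | h'
    · exact absurd (hc₂min ⟨hxE, h'⟩ hx.2.le) hx.2.not_ge
    exact hcr x ⟨h, h'⟩ hxc
  have h := hκ (c₁, c₂) hc₁E hc₂E (by simp only; linarith) hgap p q r s hc₁p' hpq hqr hrs hc₂s'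
  have hle : κ (c₁, c₂) ≤ max K 0 :=
    (hKb (mem_image_of_mem κ (mk_mem_prod hc₁E hc₂E))).trans (le_max_left _ _)
  have hpos : 0 ≤ (f r - f q) * (f s - f p) * ((q - p) * (s - r)) := by
    have hsub : Icc p s ⊆ Ioo a b := fun x hx => ⟨hp.trans_le hx.1, hx.2.trans_lt hs⟩
    have h1 : 0 ≤ (r - q) * (s - p) * ((f q - f p) * (f s - f r)) ∧
        0 ≤ (f r - f q) * (f s - f p) := by
      have hcont := (hf.continuousOn.mono (hsub.trans Ioo_subset_Icc_self))
      have hmp : p ∈ Icc p s := ⟨le_rfl, by linarith⟩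
      have hmq : q ∈ Icc p s := ⟨by linarith, by linarith⟩
      have hmr : r ∈ Icc p s := ⟨by linarith, by linarith⟩
      have hms : s ∈ Icc p s := ⟨by linarith, le_rfl⟩
      rcases pos_or_neg_of_continuousOn_ne_zero (isPreconnected_Icc (a := p) (b := s))
        ((hf.derivWithin_Icc hab).continuousOn.mono (hsub.trans Ioo_subset_Icc_self))
        (fun x hx h => hcr x hx ⟨Ioo_subset_Icc_self (hsub hx), h⟩) with hs | hs
      · have hm : StrictMonoOn f (Icc p s) := strictMonoOn_of_deriv_pos (convex_Icc _ _) hcont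
          fun x hx => by
            rw [(hf.hasDerivAt_derivWithin_Icc (hsub (interior_subset hx))).deriv]
            exact hs x (interior_subset hx)
        have e1 := hm hmp hmq hpq
        have e2 := hm hmq hmr hqr
        have e3 := hm hmr hms hrs
        exact ⟨mul_nonneg (mul_nonneg (by linarith) (by linarith))
          (mul_nonneg (by linarith) (by linarith)), mul_nonneg (by linarith) (by linarith)⟩
      · have hm : StrictAntiOn f (Icc p s) := strictAntiOn_of_deriv_neg (convex_Icc _ _) hcont
          fun x hx => by
            rw [(hf.hasDerivAt_derivWithin_Icc (hsub (interior_subset hx))).deriv]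
            exact hs x (interior_subset hx)
        have e1 := hm hmp hmq hpq
        have e2 := hm hmq hmr hqr
        have e3 := hm hmr hms hrs
        exact ⟨mul_nonneg (mul_nonneg (by linarith) (by linarith))
          (mul_nonneg_of_nonpos_of_nonpos (by linarith) (by linarith)),
          mul_nonneg_of_nonpos_of_nonpos (by linarith) (by linarith)⟩
    exact mul_nonneg h1.2 (mul_nonneg (by linarith) (by linarith))
  exact ⟨h.1.trans (mul_le_mul_of_nonneg_right (Real.exp_le_exp.2
      (mul_le_mul_of_nonneg_right hle (by linarith))) hpos),
    h.2.trans (mul_le_mul_of_nonneg_right (Real.exp_le_exp.2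
      (mul_le_mul_of_nonneg_right hle (by linarith))) hpos)⟩

end CrossRatio

/-! ### Koebe distortion for chains of monotone maps -/

/-- The cross-ratio of the images of four points under `g`. -/
noncomputable def crossRatio (g : ℝ → ℝ) (p q r s : ℝ) : ℝ :=
  |g r - g q| * |g s - g p| / (|g q - g p| * |g s - g r|)

/-- A chain of monotone maps `y 0, …, y τ = id` on `(A, B)`, along which cross-ratios do not
decrease, up to errors controlled by lengths. -/
structure IsCrossRatioChain (K R A B : ℝ) (τ : ℕ) (y : ℕ → ℝ → ℝ) : Prop where
  mono : ∀ k ≤ τ, StrictMonoOn (y k) (Ioo A B) ∨ StrictAntiOn (y k) (Ioo A B)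
  last : ∀ x ∈ Ioo A B, y τ x = x
  diam : ∀ k ≤ τ, ∀ u ∈ Ioo A B, ∀ v ∈ Ioo A B, |y k u - y k v| ≤ R
  step_left : ∀ k < τ, ∀ p q r s : ℝ, A < p → p < q → q < r → r < s → s < B →
    crossRatio (y k) p q r s ≤ Real.exp (K * |y k r - y k p|) * crossRatio (y (k + 1)) p q r s
  step_right : ∀ k < τ, ∀ p q r s : ℝ, A < p → p < q → q < r → r < s → s < B →
    crossRatio (y k) p q r s ≤ Real.exp (K * |y k s - y k q|) * crossRatio (y (k + 1)) p q r s

theorem abs_sub_add_of_mono {g : ℝ → ℝ} {s : Set ℝ} (hg : StrictMonoOn g s ∨ StrictAntiOn g s)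
    {p q r : ℝ} (hp : p ∈ s) (hq : q ∈ s) (hr : r ∈ s) (hpq : p ≤ q) (hqr : q ≤ r) :
    |g r - g p| = |g r - g q| + |g q - g p| := by
  rcases hg with h | h
  · have h1 := h.monotoneOn hp hq hpq
    have h2 := h.monotoneOn hq hr hqr
    rw [abs_of_nonneg, abs_of_nonneg, abs_of_nonneg] <;> linarith
  · have h1 := h.antitoneOn hp hq hpq
    have h2 := h.antitoneOn hq hr hqr
    rw [abs_of_nonpos, abs_of_nonpos, abs_of_nonpos] <;> linarith

theorem abs_sub_pos_of_mono {g : ℝ → ℝ} {s : Set ℝ} (hg : StrictMonoOn g s ∨ StrictAntiOn g s)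
    {p q : ℝ} (hp : p ∈ s) (hq : q ∈ s) (hpq : p < q) : 0 < |g q - g p| := by
  refine abs_pos.2 (sub_ne_zero.2 fun h => ?_)
  rcases hg with hm | hm
  · exact (hm hp hq hpq).ne' h
  · exact (hm hp hq hpq).ne h

theorem crossRatio_le_of_forall {K : ℝ} {τ : ℕ} {y : ℕ → ℝ → ℝ} {err : ℕ → ℝ} {p q r s : ℝ}
    (h : ∀ k < τ, crossRatio (y k) p q r s ≤ Real.exp (K * err k) * crossRatio (y (k + 1)) p q r s)
    {k : ℕ} (hk : k ≤ τ) : crossRatio (y k) p q r s ≤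
      Real.exp (K * ∑ j ∈ Finset.Ico k τ, err j) * crossRatio (y τ) p q r s := by
  induction hn : τ - k generalizing k with
  | zero =>
    obtain rfl : k = τ := by omega
    simp
  | succ n ih =>
    refine (h k (by omega)).trans ?_
    rw [Finset.sum_eq_sum_Ico_succ_bot (by omega), mul_add, Real.exp_add, mul_assoc]
    exact mul_le_mul_of_nonneg_left (ih (k := k + 1) (by omega) (by omega)) (Real.exp_pos _).le

namespace IsCrossRatioChain

variable {K R A B S : ℝ} {τ : ℕ} {y : ℕ → ℝ → ℝ}

theorem crossRatio_last (h : IsCrossRatioChain K R A B τ y) {p q r s : ℝ} (hp : A < p)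
    (hpq : p < q) (hqr : q < r) (hrs : r < s) (hs : s < B) :
    crossRatio (y τ) p q r s = (r - q) * (s - p) / ((q - p) * (s - r)) := by
  rw [crossRatio, h.last p ⟨by linarith, by linarith⟩, h.last q ⟨by linarith, by linarith⟩,
    h.last r ⟨by linarith, by linarith⟩, h.last s ⟨by linarith, by linarith⟩,
    abs_of_pos (by linarith), abs_of_pos (by linarith), abs_of_pos (by linarith),
    abs_of_pos (by linarith)]

/-- The maps of the chain are comparable on a definite one-sided neighbourhood. -/
theorem exists_extension (hK : 0 ≤ K) {e₀ e₁ : ℝ} (he : e₀ < e₁) (hA : A < e₀) (hB : e₁ < B)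
    (R S : ℝ) :
    ∃ s, 0 < s ∧ e₁ + s < B ∧ ∀ (τ : ℕ) (y : ℕ → ℝ → ℝ), IsCrossRatioChain K R A B τ y →
      ∑ k ∈ Finset.range τ, |y k e₁ - y k e₀| ≤ S → ∀ k ≤ τ,
        |y k (e₁ + s) - y k e₁| ≤ |y k e₁ - y k e₀| := by
  set δ := (B - e₁) / 2 with hδ
  have hδ0 : 0 < δ := by linarith
  set L := e₁ - e₀ with hL
  have hL0 : 0 < L := by linarith
  set M := Real.exp (K * (R + 2 * S)) with hM
  have hM0 : 0 < M := Real.exp_pos _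
  -- The last bound makes `M * s * (L + δ) ≤ L * (δ - s)`, so that the final cross-ratio, with the
  -- accumulated error `M`, is at most `1`.
  set s := min L (min (δ / 2) (L * δ / (2 * (M * (L + δ))))) with hs
  have hs0 : 0 < s := lt_min hL0 (lt_min (by linarith) (by positivity))
  have hsL : s ≤ L := min_le_left _ _
  have hsδ : s ≤ δ / 2 := (min_le_right _ _).trans (min_le_left _ _)
  have hs3 : s * (2 * (M * (L + δ))) ≤ L * δ :=
    (le_div_iff₀ (by positivity)).1 ((min_le_right _ _).trans (min_le_right _ _))
  refine ⟨s, hs0, by linarith, fun τ y h hS k hk => ?_⟩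
  have m0 : e₀ ∈ Ioo A B := ⟨hA, by linarith⟩
  have m1 : e₁ ∈ Ioo A B := ⟨by linarith, hB⟩
  have m2 : e₁ + s ∈ Ioo A B := ⟨by linarith, by linarith⟩
  have m3 : e₁ + δ ∈ Ioo A B := ⟨by linarith, by linarith⟩
  induction hn : τ - k using Nat.strong_induction_on generalizing k with
  | _ n ih =>
    rcases hk.eq_or_lt with rfl | hlt
    · rw [h.last _ m0, h.last _ m1, h.last _ m2, abs_of_pos (by linarith), abs_of_pos (by linarith)]
      linarith
    -- The induction runs from `τ` down to `k`: for `j > k` the extension is already known to be no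
    -- longer than the image of `[e₀, e₁]`, which gives `2 * S`, and the term `j = k` is bounded by
    -- the diameter `R`.
    have hsum : ∑ j ∈ Finset.Ico k τ, |y j (e₁ + s) - y j e₀| ≤ R + 2 * S := by
      rw [Finset.sum_eq_sum_Ico_succ_bot hlt]
      refine add_le_add (h.diam k hk _ m2 _ m0) ?_
      calc ∑ j ∈ Finset.Ico (k + 1) τ, |y j (e₁ + s) - y j e₀|
          ≤ ∑ j ∈ Finset.Ico (k + 1) τ, 2 * |y j e₁ - y j e₀| := by
            refine Finset.sum_le_sum fun j hj => ?_
            rw [Finset.mem_Ico] at hj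
            rw [abs_sub_add_of_mono (h.mono j hj.2.le) m0 m1 m2 he.le (by linarith)]
            linarith [ih (τ - j) (by omega) j hj.2.le rfl]
        _ ≤ ∑ j ∈ Finset.range τ, 2 * |y j e₁ - y j e₀| := by
            refine Finset.sum_le_sum_of_subset_of_nonneg (fun j hj => ?_) fun _ _ _ => by positivity
            rw [Finset.mem_Ico] at hj
            exact Finset.mem_range.2 hj.2
        _ ≤ 2 * S := by rw [← Finset.mul_sum]; linarith
    have hX := crossRatio_le_of_forall (K := K) (err := fun j => |y j (e₁ + s) - y j e₀|)
      (fun j hj => h.step_left j hj e₀ e₁ (e₁ + s) (e₁ + δ) hA he (by linarith) (by linarith)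
        (by linarith)) hk
    rw [h.crossRatio_last hA he (by linarith) (by linarith) (by linarith)] at hX
    have hm := h.mono k hk
    have p1 := abs_sub_pos_of_mono hm m0 m1 he
    have p2 := abs_sub_pos_of_mono hm m2 m3 (by linarith)
    have p3 := abs_sub_add_of_mono hm m0 m2 m3 (by linarith) (by linarith)
    have hlow : |y k (e₁ + s) - y k e₁| / |y k e₁ - y k e₀| ≤
        crossRatio (y k) e₀ e₁ (e₁ + s) (e₁ + δ) := by
      rw [crossRatio, div_le_div_iff₀ p1 (mul_pos p1 p2)]
      have : |y k (e₁ + δ) - y k (e₁ + s)| ≤ |y k (e₁ + δ) - y k e₀| := by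
        rw [p3]; linarith [abs_nonneg (y k (e₁ + s) - y k e₀)]
      calc _ = |y k (e₁ + s) - y k e₁| * |y k e₁ - y k e₀| *
            |y k (e₁ + δ) - y k (e₁ + s)| := by ring
        _ ≤ |y k (e₁ + s) - y k e₁| * |y k e₁ - y k e₀| * |y k (e₁ + δ) - y k e₀| := by gcongr
        _ = _ := by ring
    have hup : Real.exp (K * ∑ j ∈ Finset.Ico k τ, |y j (e₁ + s) - y j e₀|) *
        ((e₁ + s - e₁) * (e₁ + δ - e₀) / ((e₁ - e₀) * (e₁ + δ - (e₁ + s)))) ≤ 1 := by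
      have h1 : Real.exp (K * ∑ j ∈ Finset.Ico k τ, |y j (e₁ + s) - y j e₀|) ≤ M :=
        Real.exp_le_exp.2 (mul_le_mul_of_nonneg_left hsum hK)
      rw [show e₁ + s - e₁ = s by ring, show e₁ + δ - e₀ = L + δ by rw [hL]; ring,
        show e₁ + δ - (e₁ + s) = δ - s by ring, ← hL]
      have h2 : 0 < L * (δ - s) := mul_pos hL0 (by linarith)
      calc _ ≤ M * (s * (L + δ) / (L * (δ - s))) := by gcongr
        _ = (M * (s * (L + δ))) / (L * (δ - s)) := by ring
        _ ≤ 1 := by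
            rw [div_le_one h2]
            nlinarith [mul_le_mul_of_nonneg_left hsδ hL0.le]
    exact (div_le_one p1).1 (hlow.trans (hX.trans hup))

/-- Lipschitz bounds with constants proportional to the lengths. -/
theorem exists_lipschitz (hK : 0 ≤ K) {e₀ e₁ : ℝ} (he : e₀ < e₁) (hA : A < e₀) (hB : e₁ < B)
    (R S : ℝ) :
    ∃ C, 0 ≤ C ∧ ∀ (τ : ℕ) (y : ℕ → ℝ → ℝ), IsCrossRatioChain K R A B τ y →
      ∑ k ∈ Finset.range τ, |y k e₁ - y k e₀| ≤ S → ∀ k ≤ τ, ∀ u ∈ Icc e₀ e₁, ∀ v ∈ Icc e₀ e₁,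
        |y k u - y k v| ≤ C * |y k e₁ - y k e₀| * |u - v| := by
  obtain ⟨s, hs0, hsB, hs⟩ := exists_extension hK he hA hB R S
  set δ := (e₀ - A) / 2 with hδ
  have hδ0 : 0 < δ := by linarith
  set M := Real.exp (K * (2 * S)) with hM
  have hM0 : 0 < M := Real.exp_pos _
  set Λ := e₁ + s - (e₀ - δ) with hΛ
  have hΛ0 : 0 < Λ := by linarith
  refine ⟨2 * (M * (Λ / (δ * s))), by positivity, fun τ y h hS k hk u hu v hv => ?_⟩
  wlog huv : u ≤ v generalizing u v
  · rw [abs_sub_comm, abs_sub_comm u]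
    exact this v hv u hu (le_of_not_ge huv)
  rcases huv.eq_or_lt with rfl | huv
  · simp
  have m0 : e₀ ∈ Ioo A B := ⟨hA, by linarith⟩
  have m1 : e₁ ∈ Ioo A B := ⟨by linarith, hB⟩
  have m2 : e₁ + s ∈ Ioo A B := ⟨by linarith, by linarith⟩
  have m3 : e₀ - δ ∈ Ioo A B := ⟨by linarith, by linarith⟩
  have mu : u ∈ Ioo A B := ⟨by linarith [hu.1], by linarith [hu.2]⟩
  have mv : v ∈ Ioo A B := ⟨by linarith [hv.1], by linarith [hv.2]⟩
  have hbig : ∀ j ≤ τ, ∀ x ∈ Icc e₀ e₁, |y j (e₁ + s) - y j x| ≤ 2 * |y j e₁ - y j e₀| := by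
    intro j hj x hx
    have mx : x ∈ Ioo A B := ⟨by linarith [hx.1], by linarith [hx.2]⟩
    rw [abs_sub_add_of_mono (h.mono j hj) mx m1 m2 hx.2 (by linarith)]
    have := abs_sub_add_of_mono (h.mono j hj) m0 mx m1 hx.1 hx.2
    linarith [hs τ y h hS j hj, abs_nonneg (y j x - y j e₀)]
  have hsum : ∑ j ∈ Finset.Ico k τ, |y j (e₁ + s) - y j u| ≤ 2 * S := by
    calc ∑ j ∈ Finset.Ico k τ, |y j (e₁ + s) - y j u|
        ≤ ∑ j ∈ Finset.Ico k τ, 2 * |y j e₁ - y j e₀| :=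
          Finset.sum_le_sum fun j hj => hbig j (Finset.mem_Ico.1 hj).2.le u hu
      _ ≤ ∑ j ∈ Finset.range τ, 2 * |y j e₁ - y j e₀| := by
          refine Finset.sum_le_sum_of_subset_of_nonneg (fun j hj => ?_) fun _ _ _ => by positivity
          exact Finset.mem_range.2 (Finset.mem_Ico.1 hj).2
      _ ≤ 2 * S := by rw [← Finset.mul_sum]; linarith
  -- The error is measured on `[u, e₁ + s]`, whose images are summable by `exists_extension`;
  -- nothing is needed about the images of the outer point `e₀ - δ`.
  have hX := crossRatio_le_of_forall (K := K) (err := fun j => |y j (e₁ + s) - y j u|)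
    (fun j hj => h.step_right j hj (e₀ - δ) u v (e₁ + s) (by linarith) (by linarith [hu.1]) huv
      (by linarith [hv.2]) hsB) hk
  rw [h.crossRatio_last (by linarith) (by linarith [hu.1]) huv (by linarith [hv.2]) hsB] at hX
  have hm := h.mono k hk
  have p1 := abs_sub_pos_of_mono hm m3 mu (by linarith [hu.1])
  have p2 := abs_sub_pos_of_mono hm mv m2 (by linarith [hv.2])
  have p3 := abs_sub_add_of_mono hm m3 mu m2 (by linarith [hu.1]) (by linarith [hu.2])
  have hlow : |y k v - y k u| / |y k (e₁ + s) - y k v| ≤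
      crossRatio (y k) (e₀ - δ) u v (e₁ + s) := by
    rw [crossRatio, div_le_div_iff₀ p2 (mul_pos p1 p2)]
    have : |y k u - y k (e₀ - δ)| ≤ |y k (e₁ + s) - y k (e₀ - δ)| := by
      rw [p3]; linarith [abs_nonneg (y k (e₁ + s) - y k u)]
    calc _ = |y k v - y k u| * |y k (e₁ + s) - y k v| * |y k u - y k (e₀ - δ)| := by ring
      _ ≤ |y k v - y k u| * |y k (e₁ + s) - y k v| * |y k (e₁ + s) - y k (e₀ - δ)| := by gcongr
      _ = _ := by ring
  have hup : Real.exp (K * ∑ j ∈ Finset.Ico k τ, |y j (e₁ + s) - y j u|) *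
      ((v - u) * (e₁ + s - (e₀ - δ)) / ((u - (e₀ - δ)) * (e₁ + s - v))) ≤
      M * (Λ / (δ * s)) * (v - u) := by
    have h1 : Real.exp (K * ∑ j ∈ Finset.Ico k τ, |y j (e₁ + s) - y j u|) ≤ M :=
      Real.exp_le_exp.2 (mul_le_mul_of_nonneg_left hsum hK)
    have h2 : δ * s ≤ (u - (e₀ - δ)) * (e₁ + s - v) :=
      mul_le_mul (by linarith [hu.1]) (by linarith [hv.2]) hs0.le (by linarith [hu.1])
    have h3 : 0 ≤ v - u := by linarith
    have h4 : 0 ≤ u - (e₀ - δ) := by linarith [hu.1]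
    have h5 : 0 ≤ e₁ + s - v := by linarith [hv.2]
    rw [← hΛ]
    calc _ ≤ M * ((v - u) * Λ / (δ * s)) := by gcongr
      _ = _ := by ring
  have h6 := (div_le_iff₀ p2).1 (hlow.trans (hX.trans hup))
  rw [abs_sub_comm, abs_sub_comm u, abs_of_pos (sub_pos.2 huv)]
  calc _ ≤ _ := h6
    _ ≤ M * (Λ / (δ * s)) * (v - u) * (2 * |y k e₁ - y k e₀|) :=
      mul_le_mul_of_nonneg_left (hbig k hk v hv) (mul_nonneg (by positivity) (by linarith))
    _ = _ := by ring

end IsCrossRatioChain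

theorem le_mul_abs_deriv_of_eventually {G A B : ℝ → ℝ} {D A₀ B₀ : ℝ} {x : ℝ} (hG : HasDerivAt G D x)
    (hA : Filter.Tendsto A (𝓝[>] 0) (𝓝 A₀)) (hB : Filter.Tendsto B (𝓝[>] 0) (𝓝 B₀))
    (h : ∀ᶠ t in 𝓝[>] (0 : ℝ), A t * t ≤ B t * |G (x + t) - G x|) : A₀ ≤ B₀ * |D| := by
  have h1 := hG.tendsto_slope_zero_right.abs
  refine le_of_tendsto_of_tendsto hA (hB.mul h1) ?_
  filter_upwards [h, self_mem_nhdsWithin] with t ht ht0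
  have ht0 : 0 < t := ht0
  simp only [smul_eq_mul]
  rw [abs_mul, abs_of_pos (inv_pos.2 ht0), ← mul_assoc, mul_comm (B t), mul_assoc,
    ← div_eq_inv_mul, le_div_iff₀ ht0]
  exact ht

theorem mul_abs_deriv_le_of_eventually {G A B : ℝ → ℝ} {D A₀ B₀ : ℝ} {x : ℝ} (hG : HasDerivAt G D x)
    (hA : Filter.Tendsto A (𝓝[>] 0) (𝓝 A₀)) (hB : Filter.Tendsto B (𝓝[>] 0) (𝓝 B₀))
    (h : ∀ᶠ t in 𝓝[>] (0 : ℝ), B t * |G (x + t) - G x| ≤ A t * t) : B₀ * |D| ≤ A₀ := by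
  have h1 := hG.tendsto_slope_zero_right.abs
  refine le_of_tendsto_of_tendsto (hB.mul h1) hA ?_
  filter_upwards [h, self_mem_nhdsWithin] with t ht ht0
  have ht0 : 0 < t := ht0
  simp only [smul_eq_mul]
  rw [abs_mul, abs_of_pos (inv_pos.2 ht0), ← mul_assoc, mul_comm (B t), mul_assoc,
    ← div_eq_inv_mul, div_le_iff₀ ht0]
  exact ht

/-- Almost nondecreasing cross-ratios bound the derivative at the left end point of an interval by
the slope. -/
theorem koebe_left {g : ℝ → ℝ} {A B e₀ e₁ σ K : ℝ}
    (hg : StrictMonoOn g (Ioo A B) ∨ StrictAntiOn g (Ioo A B)) (hσ : 0 < σ) (hA : A < e₀ - σ)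
    (hB : e₁ + σ < B)
    (hX₁ : ∀ p q r s : ℝ, e₀ ≤ p → p < q → q < r → r ≤ e₁ → r < s → s < B →
      crossRatio g p q r s ≤ Real.exp (K * (r - p)) * ((r - q) * (s - p) / ((q - p) * (s - r))))
    (hX₂ : ∀ p q r s : ℝ, A < p → p < q → e₀ ≤ q → q < r → r < s → s ≤ e₁ →
      crossRatio g p q r s ≤ Real.exp (K * (s - q)) * ((r - q) * (s - p) / ((q - p) * (s - r))))
    {x y D : ℝ} (hx : e₀ ≤ x) (hxy : x < y) (hy : y ≤ e₁) (hD : HasDerivAt g D x) :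
    |g y - g x| ≤ Real.exp ((K + σ⁻¹) * (y - x)) * |D| * (y - x) ∧
      |D| * (y - x) ≤ Real.exp ((K + σ⁻¹) * (y - x)) * |g y - g x| := by
  have hmem : ∀ t, e₀ - σ ≤ t → t ≤ e₁ + σ → t ∈ Ioo A B := fun t h1 h2 =>
    ⟨by linarith, by linarith⟩
  have hxm := hmem x (by linarith) (by linarith)
  have hym := hmem y (by linarith) (by linarith)
  set E := Real.exp (K * (y - x)) with hE
  have hE0 : 0 < E := Real.exp_pos _
  have hEσ : Real.exp ((K + σ⁻¹) * (y - x)) = E * Real.exp ((y - x) / σ) := by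
    rw [hE, ← Real.exp_add]; congr 1; field_simp
  -- The outer point keeps distance at least `σ`, so neglecting `y - x` against it costs a factor
  -- tending to `1` with `y - x`.
  have hexp : ∀ w, σ ≤ w → w + (y - x) ≤ Real.exp ((y - x) / σ) * w := by
    intro w hw
    have h1 : (y - x) / σ + 1 ≤ Real.exp ((y - x) / σ) := Real.add_one_le_exp _
    have h2 : y - x ≤ (y - x) / σ * w := by
      rw [div_mul_eq_mul_div, le_div_iff₀ hσ]
      exact mul_le_mul_of_nonneg_left hw (by linarith)
    nlinarith [mul_le_mul_of_nonneg_right h1 (hσ.le.trans hw)]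
  have hct : Filter.Tendsto (fun t => g (x + t)) (𝓝[>] 0) (𝓝 (g x)) := by
    have h1 : ContinuousAt (fun t => g (x + t)) 0 := by
      have h2 : ContinuousAt g (x + 0) := by rw [add_zero]; exact hD.continuousAt
      exact h2.comp (continuousAt_const.add continuousAt_id)
    have h3 := h1.tendsto
    rw [add_zero] at h3
    exact h3.mono_left nhdsWithin_le_nhds
  have hid : Filter.Tendsto (fun t : ℝ => y - x - t) (𝓝[>] 0) (𝓝 (y - x)) := by
    have h1 : Filter.Tendsto (fun t : ℝ => y - x - t) (𝓝 0) (𝓝 (y - x - 0)) :=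
      (continuous_const.sub continuous_id).tendsto _
    rw [sub_zero] at h1
    exact h1.mono_left nhdsWithin_le_nhds
  have hsmall : ∀ᶠ t in 𝓝[>] (0 : ℝ), 0 < t ∧ t < y - x :=
    Ioo_mem_nhdsGT (sub_pos.2 hxy)
  have hgyx := abs_sub_pos_of_mono hg hxm hym hxy
  constructor
  -- In the cross-ratio of `x, x + t, y, d` the second point tends to the first, which turns one
  -- short gap into the derivative at `x`.
  · set d := e₁ + σ with hd
    have hdm := hmem d (by linarith) le_rfl
    have p1 := abs_sub_pos_of_mono hg hym hdm (by linarith)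
    have p2 := abs_sub_add_of_mono hg hxm hym hdm hxy.le (by linarith)
    have h1 := le_mul_abs_deriv_of_eventually hD
      (((tendsto_const_nhds.sub hct).abs.mul_const |g d - g x|).mul_const (d - y))
      (((hid.const_mul E).mul_const (d - x)).mul_const |g d - g y|) (by
        filter_upwards [hsmall] with t ht
        have hm := hmem (x + t) (by linarith) (by linarith)
        have q1 := abs_sub_pos_of_mono hg hxm hm (by linarith)
        have h2 := hX₁ x (x + t) y d hx (by linarith) (by linarith) hy (by linarith) hB
        rw [crossRatio, ← mul_div_assoc, ← hE, div_le_div_iff₀ (mul_pos q1 p1)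
          (mul_pos (by linarith) (by linarith)), show x + t - x = t by ring,
          show y - (x + t) = y - x - t by ring] at h2
        linarith)
    have h3 : |g y - g x| * (d - y) ≤ E * (y - x) * (d - x) * |D| := by
      refine le_of_mul_le_mul_right (a := |g d - g y|) ?_ p1
      calc |g y - g x| * (d - y) * |g d - g y| ≤ |g y - g x| * (d - y) * |g d - g x| := by
            refine mul_le_mul_of_nonneg_left ?_ (mul_nonneg hgyx.le (by linarith))
            rw [p2]; linarith
        _ = |g y - g x| * |g d - g x| * (d - y) := by ring
        _ ≤ _ := h1
        _ = _ := by ring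
    have h4 := hexp (d - y) (by linarith)
    rw [show d - y + (y - x) = d - x by ring] at h4
    rw [hEσ]
    refine le_of_mul_le_mul_right (a := d - y) ?_ (by linarith)
    calc _ ≤ _ := h3
      _ = E * (y - x) * |D| * (d - x) := by ring
      _ ≤ E * (y - x) * |D| * (Real.exp ((y - x) / σ) * (d - y)) :=
        mul_le_mul_of_nonneg_left h4 (by have := sub_pos.2 hxy; positivity)
      _ = _ := by ring
  -- The outer point is now on the left: the cross-ratio of `a, x, x + t, y` has the derivative in
  -- the numerator as `t` tends to `0`.
  · set a := e₀ - σ with ha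
    have ham := hmem a le_rfl (by linarith)
    have p1 := abs_sub_pos_of_mono hg ham hxm (by linarith)
    have p2 := abs_sub_add_of_mono hg ham hxm hym (by linarith) hxy.le
    have h1 := mul_abs_deriv_le_of_eventually hD
      ((tendsto_const_nhds.sub hct).abs.const_mul (E * (y - a) * |g x - g a|))
      (hid.const_mul (|g y - g a| * (x - a))) (by
        filter_upwards [hsmall] with t ht
        have hm := hmem (x + t) (by linarith) (by linarith)
        have q1 := abs_sub_pos_of_mono hg hm hym (by linarith)
        have h2 := hX₂ a x (x + t) y hA (by linarith) hx (by linarith) (by linarith) hy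
        rw [crossRatio, ← mul_div_assoc, ← hE, div_le_div_iff₀ (mul_pos p1 q1)
          (mul_pos (by linarith) (by linarith)), show x + t - x = t by ring,
          show y - (x + t) = y - x - t by ring] at h2
        linarith)
    have h3 : |D| * (y - x) * (x - a) ≤ E * (y - a) * |g y - g x| := by
      refine le_of_mul_le_mul_right (a := |g x - g a|) ?_ p1
      calc |D| * (y - x) * (x - a) * |g x - g a| ≤ |D| * (y - x) * (x - a) * |g y - g a| := by
            refine mul_le_mul_of_nonneg_left ?_ (mul_nonneg (mul_nonneg (abs_nonneg _)
              (by linarith)) (by linarith))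
            rw [p2]; linarith
        _ = |g y - g a| * (x - a) * (y - x) * |D| := by ring
        _ ≤ _ := h1
        _ = _ := by ring
    have h4 := hexp (x - a) (by linarith)
    rw [show x - a + (y - x) = y - a by ring] at h4
    rw [hEσ]
    refine le_of_mul_le_mul_right (a := x - a) ?_ (by linarith)
    calc _ ≤ _ := h3
      _ = E * |g y - g x| * (y - a) := by ring
      _ ≤ E * |g y - g x| * (Real.exp ((y - x) / σ) * (x - a)) :=
        mul_le_mul_of_nonneg_left h4 (by positivity)
      _ = _ := by ring

theorem crossRatio_neg (g : ℝ → ℝ) (p q r s : ℝ) :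
    crossRatio (fun t => g (-t)) p q r s = crossRatio g (-s) (-r) (-q) (-p) := by
  simp only [crossRatio]
  rw [abs_sub_comm (g (-r)), abs_sub_comm (g (-s)) (g (-p)), abs_sub_comm (g (-q)) (g (-p)),
    abs_sub_comm (g (-s)) (g (-r)), mul_comm |g (-p) - g (-q)|]

namespace IsCrossRatioChain

variable {K A B : ℝ}

/-- Koebe distortion along a chain. -/
theorem exists_distortion (hK : 0 ≤ K) {e₀ e₁ : ℝ} (he : e₀ < e₁) (hA : A < e₀) (hB : e₁ < B)
    (R S : ℝ) :
    ∃ K', 0 ≤ K' ∧ ∀ (τ : ℕ) (y : ℕ → ℝ → ℝ), IsCrossRatioChain K R A B τ y →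
      ∑ k ∈ Finset.range τ, |y k e₁ - y k e₀| ≤ S → ∀ D : ℝ → ℝ,
        (∀ x ∈ Icc e₀ e₁, HasDerivAt (y 0) (D x) x) →
        ∀ u ∈ Icc e₀ e₁, ∀ v ∈ Icc e₀ e₁, ∀ z ∈ Icc e₀ e₁, ∀ l, |u - z| ≤ l → |v - z| ≤ l →
          |y 0 u - y 0 v| ≤ Real.exp (K' * l) * |D z| * |u - v| ∧
            |D z| * |u - v| ≤ Real.exp (K' * l) * |y 0 u - y 0 v| := by
  obtain ⟨C, hC0, hC⟩ := exists_lipschitz hK he hA hB R S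
  obtain ⟨σ, hσ, hAσ, hBσ⟩ : ∃ σ : ℝ, 0 < σ ∧ A < e₀ - σ ∧ e₁ + σ < B := by
    refine ⟨min ((e₀ - A) / 2) ((B - e₁) / 2), lt_min (by linarith) (by linarith), ?_, ?_⟩
    · linarith [min_le_left ((e₀ - A) / 2) ((B - e₁) / 2)]
    · linarith [min_le_right ((e₀ - A) / 2) ((B - e₁) / 2)]
  -- By the Lipschitz bounds the images of `[u, v]` have total length at most `C * S * (v - u)`, so
  -- the accumulated cross-ratio error is itself exponential in `v - u`.
  set K₁ := K * (C * max S 0) with hK₁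
  have hK₁0 : 0 ≤ K₁ := by positivity
  set K₂ := K₁ + σ⁻¹ with hK₂
  have hK₂0 : 0 ≤ K₂ := by positivity
  refine ⟨4 * K₂, by positivity, fun τ y h hS D hD => ?_⟩
  have herr : ∀ u ∈ Icc e₀ e₁, ∀ v ∈ Icc e₀ e₁, u ≤ v →
      Real.exp (K * ∑ j ∈ Finset.Ico 0 τ, |y j v - y j u|) ≤ Real.exp (K₁ * (v - u)) := by
    intro u hu v hv huv
    rw [hK₁, mul_assoc]
    refine Real.exp_le_exp.2 (mul_le_mul_of_nonneg_left ?_ hK)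
    rw [Nat.Ico_zero_eq_range]
    calc ∑ j ∈ Finset.range τ, |y j v - y j u|
        ≤ ∑ j ∈ Finset.range τ, C * (v - u) * |y j e₁ - y j e₀| := by
          refine Finset.sum_le_sum fun j hj => ?_
          have := hC τ y h hS j (Finset.mem_range.1 hj).le v hv u hu
          rw [abs_of_nonneg (sub_nonneg.2 huv)] at this
          linarith
      _ = C * (v - u) * ∑ j ∈ Finset.range τ, |y j e₁ - y j e₀| := by rw [Finset.mul_sum]
      _ ≤ C * (v - u) * max S 0 :=
          mul_le_mul_of_nonneg_left (hS.trans (le_max_left _ _)) (mul_nonneg hC0 (by linarith))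
      _ = _ := by ring
  have hstd : ∀ p q r s : ℝ, p < q → q < r → r < s →
      0 ≤ (r - q) * (s - p) / ((q - p) * (s - r)) := fun p q r s h1 h2 h3 =>
    div_nonneg (mul_nonneg (by linarith) (by linarith)) (mul_nonneg (by linarith) (by linarith))
  have hX₁ : ∀ p q r s : ℝ, e₀ ≤ p → p < q → q < r → r ≤ e₁ → r < s → s < B →
      crossRatio (y 0) p q r s ≤
        Real.exp (K₁ * (r - p)) * ((r - q) * (s - p) / ((q - p) * (s - r))) := by
    intro p q r s hp hpq hqr hr hrs hs
    have h1 := crossRatio_le_of_forall (K := K) (err := fun j => |y j r - y j p|)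
      (fun j hj => h.step_left j hj p q r s (by linarith) hpq hqr hrs hs) (Nat.zero_le τ)
    rw [h.crossRatio_last (by linarith) hpq hqr hrs hs] at h1
    exact h1.trans (mul_le_mul_of_nonneg_right (herr p ⟨hp, by linarith⟩ r ⟨by linarith, hr⟩
      (by linarith)) (hstd p q r s hpq hqr hrs))
  have hX₂ : ∀ p q r s : ℝ, A < p → p < q → e₀ ≤ q → q < r → r < s → s ≤ e₁ →
      crossRatio (y 0) p q r s ≤
        Real.exp (K₁ * (s - q)) * ((r - q) * (s - p) / ((q - p) * (s - r))) := by
    intro p q r s hp hpq hq hqr hrs hs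
    have h1 := crossRatio_le_of_forall (K := K) (err := fun j => |y j s - y j q|)
      (fun j hj => h.step_right j hj p q r s hp hpq hqr hrs (by linarith)) (Nat.zero_le τ)
    rw [h.crossRatio_last hp hpq hqr hrs (by linarith)] at h1
    exact h1.trans (mul_le_mul_of_nonneg_right (herr q ⟨hq, by linarith⟩ s ⟨by linarith, hs⟩
      (by linarith)) (hstd p q r s hpq hqr hrs))
  have hm := h.mono 0 (Nat.zero_le τ)
  have hleft := fun {u v : ℝ} (hu : e₀ ≤ u) (huv : u < v) (hv : v ≤ e₁) =>
    koebe_left hm hσ hAσ hBσ hX₁ hX₂ hu huv hv (hD u ⟨hu, by linarith⟩)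
  have hright : ∀ u v : ℝ, e₀ ≤ u → u < v → v ≤ e₁ →
      |y 0 u - y 0 v| ≤ Real.exp (K₂ * (v - u)) * |D v| * (v - u) ∧
        |D v| * (v - u) ≤ Real.exp (K₂ * (v - u)) * |y 0 u - y 0 v| := by
    intro u v hu huv hv
    have hneg : ∀ t ∈ Ioo (-B) (-A), -t ∈ Ioo A B := fun t ht =>
      ⟨by linarith [ht.2], by linarith [ht.1]⟩
    have hD' : HasDerivAt (fun t => y 0 (-t)) (-D v) (-v) := by
      have h1 : HasDerivAt (y 0) (D v) (- -v) := by rw [neg_neg]; exact hD v ⟨by linarith, hv⟩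
      refine (h1.scomp (-v) (hasDerivAt_neg (-v))).congr_deriv ?_
      simp
    have h2 := koebe_left (g := fun t => y 0 (-t)) (A := -B) (B := -A) (e₀ := -e₁) (e₁ := -e₀)
      (K := K₁) (hm.symm.imp (fun h1 s hs t ht hst => h1 (hneg t ht) (hneg s hs) (neg_lt_neg hst))
        fun h1 s hs t ht hst => h1 (hneg t ht) (hneg s hs) (neg_lt_neg hst)) hσ (by linarith)
      (by linarith) (fun p q r s h1 h2 h3 h4 h5 h6 => by
        rw [crossRatio_neg]
        refine (hX₂ (-s) (-r) (-q) (-p) (by linarith) (by linarith) (by linarith) (by linarith)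
          (by linarith) (by linarith)).trans (le_of_eq ?_)
        rw [show -p - -r = r - p by ring]
        congr 1
        rw [show -r - -s = s - r by ring, show -p - -q = q - p by ring, mul_comm (s - r)]
        ring)
      (fun p q r s h1 h2 h3 h4 h5 h6 => by
        rw [crossRatio_neg]
        refine (hX₁ (-s) (-r) (-q) (-p) (by linarith) (by linarith) (by linarith) (by linarith)
          (by linarith) (by linarith)).trans (le_of_eq ?_)
        rw [show -q - -s = s - q by ring]
        congr 1
        rw [show -r - -s = s - r by ring, show -p - -q = q - p by ring, mul_comm (s - r)]
        ring)
      (x := -v) (y := -u) (by linarith) (by linarith) (by linarith) hD'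
    simp only [neg_neg, abs_neg] at h2
    rw [show -u - -v = v - u by ring] at h2
    exact h2
  -- The derivatives at both ends of an interval are compared with the same slope.
  have hDD : ∀ u ∈ Icc e₀ e₁, ∀ z ∈ Icc e₀ e₁,
      |D u| ≤ Real.exp (2 * K₂ * |u - z|) * |D z| := by
    intro u hu z hz
    rcases lt_trichotomy u z with hlt | rfl | hlt
    · have h1 := (hleft hu.1 hlt hz.2).2
      have h2 := (hright u z hu.1 hlt hz.2).1
      rw [abs_sub_comm] at h2
      rw [abs_sub_comm, abs_of_pos (sub_pos.2 hlt)]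
      refine le_of_mul_le_mul_right (a := z - u) ?_ (sub_pos.2 hlt)
      calc _ ≤ _ := h1
        _ ≤ Real.exp (K₂ * (z - u)) * (Real.exp (K₂ * (z - u)) * |D z| * (z - u)) :=
          mul_le_mul_of_nonneg_left h2 (Real.exp_pos _).le
        _ = _ := by
          rw [show 2 * K₂ * (z - u) = K₂ * (z - u) + K₂ * (z - u) by ring, Real.exp_add]; ring
    · simp
    · have h1 := (hright z u hz.1 hlt hu.2).2
      have h2 := (hleft hz.1 hlt hu.2).1
      rw [abs_sub_comm] at h1
      rw [abs_of_pos (sub_pos.2 hlt)]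
      refine le_of_mul_le_mul_right (a := u - z) ?_ (sub_pos.2 hlt)
      calc _ ≤ _ := h1
        _ ≤ Real.exp (K₂ * (u - z)) * (Real.exp (K₂ * (u - z)) * |D z| * (u - z)) :=
          mul_le_mul_of_nonneg_left h2 (Real.exp_pos _).le
        _ = _ := by
          rw [show 2 * K₂ * (u - z) = K₂ * (u - z) + K₂ * (u - z) by ring, Real.exp_add]; ring
  intro u hu v hv z hz l hul hvl
  wlog huv : u ≤ v generalizing u v
  · rw [abs_sub_comm (y 0 u), abs_sub_comm u]
    exact this v hv u hu hvl hul (le_of_not_ge huv)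
  rcases huv.eq_or_lt with rfl | huv
  · simp
  have h1 := hleft hu.1 huv hv.2
  rw [abs_sub_comm] at h1
  have hlen : v - u ≤ 2 * l := by
    have := abs_le.1 hul
    have := abs_le.1 hvl
    linarith
  have hexp1 : Real.exp (K₂ * (v - u)) ≤ Real.exp (2 * K₂ * l) :=
    Real.exp_le_exp.2 (by nlinarith)
  have hexp2 : Real.exp (2 * K₂ * |u - z|) ≤ Real.exp (2 * K₂ * l) :=
    Real.exp_le_exp.2 (mul_le_mul_of_nonneg_left hul (by positivity))
  have hsplit : Real.exp (4 * K₂ * l) = Real.exp (2 * K₂ * l) * Real.exp (2 * K₂ * l) := by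
    rw [← Real.exp_add]; ring_nf
  have hvu : |u - v| = v - u := by rw [abs_sub_comm, abs_of_pos (sub_pos.2 huv)]
  rw [hvu, hsplit]
  have hvu0 : 0 ≤ v - u := by linarith
  constructor
  · calc _ ≤ _ := h1.1
      _ ≤ Real.exp (2 * K₂ * l) * (Real.exp (2 * K₂ * l) * |D z|) * (v - u) := by
        gcongr
        exact (hDD u hu z hz).trans (mul_le_mul_of_nonneg_right hexp2 (abs_nonneg _))
      _ = _ := by ring
  · have h2 := hDD z hz u hu
    rw [abs_sub_comm] at h2
    calc |D z| * (v - u) ≤ Real.exp (2 * K₂ * l) * |D u| * (v - u) := by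
          gcongr
          exact h2.trans (mul_le_mul_of_nonneg_right hexp2 (abs_nonneg _))
      _ = Real.exp (2 * K₂ * l) * (|D u| * (v - u)) := by ring
      _ ≤ Real.exp (2 * K₂ * l) * (Real.exp (2 * K₂ * l) * |y 0 u - y 0 v|) := by
          refine mul_le_mul_of_nonneg_left ?_ (Real.exp_pos _).le
          exact h1.2.trans (mul_le_mul_of_nonneg_right hexp1 (abs_nonneg _))
      _ = _ := by ring

end IsCrossRatioChain

/-! ### Absence of wandering intervals -/

/-- A convergent sequence together with its limit is a closed countable set, whereas the interval is
uncountable. -/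
theorem not_Icc_subset_closure_range_of_tendsto {a b q : ℝ} (hab : a < b) {u : ℕ → ℝ}
    (hu : Filter.Tendsto u Filter.atTop (𝓝 q)) : ¬ Icc a b ⊆ closure (range u) := by
  intro h
  have h1 : closure (range u) ⊆ insert q (range u) :=
    closure_minimal (subset_insert _ _) hu.isCompact_insert_range.isClosed
  exact not_countable_Icc hab (((countable_range u).insert q).mono (h.trans h1))
where
  not_countable_Icc {a b : ℝ} (hab : a < b) (h : (Icc a b).Countable) : False := by
    have h1 := h.measure_zero volume
    rw [Real.volume_Icc, ENNReal.ofReal_eq_zero] at h1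
    linarith

theorem injOn_iterate_of_le {f : ℝ → ℝ} {s : Set ℝ} {m n : ℕ} (hmn : m ≤ n)
    (h : InjOn f^[n] s) : InjOn f^[m] s := by
  obtain ⟨l, rfl⟩ : ∃ l, n = l + m := ⟨n - m, by omega⟩
  rw [Function.iterate_add] at h
  intro x hx y hy hxy
  exact h hx hy (congrArg f^[l] hxy)

section Homterval

variable {f : ℝ → ℝ} {a b : ℝ}

/-- If all iterates are injective on `[x, y]` and an orientation preserving iterate `f^[m]` moves an
interior point to an interior point, then `f^[m]` has no dense orbit. -/
theorem false_of_injOn_iterate_of_strictMonoOn (hab : a < b)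
    (hmaps : MapsTo f (Icc a b) (Icc a b)) (hcont : ContinuousOn f (Icc a b)) {x y : ℝ}
    (hx : x ∈ Icc a b) (hy : y ∈ Icc a b) (hinj : ∀ n, InjOn f^[n] (Icc x y)) {m : ℕ}
    (hdense : ∃ w ∈ Icc a b, Icc a b ⊆ closure (range fun k : ℕ => (f^[m])^[k] w))
    (hmono : StrictMonoOn f^[m] (Icc x y)) {z : ℝ} (hz : z ∈ Ioo x y) (hgz : f^[m] z ∈ Ioo x y)
    (hne : f^[m] z ≠ z) : False := by
  set g := f^[m] with hg
  have hsub : Icc x y ⊆ Icc a b := Icc_subset_Icc hx.1 hy.2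
  have hgmaps : MapsTo g (Icc a b) (Icc a b) := hmaps.iterate m
  have hgcont : ContinuousOn g (Icc a b) := hcont.iterate hmaps m
  have hxy : x < y := hz.1.trans hz.2
  have hzI := Ioo_subset_Icc_self hz
  have hgzI := Ioo_subset_Icc_self hgz
  have hcg : ContinuousAt g z :=
    (hgcont.mono hsub).continuousAt (Icc_mem_nhds hz.1 hz.2)
  obtain ⟨t, ht, hgt, hzt⟩ : ∃ t ∈ Ioo x y, g t ∈ Ioo x y ∧ z < t := by
    have h1 : ∀ᶠ t in 𝓝[>] z, (t ∈ Ioo x y ∧ g t ∈ Ioo x y) ∧ z < t :=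
      ((Filter.Eventually.and (show ∀ᶠ t in 𝓝 z, t ∈ Ioo x y from Ioo_mem_nhds hz.1 hz.2)
        (hcg.eventually (isOpen_Ioo.mem_nhds hgz))).filter_mono nhdsWithin_le_nhds).and
        self_mem_nhdsWithin
    obtain ⟨t, ⟨h2, h3⟩, h4⟩ := h1.exists
    exact ⟨t, h2, h3, h4⟩
  -- Injectivity leaves only the orientation open, and one pair settles it: `z < t` is sent to `g z
  -- < g t`, still in the interval, where `g^[k]` increases by induction.
  have hk : ∀ k, StrictMonoOn g^[k] (Icc x y) := by
    intro k
    induction k with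
    | zero => exact strictMonoOn_id
    | succ k ih =>
      have h1 : InjOn g^[k + 1] (Icc x y) := by
        rw [hg, ← Function.iterate_mul]; exact hinj _
      have h2 : ContinuousOn g^[k + 1] (Icc x y) := (hgcont.iterate hgmaps (k + 1)).mono hsub
      refine (h2.strictMonoOn_of_injOn_Icc' hxy.le h1).resolve_right fun h => ?_
      have h3 := h hzI (Ioo_subset_Icc_self ht) hzt
      have h4 := ih hgzI (Ioo_subset_Icc_self hgt) (hmono hzI (Ioo_subset_Icc_self ht) hzt)
      rw [Function.iterate_succ_apply, Function.iterate_succ_apply] at h3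
      exact h3.not_gt h4
  set A : ℕ → ℝ := fun k => g^[k] z with hA
  have hAI : ∀ k, A k ∈ Icc a b := fun k => hgmaps.iterate k (hsub hzI)
  have hsucc : ∀ k, A (k + 1) = g^[k] (g z) := fun k => Function.iterate_succ_apply _ _ _
  obtain ⟨q, hq⟩ : ∃ q, Filter.Tendsto A Filter.atTop (𝓝 q) := by
    rcases hne.lt_or_gt with h | h
    · have : Antitone A := antitone_nat_of_succ_le fun k => by
        rw [hsucc]; exact (hk k hgzI hzI h).le
      exact ⟨_, tendsto_atTop_ciInf this ⟨a, by rintro _ ⟨k, rfl⟩; exact (hAI k).1⟩⟩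
    · have : Monotone A := monotone_nat_of_le_succ fun k => by
        rw [hsucc]; exact (hk k hzI hgzI h).le
      exact ⟨_, tendsto_atTop_ciSup this ⟨b, by rintro _ ⟨k, rfl⟩; exact (hAI k).2⟩⟩
  have hq' : Filter.Tendsto (fun k => A (k + 1)) Filter.atTop (𝓝 q) :=
    hq.comp (Filter.tendsto_add_atTop_nat 1)
  -- Monotonicity squeezes these orbits between two consecutive terms of the orbit of `z`. A dense
  -- orbit entering the interval would therefore converge.
  have hconv : ∀ w ∈ uIcc z (g z), Filter.Tendsto (fun k => g^[k] w) Filter.atTop (𝓝 q) := by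
    intro w hw
    have hwI : w ∈ Icc x y := (ordConnected_Icc.uIcc_subset hzI hgzI) hw
    rcases le_total z (g z) with h | h
    · rw [uIcc_of_le h] at hw
      refine tendsto_of_tendsto_of_tendsto_of_le_of_le hq hq' (fun k => ?_) fun k => ?_
      · exact (hk k).monotoneOn hzI hwI hw.1
      · simp only [hsucc]; exact (hk k).monotoneOn hwI hgzI hw.2
    · rw [uIcc_of_ge h] at hw
      refine tendsto_of_tendsto_of_tendsto_of_le_of_le hq' hq (fun k => ?_) fun k => ?_
      · simp only [hsucc]; exact (hk k).monotoneOn hgzI hwI hw.1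
      · exact (hk k).monotoneOn hwI hzI hw.2
  obtain ⟨w, -, hw⟩ := hdense
  have hmin : min z (g z) < max z (g z) := min_lt_max.2 hne.symm
  obtain ⟨_, hv, k, rfl⟩ : ((Ioo (min z (g z)) (max z (g z))) ∩
      range fun k : ℕ => g^[k] w).Nonempty := by
    have hmem : (min z (g z) + max z (g z)) / 2 ∈ Ioo (min z (g z)) (max z (g z)) :=
      ⟨by linarith, by linarith⟩
    have hIcc : (min z (g z) + max z (g z)) / 2 ∈ Icc a b :=
      hsub ((ordConnected_Icc.uIcc_subset hzI hgzI) (Ioo_subset_Icc_self hmem))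
    exact mem_closure_iff.1 (hw hIcc) _ isOpen_Ioo hmem
  have h1 := hconv _ (Ioo_subset_Icc_self hv)
  refine not_Icc_subset_closure_range_of_tendsto hab (u := fun k : ℕ => g^[k] w) (q := q) ?_ hw
  rw [← Filter.tendsto_add_atTop_iff_nat k]
  simpa only [← Function.iterate_add_apply] using h1

/-- There is no interval on which all iterates are injective. -/
theorem exists_not_injOn_iterate (hab : a < b) (hmaps : MapsTo f (Icc a b) (Icc a b))
    (hcont : ContinuousOn f (Icc a b))
    (hdense : ∀ n : ℕ, 0 < n → ∃ w ∈ Icc a b, Icc a b ⊆ closure (range fun k : ℕ => (f^[n])^[k] w))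
    {x y : ℝ} (hx : x ∈ Icc a b) (hy : y ∈ Icc a b) (hxy : x < y) :
    ∃ n, ¬ InjOn f^[n] (Icc x y) := by
  by_contra! hinj
  have hsub : Icc x y ⊆ Icc a b := Icc_subset_Icc hx.1 hy.2
  have hcontn : ∀ n, ContinuousOn f^[n] (Icc x y) := fun n => (hcont.iterate hmaps n).mono hsub
  have hma : ∀ n, StrictMonoOn f^[n] (Icc x y) ∨ StrictAntiOn f^[n] (Icc x y) := fun n =>
    (hcontn n).strictMonoOn_of_injOn_Icc' hxy.le (hinj n)
  obtain ⟨w, -, hw⟩ := hdense 1 one_pos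
  rw [Function.iterate_one] at hw
  have hvisit : ∀ u v : ℝ, x ≤ u → u < v → v ≤ y → ∃ k : ℕ, f^[k] w ∈ Ioo u v := by
    intro u v hu huv hv
    have hmem : (u + v) / 2 ∈ Ioo u v := ⟨by linarith, by linarith⟩
    obtain ⟨_, h1, k, rfl⟩ := mem_closure_iff.1 (hw (hsub ⟨by linarith, by linarith⟩)) _
      isOpen_Ioo hmem
    exact ⟨k, h1⟩
  -- no returns by orientation preserving iterates
  have hno : ∀ i j : ℕ, i < j → f^[i] w ∈ Ioo x y → f^[j] w ∈ Ioo x y → f^[i] w ≠ f^[j] w →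
      StrictAntiOn f^[j - i] (Icc x y) := by
    intro i j hij hi hj hne
    refine (hma (j - i)).resolve_left fun hm => ?_
    have he : f^[j - i] (f^[i] w) = f^[j] w := by
      rw [← Function.iterate_add_apply]; congr 2; omega
    exact false_of_injOn_iterate_of_strictMonoOn hab hmaps hcont hx hy hinj (hdense _ (by omega))
      hm hi (by rwa [he]) (by rw [he]; exact hne.symm)
  -- Among three distinct visits all returns reverse orientation; but two reversals compose to an
  -- iterate preserving the order near the first point.
  have hthree : ∀ i j k : ℕ, i < j → j < k → f^[i] w ∈ Ioo x y → f^[j] w ∈ Ioo x y →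
      f^[k] w ∈ Ioo x y → f^[i] w ≠ f^[j] w → f^[j] w ≠ f^[k] w → f^[i] w ≠ f^[k] w → False := by
    intro i j k hij hjk hi hj hk n1 n2 n3
    have h1 := hno i j hij hi hj n1
    have h2 := hno j k hjk hj hk n2
    have h3 := hno i k (hij.trans hjk) hi hk n3
    have he : f^[j - i] (f^[i] w) = f^[j] w := by
      rw [← Function.iterate_add_apply]; congr 2; omega
    have hc : ContinuousAt f^[j - i] (f^[i] w) :=
      (hcontn (j - i)).continuousAt (Icc_mem_nhds hi.1 hi.2)
    have hev : ∀ᶠ t in 𝓝[>] (f^[i] w), (t ∈ Ioo x y ∧ f^[j - i] t ∈ Ioo x y) ∧ f^[i] w < t :=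
      ((Filter.Eventually.and (show ∀ᶠ t in 𝓝 (f^[i] w), t ∈ Ioo x y from Ioo_mem_nhds hi.1 hi.2)
        (hc.eventually (isOpen_Ioo.mem_nhds (by rwa [he])))).filter_mono nhdsWithin_le_nhds).and
        self_mem_nhdsWithin
    obtain ⟨t, ⟨ht, hft⟩, hlt⟩ := hev.exists
    have e1 := h1 (Ioo_subset_Icc_self hi) (Ioo_subset_Icc_self ht) hlt
    have e2 := h2 (Ioo_subset_Icc_self hft) (Ioo_subset_Icc_self (by rwa [he])) e1
    have e3 := h3 (Ioo_subset_Icc_self hi) (Ioo_subset_Icc_self ht) hlt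
    rw [← Function.iterate_add_apply f (k - j), ← Function.iterate_add_apply f (k - j) (j - i) t,
      show k - j + (j - i) = k - i by omega] at e2
    exact e2.not_gt e3
  set δ := (y - x) / 3 with hδ
  obtain ⟨k₁, h₁⟩ := hvisit x (x + δ) le_rfl (by linarith) (by linarith)
  obtain ⟨k₂, h₂⟩ := hvisit (x + δ) (x + 2 * δ) (by linarith) (by linarith) (by linarith)
  obtain ⟨k₃, h₃⟩ := hvisit (x + 2 * δ) y (by linarith) (by linarith) le_rfl
  have m₁ : f^[k₁] w ∈ Ioo x y := ⟨h₁.1, by linarith [h₁.2]⟩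
  have m₂ : f^[k₂] w ∈ Ioo x y := ⟨by linarith [h₂.1], by linarith [h₂.2]⟩
  have m₃ : f^[k₃] w ∈ Ioo x y := ⟨by linarith [h₃.1], h₃.2⟩
  have n₁₂ : f^[k₁] w ≠ f^[k₂] w := (h₁.2.trans h₂.1).ne
  have n₂₃ : f^[k₂] w ≠ f^[k₃] w := (h₂.2.trans h₃.1).ne
  have n₁₃ : f^[k₁] w ≠ f^[k₃] w := by linarith [h₁.2, h₃.1] |> fun h : f^[k₁] w < f^[k₃] w => h.ne
  have d₁₂ : k₁ ≠ k₂ := fun h => n₁₂ (by rw [h])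
  have d₂₃ : k₂ ≠ k₃ := fun h => n₂₃ (by rw [h])
  have d₁₃ : k₁ ≠ k₃ := fun h => n₁₃ (by rw [h])
  rcases lt_or_gt_of_ne d₁₂ with a | a <;> rcases lt_or_gt_of_ne d₂₃ with b | b <;>
    rcases lt_or_gt_of_ne d₁₃ with c | c
  · exact hthree _ _ _ a b m₁ m₂ m₃ n₁₂ n₂₃ n₁₃
  · omega
  · exact hthree _ _ _ c b m₁ m₃ m₂ n₁₃ n₂₃.symm n₁₂
  · exact hthree _ _ _ c a m₃ m₁ m₂ n₁₃.symm n₁₂ n₂₃.symm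
  · exact hthree _ _ _ a c m₂ m₁ m₃ n₁₂.symm n₁₃ n₂₃
  · exact hthree _ _ _ b c m₂ m₃ m₁ n₂₃ n₁₃.symm n₁₂.symm
  · omega
  · exact hthree _ _ _ b a m₃ m₂ m₁ n₂₃.symm n₁₂.symm n₁₃.symm

/-- Intervals on which a high iterate is injective are short. -/
theorem exists_forall_injOn_iterate_lt (hab : a < b) (hmaps : MapsTo f (Icc a b) (Icc a b))
    (hcont : ContinuousOn f (Icc a b))
    (hdense : ∀ n : ℕ, 0 < n → ∃ w ∈ Icc a b, Icc a b ⊆ closure (range fun k : ℕ => (f^[n])^[k] w))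
    {ε : ℝ} (hε : 0 < ε) :
    ∃ N : ℕ, ∀ x ∈ Icc a b, ∀ y ∈ Icc a b, InjOn f^[N] (Icc x y) → y - x < ε := by
  -- An interval of length at least `ε` contains a grid interval of length `ε / 2`, and finitely
  -- many grid intervals have a common failing time.
  have hgrid : ∀ j : ℕ, ∃ n : ℕ, a + (j + 1) * (ε / 2) ≤ b →
      ¬ InjOn f^[n] (Icc (a + j * (ε / 2)) (a + (j + 1) * (ε / 2))) := by
    intro j
    by_cases h : a + (j + 1) * (ε / 2) ≤ b
    · have h0 : 0 ≤ (j : ℝ) * (ε / 2) := by positivity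
      obtain ⟨n, hn⟩ := exists_not_injOn_iterate hab hmaps hcont hdense
        (x := a + j * (ε / 2)) (y := a + (j + 1) * (ε / 2)) ⟨by linarith, by linarith⟩
        ⟨by linarith, h⟩ (by linarith)
      exact ⟨n, fun _ => hn⟩
    · exact ⟨0, fun h' => absurd h' h⟩
  choose n hn using hgrid
  obtain ⟨N, hN⟩ := ((Set.finite_Iic ⌈(b - a) / (ε / 2)⌉₊).image n).bddAbove
  refine ⟨N, fun x hx y hy hinj => ?_⟩
  by_contra! hlen
  set j := ⌈(x - a) / (ε / 2)⌉₊ with hj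
  have hε2 : 0 < ε / 2 := by linarith
  have h1 : x - a ≤ j * (ε / 2) := (div_le_iff₀ hε2).1 (Nat.le_ceil _)
  have h2 : j * (ε / 2) < x - a + ε / 2 := by
    have := Nat.ceil_lt_add_one (div_nonneg (sub_nonneg.2 hx.1) hε2.le)
    rw [← hj] at this
    calc (j : ℝ) * (ε / 2) < ((x - a) / (ε / 2) + 1) * (ε / 2) := by gcongr
      _ = _ := by field_simp
  have hjle : j ≤ ⌈(b - a) / (ε / 2)⌉₊ := by
    refine Nat.ceil_le_ceil ?_
    gcongr
    exact hx.2
  refine hn j (by linarith [hy.2]) ((injOn_iterate_of_le (hN (mem_image_of_mem n hjle)) hinj).mono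
    (Icc_subset_Icc (by linarith) (by linarith)))

end Homterval

/-! ### Inverse branches -/

/-- The points with the same itinerary as `x` for `n` steps. -/
def itinerarySet (f : ℝ → ℝ) (P : Set (Set ℝ)) (x : ℝ) (n : ℕ) : Set ℝ :=
  {y | ∀ k < n, ∃ E ∈ P, f^[k] x ∈ E ∧ f^[k] y ∈ E}

theorem strictMonoOn_or_strictAntiOn_comp {g f : ℝ → ℝ} {s t : Set ℝ}
    (hg : StrictMonoOn g t ∨ StrictAntiOn g t) (hf : StrictMonoOn f s ∨ StrictAntiOn f s)
    (h : MapsTo f s t) : StrictMonoOn (g ∘ f) s ∨ StrictAntiOn (g ∘ f) s := by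
  rcases hg with hg | hg <;> rcases hf with hf | hf
  · exact Or.inl (hg.comp hf h)
  · exact Or.inr fun x hx y hy hxy => hg (h hy) (h hx) (hf hx hy hxy)
  · exact Or.inr fun x hx y hy hxy => hg (h hx) (h hy) (hf hx hy hxy)
  · exact Or.inl fun x hx y hy hxy => hg (h hy) (h hx) (hf hx hy hxy)

theorem mem_uIcc_of_mono {f : ℝ → ℝ} {s : Set ℝ} (hf : StrictMonoOn f s ∨ StrictAntiOn f s)
    {x y z : ℝ} (hx : x ∈ s) (hy : y ∈ s) (hz : z ∈ s) (h : z ∈ Icc x y) :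
    f z ∈ uIcc (f x) (f y) := by
  rcases hf with hf | hf
  · exact Icc_subset_uIcc ⟨hf.monotoneOn hx hz h.1, hf.monotoneOn hz hy h.2⟩
  · exact Icc_subset_uIcc' ⟨hf.antitoneOn hz hy h.2, hf.antitoneOn hx hz h.1⟩

theorem injOn_of_mono {f : ℝ → ℝ} {s : Set ℝ} (hf : StrictMonoOn f s ∨ StrictAntiOn f s) :
    InjOn f s := hf.elim StrictMonoOn.injOn StrictAntiOn.injOn

theorem IsBranchPartition.itinerarySet_ordConnected_mono {f : ℝ → ℝ} {I : Set ℝ} {P : Set (Set ℝ)}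
    (hP : IsBranchPartition f I P) (x : ℝ) (n : ℕ) :
    (itinerarySet f P x n).OrdConnected ∧ (StrictMonoOn f^[n] (itinerarySet f P x n) ∨
      StrictAntiOn f^[n] (itinerarySet f P x n)) := by
  induction n with
  | zero =>
    have : itinerarySet f P x 0 = univ := by ext; simp [itinerarySet]
    rw [this]
    exact ⟨ordConnected_univ, Or.inl (strictMonoOn_id)⟩
  | succ n ih =>
    obtain ⟨hc, hm⟩ := ih
    have hsub : itinerarySet f P x (n + 1) ⊆ itinerarySet f P x n := fun y hy k hk =>
      hy k (hk.trans n.lt_succ_self)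
    by_cases hE : ∃ E ∈ P, f^[n] x ∈ E
    · obtain ⟨E, hEP, hxE⟩ := hE
      have hmem : ∀ y ∈ itinerarySet f P x (n + 1), f^[n] y ∈ E := by
        intro y hy
        obtain ⟨E', hE', hx', hy'⟩ := hy n n.lt_succ_self
        by_cases h : E = E'
        · rwa [h]
        · exact absurd hx' (disjoint_left.1 (hP.disjoint hEP hE' h) hxE)
      refine ⟨⟨fun u hu v hv z hz k hk => ?_⟩, ?_⟩
      · have hzn : z ∈ itinerarySet f P x n := hc.out (hsub hu) (hsub hv) hz
        rcases Nat.lt_succ_iff_lt_or_eq.1 hk with hk | rfl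
        · exact hzn k hk
        · exact ⟨E, hEP, hxE, (hP.ordConnected E hEP).uIcc_subset (hmem u hu) (hmem v hv)
            (mem_uIcc_of_mono hm (hsub hu) (hsub hv) hzn hz)⟩
      · rw [Function.iterate_succ']
        exact strictMonoOn_or_strictAntiOn_comp (hP.monotone E hEP)
          (hm.imp (fun h => h.mono hsub) fun h => h.mono hsub) hmem
    · have : itinerarySet f P x (n + 1) = ∅ := by
        ext y
        simp only [mem_empty_iff_false, iff_false]
        intro hy
        obtain ⟨E', hE', hx', -⟩ := hy n n.lt_succ_self
        exact hE ⟨E', hE', hx'⟩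
      rw [this]
      exact ⟨ordConnected_empty, Or.inl fun y hy => hy.elim⟩

theorem hofbauerMap_iterate_fst (f : ℝ → ℝ) (P : Set (Set ℝ)) (n : ℕ) (q : ℝ × Set ℝ) :
    ((hofbauerMap f P)^[n] q).1 = f^[n] q.1 := by
  induction n with
  | zero => rfl
  | succ n ih =>
    rw [Function.iterate_succ_apply', Function.iterate_succ_apply', ← ih]; rfl

/-- Used at a return time: the level reached contains `U`, so the monotone branch of `f^[n]` through
the starting point covers `U`. -/
theorem hofbauerMap_iterate_snd_subset (f : ℝ → ℝ) (P : Set (Set ℝ)) (n : ℕ) (q : ℝ × Set ℝ) :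
    ((hofbauerMap f P)^[n] q).2 ⊆ f^[n] '' itinerarySet f P q.1 n := by
  induction n with
  | zero => exact fun y _ => ⟨y, fun k hk => absurd hk (Nat.not_lt_zero k), rfl⟩
  | succ n ih =>
    rw [Function.iterate_succ_apply']
    rintro _ ⟨d, ⟨hd, E, ⟨hE, hxE⟩, hdE⟩, rfl⟩
    obtain ⟨y, hy, rfl⟩ := ih hd
    rw [hofbauerMap_iterate_fst] at hxE
    refine ⟨y, fun k hk => ?_, Function.iterate_succ_apply' _ _ _⟩
    rcases Nat.lt_succ_iff_lt_or_eq.1 hk with hk | rfl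
    · exact hy k hk
    · exact ⟨E, hE, hxE, hdE⟩

/-- `g` is a monotone inverse branch of `f^[τ]` on `(A, B)`. -/
structure IsInverseBranch (f : ℝ → ℝ) (I : Set ℝ) (A B : ℝ) (τ : ℕ) (g : ℝ → ℝ) : Prop where
  mono : StrictMonoOn g (Ioo A B) ∨ StrictAntiOn g (Ioo A B)
  mapsTo : MapsTo g (Ioo A B) I
  right_inv : ∀ u ∈ Ioo A B, f^[τ] (g u) = u
  ordConnected : (g '' Ioo A B).OrdConnected

/-- A monotone function whose image is an interval has no jumps. -/
theorem continuousAt_of_mono_of_ordConnected_image {g : ℝ → ℝ} {A B : ℝ}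
    (hg : StrictMonoOn g (Ioo A B) ∨ StrictAntiOn g (Ioo A B))
    (hc : (g '' Ioo A B).OrdConnected) {u : ℝ} (hu : u ∈ Ioo A B) : ContinuousAt g u := by
  have hl : (A + u) / 2 ∈ Ioo A B := ⟨by linarith [hu.1], by linarith [hu.1, hu.2]⟩
  have hr : (u + B) / 2 ∈ Ioo A B := ⟨by linarith [hu.1, hu.2], by linarith [hu.2]⟩
  have hlu : (A + u) / 2 < u := by linarith [hu.1]
  have hur : u < (u + B) / 2 := by linarith [hu.2]
  have hnhds := isOpen_Ioo.mem_nhds hu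
  rcases hg with h | h
  · refine continuousAt_of_monotoneOn_of_image_mem_nhds h.monotoneOn hnhds ?_
    exact Filter.mem_of_superset (Icc_mem_nhds (h hl hu hlu) (h hu hr hur))
      (hc.out (mem_image_of_mem _ hl) (mem_image_of_mem _ hr))
  · have h1 : ContinuousAt (fun t => -g t) u := by
      refine continuousAt_of_monotoneOn_of_image_mem_nhds
        (fun s hs t ht hst => neg_le_neg (h.antitoneOn hs ht hst)) hnhds ?_
      have h2 : g '' Ioo A B ∈ 𝓝 (g u) := Filter.mem_of_superset
        (Icc_mem_nhds (h hu hr hur) (h hl hu hlu))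
        (hc.out (mem_image_of_mem _ hr) (mem_image_of_mem _ hl))
      have h3 : (fun t => -g t) '' Ioo A B = Neg.neg ⁻¹' (g '' Ioo A B) := by
        ext z
        constructor
        · rintro ⟨t, ht, rfl⟩; exact ⟨t, ht, (neg_neg _).symm⟩
        · rintro ⟨t, ht, hz⟩; exact ⟨t, ht, by simp [hz]⟩
      rw [h3]
      exact continuous_neg.continuousAt (by rwa [neg_neg])
    exact h1.neg.congr (Filter.Eventually.of_forall fun t => neg_neg _)

theorem IsInverseBranch.continuousOn {f : ℝ → ℝ} {I : Set ℝ} {A B : ℝ} {τ : ℕ} {g : ℝ → ℝ}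
    (h : IsInverseBranch f I A B τ g) : ContinuousOn g (Ioo A B) := fun _ hu =>
  (continuousAt_of_mono_of_ordConnected_image h.mono h.ordConnected hu).continuousWithinAt

theorem exists_isInverseBranch {f : ℝ → ℝ} {I Z : Set ℝ} {A B : ℝ} {τ : ℕ} (hZI : Z ⊆ I)
    (hZc : Z.OrdConnected) (hZm : StrictMonoOn f^[τ] Z ∨ StrictAntiOn f^[τ] Z)
    (hsurj : Ioo A B ⊆ f^[τ] '' Z) :
    ∃ g, IsInverseBranch f I A B τ g ∧ ∀ z ∈ Z, f^[τ] z ∈ Ioo A B → g (f^[τ] z) = z := by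
  have hsurj' : ∀ u, u ∈ Ioo A B → ∃ z, z ∈ Z ∧ f^[τ] z = u := fun u hu => hsurj hu
  choose! g hgZ hg using hsurj'
  have hinj := injOn_of_mono hZm
  have hleft : ∀ z ∈ Z, f^[τ] z ∈ Ioo A B → g (f^[τ] z) = z := fun z hz hzU =>
    hinj (hgZ _ hzU) hz (hg _ hzU)
  refine ⟨g, ⟨?_, fun u hu => hZI (hgZ _ hu), fun u hu => hg _ hu, ⟨?_⟩⟩, hleft⟩
  · refine hZm.imp (fun h u hu v hv huv => ?_) fun h u hu v hv huv => ?_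
    · exact (h.lt_iff_lt (hgZ _ hu) (hgZ _ hv)).1 (by rwa [hg u hu, hg v hv])
    · exact (h.lt_iff_gt (hgZ _ hu) (hgZ _ hv)).1 (by rwa [hg u hu, hg v hv])
  · rintro _ ⟨u, hu, rfl⟩ _ ⟨v, hv, rfl⟩ z hz
    have hzZ := hZc.out (hgZ _ hu) (hgZ _ hv) hz
    have h1 := mem_uIcc_of_mono hZm (hgZ _ hu) (hgZ _ hv) hzZ hz
    rw [hg u hu, hg v hv] at h1
    have h2 := ordConnected_Ioo.uIcc_subset hu hv h1
    exact ⟨f^[τ] z, h2, hleft z hzZ h2⟩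

namespace InducingScheme

variable {f : ℝ → ℝ} {a b : ℝ} {ι : Type*}

theorem dom_nontrivial {I : Set ℝ} (S : InducingScheme f I ι) (i : ι) : (S.dom i).Nontrivial := by
  obtain ⟨x, hx, y, hy, hxy⟩ := S.base_nontrivial
  obtain ⟨x', hx', rfl⟩ := S.surjOn_dom i hx
  obtain ⟨y', hy', rfl⟩ := S.surjOn_dom i hy
  exact ⟨x', hx', y', hy', fun h => hxy (by rw [h])⟩

/-- The branches of a scheme given by a first return map on the tower extend to a common
neighbourhood of the closure of the base. -/
theorem CorrespondsToFirstReturn.exists_isInverseBranch {S : InducingScheme f (Icc a b) ι}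
    {P : Set (Set ℝ)} (hS : S.CorrespondsToFirstReturn P) (hP : IsBranchPartition f (Icc a b) P)
    (hmaps : MapsTo f (Icc a b) (Icc a b)) (hcont : ContinuousOn f (Icc a b)) :
    ∃ A B, closure S.base ⊆ Ioo A B ∧ ∀ i, ∃ g, IsInverseBranch f (Icc a b) A B (S.tau i) g ∧
      ∀ x ∈ S.dom i, g (f^[S.tau i] x) = x := by
  obtain ⟨Xhat, -, hproj, ⟨U, hUo, hclU, hU⟩, hret⟩ := hS
  have hbdd : Bornology.IsBounded S.base := Metric.isBounded_Icc a b |>.subset S.base_subset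
  have hne : S.base.Nonempty := S.base_nontrivial.nonempty
  have hcomp : IsCompact (closure S.base) := hbdd.isCompact_closure
  obtain ⟨A, B, hAB, hABU⟩ : ∃ A B, closure S.base ⊆ Ioo A B ∧ Ioo A B ⊆ U := by
    have hinf := hcomp.sInf_mem hne.closure
    have hsup := hcomp.sSup_mem hne.closure
    obtain ⟨δ₀, hδ₀, h₀⟩ := Metric.isOpen_iff.1 hUo _ (hclU hinf)
    obtain ⟨δ₁, hδ₁, h₁⟩ := Metric.isOpen_iff.1 hUo _ (hclU hsup)
    have hcl : closure S.base = Icc (sInf (closure S.base)) (sSup (closure S.base)) := by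
      refine Subset.antisymm
        (fun x hx => ⟨csInf_le hcomp.bddBelow hx, le_csSup hcomp.bddAbove hx⟩) ?_
      exact (S.base_ordConnected.isPreconnected.closure.ordConnected).out hinf hsup
    refine ⟨sInf (closure S.base) - δ₀, sSup (closure S.base) + δ₁, fun x hx => ?_, fun x hx => ?_⟩
    · exact ⟨by linarith [csInf_le hcomp.bddBelow hx], by linarith [le_csSup hcomp.bddAbove hx]⟩
    · by_cases hx0 : x < sInf (closure S.base)
      · exact h₀ (by rw [Metric.mem_ball, Real.dist_eq, abs_lt]; constructor <;> linarith [hx.1])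
      by_cases hx1 : sSup (closure S.base) < x
      · exact h₁ (by rw [Metric.mem_ball, Real.dist_eq, abs_lt]; constructor <;> linarith [hx.2])
      · exact hclU (hcl ▸ ⟨not_lt.1 hx0, not_lt.1 hx1⟩)
  refine ⟨A, B, hAB, fun i => ?_⟩
  obtain ⟨x₀, hx₀, x₁, hx₁, hlt⟩ := (S.dom_nontrivial i).exists_lt
  -- At an end of `X_i` the itinerary may change, as turning points are assigned to one side. The
  -- argument is made on the interior `T`, and the left inverse property extends to `X_i` by
  -- continuity.
  set T : Set ℝ := {x | ∃ u ∈ S.dom i, ∃ v ∈ S.dom i, x ∈ Ioo u v} with hT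
  have hTdom : T ⊆ S.dom i := by
    rintro x ⟨u, hu, v, hv, hx⟩
    exact (S.dom_ordConnected i).out hu hv (Ioo_subset_Icc_self hx)
  have hTcl : S.dom i ⊆ closure T := by
    intro x hx
    have hIoo : ∀ u ∈ S.dom i, ∀ v ∈ S.dom i, u < v → Icc u v ⊆ closure T := by
      intro u hu v hv huv
      rw [← closure_Ioo huv.ne]
      exact closure_mono fun z hz => ⟨u, hu, v, hv, hz⟩
    rcases eq_or_ne x x₀ with rfl | hne
    · exact hIoo _ hx _ hx₁ hlt ⟨le_rfl, hlt.le⟩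
    · rcases hne.lt_or_gt with h | h
      · exact hIoo _ hx _ hx₀ h ⟨le_rfl, h.le⟩
      · exact hIoo _ hx₀ _ hx h ⟨h.le, le_rfl⟩
  have hxT : (x₀ + x₁) / 2 ∈ T := ⟨x₀, hx₀, x₁, hx₁, by constructor <;> linarith⟩
  set x := (x₀ + x₁) / 2 with hx
  have hxbase : x ∈ S.base := S.dom_subset i (hTdom hxT)
  rw [← hproj] at hxbase
  obtain ⟨⟨x', D⟩, hq, hx'⟩ := hxbase
  have hx' : x' = x := hx'
  rw [hx'] at hq
  have hqret := (hret _ hq i (hTdom hxT)).1.2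
  -- The point of the tower over `x` is back in `Xhat` at time `τ_i`, on a level containing `U`;
  -- only that it returns is needed here.
  have hUsub : Ioo A B ⊆ f^[S.tau i] '' itinerarySet f P x (S.tau i) :=
    hABU.trans ((hU _ hqret).trans (hofbauerMap_iterate_snd_subset f P _ _))
  obtain ⟨hZc, hZm⟩ := hP.itinerarySet_ordConnected_mono x (S.tau i)
  have hZI : itinerarySet f P x (S.tau i) ⊆ Icc a b := by
    intro y hy
    obtain ⟨E, hE, -, hyE⟩ := hy 0 (S.tau_pos i)
    rw [← hP.sUnion_eq]
    exact ⟨E, hE, hyE⟩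
  obtain ⟨g, hg, hleft⟩ := _root_.exists_isInverseBranch hZI hZc hZm hUsub
  refine ⟨g, hg, ?_⟩
  have hTZ : T ⊆ itinerarySet f P x (S.tau i) := by
    intro z hz k hk
    obtain ⟨u, hu, v, hv, hzuv⟩ := hz
    obtain ⟨u', hu', v', hv', hxuv⟩ := hxT
    have h1 : min u u' ∈ S.dom i := by rcases min_choice u u' with h | h <;> rwa [h]
    have h2 : max v v' ∈ S.dom i := by rcases max_choice v v' with h | h <;> rwa [h]
    have hsub : Icc (min u u') (max v v') ⊆ S.dom i := (S.dom_ordConnected i).out h1 h2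
    have hI := (S.dom_subset i).trans S.base_subset
    refine hP.exists_mem_iterate hmaps hcont (hI h1) (hI h2) ((S.injOn_dom i).mono hsub)
      ⟨(min_le_right _ _).trans_lt hxuv.1, hxuv.2.trans_le (le_max_right _ _)⟩
      ⟨(min_le_left _ _).trans_lt hzuv.1, hzuv.2.trans_le (le_max_left _ _)⟩ hk
  have hbaseU : S.base ⊆ Ioo A B := subset_closure.trans hAB
  have hEq : EqOn (g ∘ f^[S.tau i]) id T := fun z hz =>
    hleft z (hTZ hz) (hbaseU (S.mapsTo_dom i (hTdom hz)))
  exact hEq.of_subset_closure (hg.continuousOn.comp (S.continuousOn_dom i)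
    ((S.mapsTo_dom i).mono_right hbaseU)) continuousOn_id hTdom hTcl

end InducingScheme

/-! ### Inverse branches and the critical set -/

theorem ContinuousOn.strictMonoOn_of_injOn_Ioo' {g : ℝ → ℝ} {A B : ℝ}
    (hc : ContinuousOn g (Ioo A B)) (hi : InjOn g (Ioo A B)) :
    StrictMonoOn g (Ioo A B) ∨ StrictAntiOn g (Ioo A B) := by
  by_contra! h
  obtain ⟨h1, h2⟩ := h
  simp only [StrictMonoOn, StrictAntiOn] at h1 h2
  push Not at h1 h2
  obtain ⟨u, hu, v, hv, huv, h1⟩ := h1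
  obtain ⟨p, hp, q, hq, hpq, h2⟩ := h2
  have hx : min u p ∈ Ioo A B := by rcases min_choice u p with h | h <;> rwa [h]
  have hy : max v q ∈ Ioo A B := by rcases max_choice v q with h | h <;> rwa [h]
  have hsub : Icc (min u p) (max v q) ⊆ Ioo A B := ordConnected_Ioo.out hx hy
  have hle : min u p ≤ max v q := (min_le_left _ _).trans (huv.le.trans (le_max_left _ _))
  have mu : u ∈ Icc (min u p) (max v q) := ⟨min_le_left _ _, huv.le.trans (le_max_left _ _)⟩
  have mv : v ∈ Icc (min u p) (max v q) := ⟨(min_le_left _ _).trans huv.le, le_max_left _ _⟩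
  have mp : p ∈ Icc (min u p) (max v q) := ⟨min_le_right _ _, hpq.le.trans (le_max_right _ _)⟩
  have mq : q ∈ Icc (min u p) (max v q) := ⟨(min_le_right _ _).trans hpq.le, le_max_right _ _⟩
  rcases (hc.mono hsub).strictMonoOn_of_injOn_Icc' hle (hi.mono hsub) with h | h
  · exact (h mu mv huv).not_ge h1
  · exact (h mp mq hpq).not_ge h2

theorem crossRatio_le_of_mul_le {g h : ℝ → ℝ} {s : Set ℝ} {E p q r t : ℝ}
    (hg : StrictMonoOn g s ∨ StrictAntiOn g s) (hh : StrictMonoOn h s ∨ StrictAntiOn h s)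
    (hp : p ∈ s) (hq : q ∈ s) (hr : r ∈ s) (ht : t ∈ s) (hpq : p < q) (hqr : q < r) (hrt : r < t)
    (hle : (g r - g q) * (g t - g p) * ((h q - h p) * (h t - h r)) ≤
      E * ((h r - h q) * (h t - h p) * ((g q - g p) * (g t - g r)))) :
    crossRatio g p q r t ≤ E * crossRatio h p q r t := by
  have hpos : ∀ {k : ℝ → ℝ}, (StrictMonoOn k s ∨ StrictAntiOn k s) → ∀ {x y z w : ℝ}, x ∈ s →
      y ∈ s → z ∈ s → w ∈ s → x < y → z < w → 0 < (k y - k x) * (k w - k z) := by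
    rintro k (hk | hk) x y z w hx hy hz hw hxy hzw
    · exact mul_pos (sub_pos.2 (hk hx hy hxy)) (sub_pos.2 (hk hz hw hzw))
    · exact mul_pos_of_neg_of_neg (sub_neg.2 (hk hx hy hxy)) (sub_neg.2 (hk hz hw hzw))
  have g1 := hpos hg hq hr hp ht hqr (hpq.trans (hqr.trans hrt))
  have g2 := hpos hg hp hq hr ht hpq hrt
  have h1 := hpos hh hq hr hp ht hqr (hpq.trans (hqr.trans hrt))
  have h2 := hpos hh hp hq hr ht hpq hrt
  rw [crossRatio, crossRatio, ← abs_mul, ← abs_mul, ← abs_mul, ← abs_mul, abs_of_pos g1,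
    abs_of_pos g2, abs_of_pos h1, abs_of_pos h2, ← mul_div_assoc, div_le_div_iff₀ g2 h2]
  linarith

namespace IsInverseBranch

variable {f g : ℝ → ℝ} {a b A B : ℝ} {τ : ℕ}

theorem continuousOn_iterate (h : IsInverseBranch f (Icc a b) A B τ g)
    (hmaps : MapsTo f (Icc a b) (Icc a b)) (hcont : ContinuousOn f (Icc a b)) (k : ℕ) :
    ContinuousOn (fun u => f^[k] (g u)) (Ioo A B) :=
  (hcont.iterate hmaps k).comp h.continuousOn h.mapsTo

theorem mono_iterate (h : IsInverseBranch f (Icc a b) A B τ g)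
    (hmaps : MapsTo f (Icc a b) (Icc a b)) (hcont : ContinuousOn f (Icc a b)) {k : ℕ} (hk : k ≤ τ) :
    StrictMonoOn (fun u => f^[k] (g u)) (Ioo A B) ∨
      StrictAntiOn (fun u => f^[k] (g u)) (Ioo A B) := by
  refine (h.continuousOn_iterate hmaps hcont k).strictMonoOn_of_injOn_Ioo' fun u hu v hv huv => ?_
  have h1 := congrArg f^[τ - k] huv
  simp only [← Function.iterate_add_apply, Nat.sub_add_cancel hk] at h1
  rwa [h.right_inv u hu, h.right_inv v hv] at h1

theorem iterate_mem_Ioo (h : IsInverseBranch f (Icc a b) A B τ g)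
    (hmaps : MapsTo f (Icc a b) (Icc a b)) (hcont : ContinuousOn f (Icc a b)) {k : ℕ} (hk : k ≤ τ)
    {u : ℝ} (hu : u ∈ Ioo A B) : f^[k] (g u) ∈ Ioo a b := by
  have hl : (A + u) / 2 ∈ Ioo A B := ⟨by linarith [hu.1], by linarith [hu.1, hu.2]⟩
  have hr : (u + B) / 2 ∈ Ioo A B := ⟨by linarith [hu.1, hu.2], by linarith [hu.2]⟩
  have hlu : (A + u) / 2 < u := by linarith [hu.1]
  have hur : u < (u + B) / 2 := by linarith [hu.2]
  have hI := fun {v : ℝ} (hv : v ∈ Ioo A B) => hmaps.iterate k (h.mapsTo hv)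
  rcases h.mono_iterate hmaps hcont hk with hm | hm
  · exact ⟨(hI hl).1.trans_lt (hm hl hu hlu), (hm hu hr hur).trans_le (hI hr).2⟩
  · exact ⟨(hI hr).1.trans_lt (hm hu hr hur), (hm hl hu hlu).trans_le (hI hl).2⟩

/-- At a critical point, necessarily interior and hence a local extremum of `f`, the map `f^[k + 1]
∘ g` would have a local extremum, although it is strictly monotone on an open interval. -/
theorem iterate_notMem_criticalSet (h : IsInverseBranch f (Icc a b) A B τ g)
    (hmaps : MapsTo f (Icc a b) (Icc a b)) (hcont : ContinuousOn f (Icc a b))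
    (hext : ∀ c ∈ criticalSet f a b, c ∈ Ioo a b → IsLocalExtr f c) {k : ℕ} (hk : k < τ)
    {u : ℝ} (hu : u ∈ Ioo A B) : f^[k] (g u) ∉ criticalSet f a b := by
  intro hc
  have hcA : ContinuousAt (fun u => f^[k] (g u)) u :=
    (h.continuousOn_iterate hmaps hcont k).continuousAt (isOpen_Ioo.mem_nhds hu)
  have hU : ∀ᶠ v in 𝓝 u, v ∈ Ioo A B := Ioo_mem_nhds hu.1 hu.2
  have hex : IsLocalExtr (fun u => f^[k + 1] (g u)) u := by
    have h1 := hext _ hc (h.iterate_mem_Ioo hmaps hcont hk.le hu)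
    simp only [Function.iterate_succ_apply']
    exact h1.elim (fun h1 => Or.inl (hcA.eventually h1)) fun h1 => Or.inr (hcA.eventually h1)
  have hgt : ∃ᶠ v in 𝓝 u, u < v :=
    (frequently_gt_nhds u)
  have hlt : ∃ᶠ v in 𝓝 u, v < u :=
    (frequently_lt_nhds u)
  rcases h.mono_iterate hmaps hcont (show k + 1 ≤ τ from hk) with hm | hm <;> rcases hex with hx | hx
  · obtain ⟨v, h1, h2, h3⟩ := (hlt.and_eventually (hU.and hx)).exists
    exact (hm h2 hu h1).not_ge h3
  · obtain ⟨v, h1, h2, h3⟩ := (hgt.and_eventually (hU.and hx)).exists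
    exact (hm hu h2 h1).not_ge h3
  · obtain ⟨v, h1, h2, h3⟩ := (hgt.and_eventually (hU.and hx)).exists
    exact (hm hu h2 h1).not_ge h3
  · obtain ⟨v, h1, h2, h3⟩ := (hlt.and_eventually (hU.and hx)).exists
    exact (hm h2 hu h1).not_ge h3

theorem exists_hasDerivAt_iterate (h : IsInverseBranch f (Icc a b) A B τ g)
    (hmaps : MapsTo f (Icc a b) (Icc a b)) (hf : ContDiffOn ℝ 2 f (Icc a b))
    (hext : ∀ c ∈ criticalSet f a b, c ∈ Ioo a b → IsLocalExtr f c) {k : ℕ} (hk : k ≤ τ)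
    {u : ℝ} (hu : u ∈ Ioo A B) : ∃ d, d ≠ 0 ∧ HasDerivAt f^[k] d (g u) := by
  induction k with
  | zero => exact ⟨1, one_ne_zero, hasDerivAt_id _⟩
  | succ k ih =>
    obtain ⟨d, hd, hd'⟩ := ih (by omega)
    have h1 := h.iterate_mem_Ioo hmaps hf.continuousOn (show k ≤ τ by omega) hu
    refine ⟨derivWithin f (Icc a b) (f^[k] (g u)) * d, mul_ne_zero (fun h0 => ?_) hd, ?_⟩
    · exact h.iterate_notMem_criticalSet hmaps hf.continuousOn hext hk hu
        ⟨Ioo_subset_Icc_self h1, h0⟩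
    · rw [Function.iterate_succ']
      exact (hf.hasDerivAt_derivWithin_Icc h1).comp _ hd'

theorem exists_hasDerivAt (h : IsInverseBranch f (Icc a b) A B τ g)
    (hmaps : MapsTo f (Icc a b) (Icc a b)) (hf : ContDiffOn ℝ 2 f (Icc a b))
    (hext : ∀ c ∈ criticalSet f a b, c ∈ Ioo a b → IsLocalExtr f c)
    {u : ℝ} (hu : u ∈ Ioo A B) : ∃ d, d ≠ 0 ∧ HasDerivAt g d u := by
  obtain ⟨d, hd, hd'⟩ := h.exists_hasDerivAt_iterate hmaps hf hext le_rfl hu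
  exact ⟨d⁻¹, inv_ne_zero hd, HasDerivAt.of_local_left_inverse
    (h.continuousOn.continuousAt (isOpen_Ioo.mem_nhds hu)) hd' hd
    (Filter.mem_of_superset (isOpen_Ioo.mem_nhds hu) h.right_inv)⟩

/-- The iterates of an inverse branch form a chain for the cross-ratio estimates. -/
theorem isCrossRatioChain (h : IsInverseBranch f (Icc a b) A B τ g)
    (hmaps : MapsTo f (Icc a b) (Icc a b)) (hcont : ContinuousOn f (Icc a b))
    (hext : ∀ c ∈ criticalSet f a b, c ∈ Ioo a b → IsLocalExtr f c) {K : ℝ}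
    (hK : ∀ p q r s : ℝ, a < p → p < q → q < r → r < s → s < b →
      (∀ x ∈ Icc p s, x ∉ criticalSet f a b) →
      (r - q) * (s - p) * ((f q - f p) * (f s - f r)) ≤
        Real.exp (K * (r - p)) * ((f r - f q) * (f s - f p) * ((q - p) * (s - r))) ∧
      (r - q) * (s - p) * ((f q - f p) * (f s - f r)) ≤
        Real.exp (K * (s - q)) * ((f r - f q) * (f s - f p) * ((q - p) * (s - r)))) :
    IsCrossRatioChain K (b - a) A B τ (fun k u => f^[k] (g u)) := by
  have hstep : ∀ k < τ, ∀ p q r s : ℝ, A < p → p < q → q < r → r < s → s < B →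
      crossRatio (fun u => f^[k] (g u)) p q r s ≤
        Real.exp (K * |f^[k] (g r) - f^[k] (g p)|) *
          crossRatio (fun u => f^[k + 1] (g u)) p q r s ∧
      crossRatio (fun u => f^[k] (g u)) p q r s ≤
        Real.exp (K * |f^[k] (g s) - f^[k] (g q)|) *
          crossRatio (fun u => f^[k + 1] (g u)) p q r s := by
    intro k hk p q r s hp hpq hqr hrs hs
    have mp : p ∈ Ioo A B := ⟨by linarith, by linarith⟩
    have mq : q ∈ Ioo A B := ⟨by linarith, by linarith⟩
    have mr : r ∈ Ioo A B := ⟨by linarith, by linarith⟩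
    have ms : s ∈ Ioo A B := ⟨by linarith, by linarith⟩
    have hm := h.mono_iterate hmaps hcont hk.le
    have hm' := h.mono_iterate hmaps hcont (show k + 1 ≤ τ from hk)
    have hIoo := fun {u : ℝ} (hu : u ∈ Ioo A B) => h.iterate_mem_Ioo hmaps hcont hk.le hu
    have hcrit : ∀ x ∈ uIcc (f^[k] (g p)) (f^[k] (g s)), x ∉ criticalSet f a b := by
      intro x hx
      have hsub : uIcc p s ⊆ Ioo A B := ordConnected_Ioo.uIcc_subset mp ms
      obtain ⟨u, hu, rfl⟩ := intermediate_value_uIcc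
        ((h.continuousOn_iterate hmaps hcont k).mono hsub) hx
      exact h.iterate_notMem_criticalSet hmaps hcont hext hk (hsub hu)
    have key := fun {E : ℝ} => crossRatio_le_of_mul_le (E := E) hm hm' mp mq mr ms hpq hqr hrs
    simp only [Function.iterate_succ_apply'] at key ⊢
    rcases hm with hm | hm
    · have h1 : f^[k] (g p) < f^[k] (g q) := hm mp mq hpq
      have h2 : f^[k] (g q) < f^[k] (g r) := hm mq mr hqr
      have h3 : f^[k] (g r) < f^[k] (g s) := hm mr ms hrs
      have h4 := hK _ _ _ _ (hIoo mp).1 h1 h2 h3 (hIoo ms).2 fun x hx => hcrit x (Icc_subset_uIcc hx)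
      rw [abs_of_pos (by linarith), abs_of_pos (by linarith)]
      exact ⟨key h4.1, key h4.2⟩
    -- The order of the four points is reversed, so the left and right error bounds exchange roles.
    · have h1 : f^[k] (g q) < f^[k] (g p) := hm mp mq hpq
      have h2 : f^[k] (g r) < f^[k] (g q) := hm mq mr hqr
      have h3 : f^[k] (g s) < f^[k] (g r) := hm mr ms hrs
      have h4 := hK _ _ _ _ (hIoo ms).1 h3 h2 h1 (hIoo mp).2 fun x hx =>
        hcrit x (Icc_subset_uIcc' hx)
      rw [abs_of_neg (by linarith), abs_of_neg (by linarith), neg_sub, neg_sub]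
      exact ⟨key (by linarith [h4.2]), key (by linarith [h4.1])⟩
  exact
    { mono := fun k hk => h.mono_iterate hmaps hcont hk
      last := h.right_inv
      diam := fun k _ u hu v hv => by
        have h1 := hmaps.iterate k (h.mapsTo hu)
        have h2 := hmaps.iterate k (h.mapsTo hv)
        rw [abs_le]
        constructor <;> linarith [h1.1, h1.2, h2.1, h2.2]
      step_left := fun k hk p q r s h1 h2 h3 h4 h5 => (hstep k hk p q r s h1 h2 h3 h4 h5).1
      step_right := fun k hk p q r s h1 h2 h3 h4 h5 => (hstep k hk p q r s h1 h2 h3 h4 h5).2 }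

end IsInverseBranch

/-! ### From the inducing scheme to an iterated function system -/

namespace InducingScheme

variable {f : ℝ → ℝ} {a b : ℝ} {ι : Type*}

theorem exists_closure_base_eq (S : InducingScheme f (Icc a b) ι) :
    ∃ e₀ e₁, e₀ < e₁ ∧ closure S.base = Icc e₀ e₁ ∧ Ioo e₀ e₁ ⊆ S.base := by
  have hcomp : IsCompact (closure S.base) :=
    (Metric.isBounded_Icc a b |>.subset S.base_subset).isCompact_closure
  have hne : (closure S.base).Nonempty := S.base_nontrivial.nonempty.closure
  have hinf := hcomp.sInf_mem hne
  have hsup := hcomp.sSup_mem hne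
  have hle := fun {x : ℝ} (hx : x ∈ closure S.base) => csInf_le hcomp.bddBelow hx
  have hge := fun {x : ℝ} (hx : x ∈ closure S.base) => le_csSup hcomp.bddAbove hx
  obtain ⟨x, hx, y, hy, hxy⟩ := S.base_nontrivial.exists_lt
  refine ⟨sInf (closure S.base), sSup (closure S.base),
    (hle (subset_closure hx)).trans_lt (hxy.trans_le (hge (subset_closure hy))),
    Subset.antisymm (fun x hx => ⟨hle hx, hge hx⟩)
      ((S.base_ordConnected.isPreconnected.closure.ordConnected).out hinf hsup), fun z hz => ?_⟩
  obtain ⟨u, hu, hub⟩ := mem_closure_iff.1 hinf _ isOpen_Iio hz.1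
  obtain ⟨v, hv, hvb⟩ := mem_closure_iff.1 hsup _ isOpen_Ioi hz.2
  exact S.base_ordConnected.out hub hvb ⟨le_of_lt hu, le_of_lt hv⟩

theorem wordTime_succ_shift {I : Set ℝ} (S : InducingScheme f I ι) (w : ℕ → ι) (n : ℕ) :
    S.wordTime w (n + 1) = S.wordTime (fun k => w (k + 1)) n + S.tau (w 0) := by
  rw [wordTime, Finset.sum_range_succ']; rfl

theorem le_wordTime {I : Set ℝ} (S : InducingScheme f I ι) (w : ℕ → ι) (n : ℕ) :
    n ≤ S.wordTime w n := by
  cases n with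
  | zero => exact Nat.zero_le _
  | succ n => have := S.tau_add_le_wordTime w n; have := S.tau_pos (w 0); omega

/-- The inverse branches of a scheme form a hyperbolic iterated function system. -/
theorem exists_isIntervalIFS (S : InducingScheme f (Icc a b) ι) (hab : a < b)
    (hf : IsClassH f a b) (hext : ∀ c ∈ criticalSet f a b, c ∈ Ioo a b → IsLocalExtr f c)
    {A B e₀ e₁ M : ℝ} {g : ι → ℝ → ℝ} (he : e₀ < e₁) (hcl : closure S.base = Icc e₀ e₁)
    (hbase : Ioo e₀ e₁ ⊆ S.base) (hAB : Icc e₀ e₁ ⊆ Ioo A B)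
    (hg : ∀ i, IsInverseBranch f (Icc a b) A B (S.tau i) (g i))
    (hleft : ∀ i, ∀ x ∈ S.dom i, g i (f^[S.tau i] x) = x)
    (hsum : ∀ i, ∑ k ∈ Finset.range (S.tau i), |f^[k] (g i e₁) - f^[k] (g i e₀)| ≤ M) :
    (∃ K, IsIntervalIFS e₀ e₁ K g fun i u => |deriv (g i) u|) ∧
      ∃ C, 0 ≤ C ∧ ∀ i, ∀ k ≤ S.tau i, ∀ u ∈ Icc e₀ e₁, ∀ v ∈ Icc e₀ e₁,
        |f^[k] (g i u) - f^[k] (g i v)| ≤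
          C * |f^[k] (g i e₁) - f^[k] (g i e₀)| * |u - v| := by
  have hcont := hf.contDiffOn.continuousOn
  obtain ⟨K, hK0, hK⟩ := exists_crossRatio_le hab hf.contDiffOn hf.finite_critical hf.nonflat
  have hchain := fun i => (hg i).isCrossRatioChain hf.mapsTo hcont hext hK
  have hm0 : e₀ ∈ Icc e₀ e₁ := left_mem_Icc.2 he.le
  have hm1 : e₁ ∈ Icc e₀ e₁ := right_mem_Icc.2 he.le
  obtain ⟨C, hC0, hC⟩ := IsCrossRatioChain.exists_lipschitz hK0 he (hAB hm0).1 (hAB hm1).2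
    (b - a) M
  obtain ⟨K', hK'0, hK'⟩ := IsCrossRatioChain.exists_distortion hK0 he (hAB hm0).1 (hAB hm1).2
    (b - a) M
  refine ⟨⟨K', ?_⟩, C, hC0, fun i => hC _ _ (hchain i) (hsum i)⟩
  have hder : ∀ i, ∀ u ∈ Icc e₀ e₁, deriv (g i) u ≠ 0 ∧ HasDerivAt (g i) (deriv (g i) u) u := by
    intro i u hu
    obtain ⟨d, hd, hd'⟩ := (hg i).exists_hasDerivAt hf.mapsTo hf.contDiffOn hext (hAB hu)
    rw [hd'.deriv]
    exact ⟨hd, hd'⟩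
  have hgdom : ∀ i, MapsTo (g i) S.base (S.dom i) := by
    intro i y hy
    obtain ⟨x, hx, rfl⟩ := S.surjOn_dom i hy
    rwa [hleft i x hx]
  have hgcont : ∀ i, ContinuousOn (g i) (Icc e₀ e₁) := fun i => (hg i).continuousOn.mono hAB
  have hmaps : ∀ i, MapsTo (g i) (Icc e₀ e₁) (Icc e₀ e₁) := by
    intro i
    rw [← hcl]
    exact ((hgdom i).mono_right (S.dom_subset i)).closure_of_continuousOn (hcl ▸ hgcont i)
  have hsmaps : ∀ (n : ℕ) (η : ℕ → ι), MapsTo (seqMap g n η) (Icc e₀ e₁) (Icc e₀ e₁) := by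
    intro n
    induction n with
    | zero => exact fun η u hu => hu
    | succ n ih => exact fun η u hu => hmaps _ (ih _ hu)
  have hscont : ∀ (n : ℕ) (η : ℕ → ι), ContinuousOn (seqMap g n η) (Icc e₀ e₁) := by
    intro n
    induction n with
    | zero => exact fun η => continuousOn_id
    | succ n ih => exact fun η => (hgcont (η 0)).comp (ih _) (hsmaps n _)
  have hsinv : ∀ (n : ℕ) (η : ℕ → ι), ∀ u ∈ Icc e₀ e₁,
      f^[S.wordTime η n] (seqMap g n η u) = u := by
    intro n
    induction n with
    | zero => exact fun η u hu => rfl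
    | succ n ih =>
      intro η u hu
      rw [S.wordTime_succ_shift, Function.iterate_add_apply]
      simp only [seqMap]
      rw [(hg (η 0)).right_inv _ (hAB (hsmaps n _ hu)), ih _ u hu]
  have hIab : Icc e₀ e₁ ⊆ Icc a b := by
    rw [← hcl]; exact closure_minimal S.base_subset isClosed_Icc
  exact
    { lt := he
      K_nonneg := hK'0
      mapsTo := hmaps
      pos := fun i u hu => abs_pos.2 (hder i u hu).1
      mono := fun i => (hg i).mono.imp (fun h => h.mono hAB) fun h => h.mono hAB
      dist_le := fun i x hx y hy z hz l h1 h2 =>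
        (hK' _ _ (hchain i) (hsum i) (deriv (g i)) (fun u hu => (hder i u hu).2)
          x hx y hy z hz l h1 h2).1
      le_dist := fun i x hx y hy z hz l h1 h2 =>
        (hK' _ _ (hchain i) (hsum i) (deriv (g i)) (fun u hu => (hder i u hu).2)
          x hx y hy z hz l h1 h2).2
      disjoint := fun i j hij => (S.dom_disjoint hij).mono
        (image_subset_iff.2 fun u hu => hgdom i (hbase hu))
        (image_subset_iff.2 fun u hu => hgdom j (hbase hu))
      shrink := by
        intro ε hε
        obtain ⟨N, hN⟩ := exists_forall_injOn_iterate_lt hab hf.mapsTo hcont hf.mixing hε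
        refine ⟨N, fun n hn η => ?_⟩
        have hp := hIab (hsmaps n η hm0)
        have hq := hIab (hsmaps n η hm1)
        have hsurj : ∀ z ∈ uIcc (seqMap g n η e₀) (seqMap g n η e₁), ∃ u ∈ Icc e₀ e₁,
            seqMap g n η u = z := by
          have := intermediate_value_uIcc (f := seqMap g n η) (a := e₀) (b := e₁)
            (by rw [uIcc_of_le he.le]; exact hscont n η)
          rw [uIcc_of_le he.le] at this
          exact this
        -- The iterate of order `wordTime` inverts the composition, so it is injective on the
        -- cylinder, and its order is at least `n ≥ N`.
        have hinj : InjOn f^[N] (uIcc (seqMap g n η e₀) (seqMap g n η e₁)) := by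
          refine injOn_iterate_of_le (hn.trans (S.le_wordTime η n)) fun z hz z' hz' h => ?_
          obtain ⟨u, hu, rfl⟩ := hsurj z hz
          obtain ⟨u', hu', rfl⟩ := hsurj z' hz'
          rw [hsinv n η u hu, hsinv n η u' hu'] at h
          rw [h]
        have h1 := hN _ (by rcases min_choice (seqMap g n η e₀) (seqMap g n η e₁) with h | h <;>
          rw [h] <;> assumption) _ (by
          rcases max_choice (seqMap g n η e₀) (seqMap g n η e₁) with h | h <;>
          rw [h] <;> assumption) hinj
        rw [abs_sub_comm, ← max_sub_min_eq_abs]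
        exact h1.le
      hyperbolic := by
        intro n hn η p hp hfix
        have hd : ∀ (n : ℕ) (η : ℕ → ι), ∀ u ∈ Icc e₀ e₁, ∃ d,
            |d| = seqDeriv g (fun i u => |deriv (g i) u|) n η u ∧
              HasDerivAt (seqMap g n η) d u := by
          intro n
          induction n with
          | zero => exact fun η u hu => ⟨1, abs_one, hasDerivAt_id u⟩
          | succ n ih =>
            intro η u hu
            obtain ⟨d, hd, hd'⟩ := ih (fun k => η (k + 1)) u hu
            exact ⟨deriv (g (η 0)) (seqMap g n (fun k => η (k + 1)) u) * d, by
              simp only [seqDeriv]; rw [abs_mul, hd],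
              (hder (η 0) _ (hsmaps n _ hu)).2.comp u hd'⟩
        obtain ⟨d, hd1, hd2⟩ := hd n η p hp
        have hT := hsinv n η p hp
        rw [hfix] at hT
        have hL := hf.repelling p (hIab hp) _ (hn.trans_le (S.le_wordTime η n)) hT
        set L := derivWithin f^[S.wordTime η n] (Icc a b) p with hLdef
        -- `derivWithin` is `0` where the derivative does not exist, so `1 < |L|` entails
        -- differentiability. The chain rule then makes the derivative of the composition the
        -- reciprocal of `L`.
        have hdiff : DifferentiableWithinAt ℝ f^[S.wordTime η n] (Icc a b) p := by
          by_contra h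
          rw [hLdef, derivWithin_zero_of_not_differentiableWithinAt h, abs_zero] at hL
          linarith
        have h1 : HasDerivWithinAt f^[S.wordTime η n] L (Icc a b) (seqMap g n η p) := by
          rw [hfix]; exact hdiff.hasDerivWithinAt
        have h2 := h1.comp p hd2.hasDerivWithinAt ((hsmaps n η).mono_right hIab)
        have h3 : HasDerivWithinAt (f^[S.wordTime η n] ∘ seqMap g n η) 1 (Icc e₀ e₁) p :=
          (hasDerivWithinAt_id p _).congr (fun u hu => hsinv n η u hu) (hsinv n η p hp)
        have h4 : L * d = 1 := (uniqueDiffOn_Icc he p hp).eq_deriv _ h2 h3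
        rw [← hd1]
        have h5 : |L| * |d| = 1 := by rw [← abs_mul, h4, abs_one]
        by_contra! h6
        nlinarith }

end InducingScheme

theorem HolderOnWith.abs_sub_le {φ : ℝ → ℝ} {C α : ℝ≥0} {s : Set ℝ} (h : HolderOnWith C α φ s)
    {x y : ℝ} (hx : x ∈ s) (hy : y ∈ s) : |φ x - φ y| ≤ C * |x - y| ^ (α : ℝ) := by
  have h1 := h.edist_le hx hy
  rw [edist_dist, edist_dist, Real.dist_eq, Real.dist_eq,
    ENNReal.ofReal_rpow_of_nonneg (abs_nonneg _) α.coe_nonneg, ← ENNReal.ofReal_coe_nnreal (p := C),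
    ← ENNReal.ofReal_mul C.coe_nonneg] at h1
  exact (ENNReal.ofReal_le_ofReal_iff
    (mul_nonneg C.coe_nonneg (Real.rpow_nonneg (abs_nonneg _) _))).1 h1

/-- Hölder continuous functions with exponent greater than one are constant. -/
theorem HolderOnWith.eq_of_one_lt {φ : ℝ → ℝ} {C α : ℝ≥0} {s : Set ℝ} (h : HolderOnWith C α φ s)
    (hs : Convex ℝ s) (hα : 1 < α) {x y : ℝ} (hx : x ∈ s) (hy : y ∈ s) : φ x = φ y := by
  have hα' : (1 : ℝ) < α := by exact_mod_cast hα
  have hd : ∀ z ∈ s, HasDerivWithinAt φ 0 s z := by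
    intro z hz
    rw [hasDerivWithinAt_iff_isLittleO, Asymptotics.isLittleO_iff]
    intro c hc
    have hlim : Filter.Tendsto (fun t => (C : ℝ) * |t - z| ^ ((α : ℝ) - 1)) (𝓝[s] z) (𝓝 0) := by
      have h1 : ContinuousAt (fun t => (C : ℝ) * |t - z| ^ ((α : ℝ) - 1)) z :=
        continuousAt_const.mul (((continuousAt_id.sub continuousAt_const).abs).rpow_const
          (Or.inr (by linarith)))
      have h2 := h1.tendsto
      simp only [sub_self, abs_zero] at h2
      rw [Real.zero_rpow (by linarith), mul_zero] at h2
      exact h2.mono_left nhdsWithin_le_nhds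
    filter_upwards [hlim.eventually_lt_const hc, self_mem_nhdsWithin] with t ht hts
    rw [smul_zero, sub_zero, Real.norm_eq_abs, Real.norm_eq_abs]
    refine (h.abs_sub_le hts hz).trans ?_
    rcases eq_or_ne t z with rfl | hne
    · rw [sub_self, abs_zero, Real.zero_rpow (by linarith), mul_zero, mul_zero]
    · have h3 : |t - z| ^ (α : ℝ) = |t - z| ^ ((α : ℝ) - 1) * |t - z| := by
        rw [← Real.rpow_add_one (abs_pos.2 (sub_ne_zero.2 hne)).ne']; ring_nf
      rw [h3, ← mul_assoc]
      exact mul_le_mul_of_nonneg_right ht.le (abs_nonneg _)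
  have h4 := hs.norm_image_sub_le_of_norm_hasDerivWithin_le hd (C := 0) (fun _ _ => by simp) hy hx
  rw [zero_mul] at h4
  exact sub_eq_zero.1 (norm_le_zero_iff.1 h4)

/-! ### Exponential decay of the induced variations: part (b) -/

namespace InducingScheme

variable {f φ : ℝ → ℝ} {a b : ℝ} {ι : Type*}

/-- A potential whose induced variations decay exponentially satisfies (SVI). -/
theorem svi_of_exponential {I : Set ℝ} (S : InducingScheme f I ι) {M ρ : ℝ} (hρ0 : 0 ≤ ρ)
    (hρ1 : ρ < 1)
    (h : ∀ (w : ℕ → ι) (n : ℕ) (x y : ℝ), S.Follows w (n + 1) x → S.Follows w (n + 1) y →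
      x ∈ S.base → y ∈ S.base →
      ∑ k ∈ Finset.range (S.tau (w 0)), |φ (f^[k] x) - φ (f^[k] y)| ≤ M * ρ ^ n) : S.SVI φ := by
  refine lt_of_le_of_lt (ENNReal.tsum_le_tsum fun n => ?_)
    ((summable_geometric_of_lt_one hρ0 hρ1).mul_left M).tsum_ofReal_lt_top
  refine iSup₂_le fun Z hZ => iSup₂_le fun x hx => iSup₂_le fun y hy => ENNReal.ofReal_le_ofReal ?_
  obtain ⟨w, hw⟩ := S.exists_word_of_mem_cylinders hZ
  have hxy : x ∈ S.base ∧ y ∈ S.base := by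
    obtain ⟨-, c, -, rfl⟩ := hZ
    exact ⟨hx.1, hy.1⟩
  have hx0 : x ∈ S.dom (w 0) := hw x hx 0 n.succ_pos
  have hy0 : y ∈ S.dom (w 0) := hw y hy 0 n.succ_pos
  rw [inducedPotential, inducedPotential, S.time_eq hx0, S.time_eq hy0, ← Finset.sum_sub_distrib]
  exact (Finset.abs_sum_le_sum_abs _ _).trans (h w n x y (hw x hx) (hw y hy) hxy.1 hxy.2)

theorem Follows.eq_seqMap {I : Set ℝ} {S : InducingScheme f I ι} {g : ι → ℝ → ℝ}
    (hleft : ∀ i, ∀ x ∈ S.dom i, g i (f^[S.tau i] x) = x) {n : ℕ} :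
    ∀ {w : ℕ → ι} {x : ℝ}, S.Follows w n x → x = seqMap g n w (f^[S.wordTime w n] x) := by
  induction n with
  | zero => intros; rfl
  | succ n ih =>
    intro w x h
    have h0 : x ∈ S.dom (w 0) := h 0 n.succ_pos
    have h1 : S.Follows (fun k => w (k + 1)) n (f^[S.tau (w 0)] x) := fun j hj => by
      have := h (j + 1) (Nat.succ_lt_succ hj)
      rwa [S.wordTime_succ_shift, Function.iterate_add_apply] at this
    simp only [seqMap]
    rw [S.wordTime_succ_shift, Function.iterate_add_apply, ← ih h1, hleft _ _ h0]

theorem Follows.iterate_mem_base {I : Set ℝ} {S : InducingScheme f I ι} {w : ℕ → ι} {n : ℕ} {x : ℝ}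
    (h : S.Follows w n x) (hx : x ∈ S.base) : f^[S.wordTime w n] x ∈ S.base := by
  cases n with
  | zero => exact hx
  | succ n =>
    rw [S.wordTime_succ, Function.iterate_add_apply]
    exact S.mapsTo_dom _ (h n n.lt_succ_self)

/-- The lengths of the iterates of the branches, in terms of the measures of their images. -/
theorem ofReal_abs_sub_le_volume (S : InducingScheme f (Icc a b) ι)
    (hmaps : MapsTo f (Icc a b) (Icc a b)) (hcont : ContinuousOn f (Icc a b)) {A B e₀ e₁ : ℝ}
    (he : e₀ < e₁) (hbase : Ioo e₀ e₁ ⊆ S.base) (hAB : Icc e₀ e₁ ⊆ Ioo A B) {i : ι} {g : ℝ → ℝ}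
    (hg : IsInverseBranch f (Icc a b) A B (S.tau i) g)
    (hleft : ∀ x ∈ S.dom i, g (f^[S.tau i] x) = x) (k : ℕ) :
    ENNReal.ofReal |f^[k] (g e₁) - f^[k] (g e₀)| ≤ volume (f^[k] '' S.dom i) := by
  have hc := (hg.continuousOn_iterate hmaps hcont k).mono hAB
  have hsub : (fun u => f^[k] (g u)) '' Ioo e₀ e₁ ⊆ f^[k] '' S.dom i := by
    rintro _ ⟨u, hu, rfl⟩
    obtain ⟨x, hx, hxu⟩ := S.surjOn_dom i (hbase hu)
    refine ⟨g u, ?_, rfl⟩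
    rw [← hxu, hleft x hx]
    exact hx
  rcases le_total (f^[k] (g e₀)) (f^[k] (g e₁)) with h | h
  · rw [abs_of_nonneg (sub_nonneg.2 h), ← Real.volume_Ioo]
    exact measure_mono ((intermediate_value_Ioo he.le hc).trans hsub)
  · rw [abs_of_nonpos (sub_nonpos.2 h), neg_sub, ← Real.volume_Ioo]
    exact measure_mono ((intermediate_value_Ioo' he.le hc).trans hsub)

/-- The images under `F` of two points in an `(n+1)`-cylinder are `O(θ ^ n)` apart. Pulled back by
the Lipschitz bound, their `k`-th iterates are `O(θ ^ n)` times the length of the image of `X_i`;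
the `α`-th powers of these lengths have a uniformly bounded sum. -/
theorem svi_of_correspondsToFirstReturn (S : InducingScheme f (Icc a b) ι) (hab : a < b)
    (hf : IsClassH f a b) {P : Set (Set ℝ)} (hP : IsBranchPartition f (Icc a b) P)
    (hext : ∀ c ∈ criticalSet f a b, c ∈ Ioo a b → IsLocalExtr f c) {α C : ℝ≥0} (hα : 0 < α)
    (hα1 : α ≤ 1) (hφ : HolderOnWith C α φ (Icc a b)) (hS : S.CorrespondsToFirstReturn P)
    (hlen : (⨆ i, ∑ k ∈ Finset.range (S.tau i), volume (f^[k] '' S.dom i) ^ (α : ℝ)) < ⊤) :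
    S.SVI φ := by
  have hcont := hf.contDiffOn.continuousOn
  have hα' : (0 : ℝ) < α := by exact_mod_cast hα
  have hα1' : (α : ℝ) ≤ 1 := by exact_mod_cast hα1
  obtain ⟨e₀, e₁, he, hcl, hbase⟩ := S.exists_closure_base_eq
  obtain ⟨A, B, hAB, hbranch⟩ := hS.exists_isInverseBranch hP hf.mapsTo hcont
  rw [hcl] at hAB
  choose g hg hleft using hbranch
  set M := (⨆ i, ∑ k ∈ Finset.range (S.tau i), volume (f^[k] '' S.dom i) ^ (α : ℝ)).toReal with hM
  set J : ι → ℕ → ℝ := fun i k => |f^[k] (g i e₁) - f^[k] (g i e₀)| with hJ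
  have hJ0 : ∀ i k, 0 ≤ J i k := fun i k => abs_nonneg _
  have hJα : ∀ i, ∑ k ∈ Finset.range (S.tau i), J i k ^ (α : ℝ) ≤ M := by
    intro i
    rw [hM, ← ENNReal.ofReal_le_iff_le_toReal hlen.ne,
      ENNReal.ofReal_sum_of_nonneg fun k _ => Real.rpow_nonneg (hJ0 i k) _]
    refine (Finset.sum_le_sum fun k _ => ?_).trans (le_iSup (fun i =>
      ∑ k ∈ Finset.range (S.tau i), volume (f^[k] '' S.dom i) ^ (α : ℝ)) i)
    rw [← ENNReal.ofReal_rpow_of_nonneg (hJ0 i k) hα'.le]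
    exact ENNReal.rpow_le_rpow (S.ofReal_abs_sub_le_volume hf.mapsTo hcont he hbase hAB (hg i)
      (hleft i) k) hα'.le
  -- The distortion estimates need the sum of the lengths themselves. As `α ≤ 1` and lengths are at
  -- most `b - a`, a length is at most `(b - a) ^ (1 - α)` times its `α`-th power.
  have hsum : ∀ i, ∑ k ∈ Finset.range (S.tau i), |f^[k] (g i e₁) - f^[k] (g i e₀)| ≤
      (b - a) ^ (1 - (α : ℝ)) * M := by
    intro i
    refine le_trans ?_ (mul_le_mul_of_nonneg_left (hJα i) (Real.rpow_nonneg (by linarith) _))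
    rw [Finset.mul_sum]
    refine Finset.sum_le_sum fun k _ => ?_
    have h1 : J i k ≤ b - a := by
      have h1 := hf.mapsTo.iterate k ((hg i).mapsTo (hAB (right_mem_Icc.2 he.le)))
      have h2 := hf.mapsTo.iterate k ((hg i).mapsTo (hAB (left_mem_Icc.2 he.le)))
      simp only [hJ]
      rw [abs_le]
      constructor <;> linarith [h1.1, h1.2, h2.1, h2.2]
    calc J i k = J i k ^ (1 - (α : ℝ)) * J i k ^ (α : ℝ) := by
          rw [← Real.rpow_add' (hJ0 i k) (by simp)]; simp
      _ ≤ (b - a) ^ (1 - (α : ℝ)) * J i k ^ (α : ℝ) := by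
          refine mul_le_mul_of_nonneg_right ?_ (Real.rpow_nonneg (hJ0 i k) _)
          exact Real.rpow_le_rpow (hJ0 i k) h1 (by linarith)
  obtain ⟨⟨K, hIFS⟩, C₁, hC₁, hlip⟩ := S.exists_isIntervalIFS hab hf hext he hcl hbase hAB hg hleft
    hsum
  obtain ⟨C₂, θ, hC₂, hθ0, hθ1, hexp⟩ := hIFS.exists_length_le
  have hbaseI : S.base ⊆ Icc e₀ e₁ := by rw [← hcl]; exact subset_closure
  refine S.svi_of_exponential (M := C * ((C₁ * C₂) ^ (α : ℝ) * M)) (ρ := θ ^ (α : ℝ))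
    (Real.rpow_nonneg hθ0.le _) (Real.rpow_lt_one hθ0.le hθ1 hα') fun w n x y hx hy hxb hyb => ?_
  have hdist : |f^[S.tau (w 0)] x - f^[S.tau (w 0)] y| ≤ C₂ * θ ^ n := by
    have hshift : ∀ {z : ℝ}, S.Follows w (n + 1) z →
        S.Follows (fun k => w (k + 1)) n (f^[S.tau (w 0)] z) := fun h j hj => by
      have := h (j + 1) (Nat.succ_lt_succ hj)
      rwa [S.wordTime_succ_shift, Function.iterate_add_apply] at this
    have hx0 := S.mapsTo_dom _ (hx 0 n.succ_pos)
    have hy0 := S.mapsTo_dom _ (hy 0 n.succ_pos)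
    rw [(hshift hx).eq_seqMap hleft, (hshift hy).eq_seqMap hleft]
    exact (hIFS.abs_seqMap_sub_le (hbaseI ((hshift hx).iterate_mem_base hx0))
      (hbaseI ((hshift hy).iterate_mem_base hy0))).trans (hexp n _)
  have hterm : ∀ k ∈ Finset.range (S.tau (w 0)), |φ (f^[k] x) - φ (f^[k] y)| ≤
      C * ((C₁ * C₂) ^ (α : ℝ) * (θ ^ (α : ℝ)) ^ n) * J (w 0) k ^ (α : ℝ) := by
    intro k hk
    have hx0 : x ∈ S.dom (w 0) := hx 0 n.succ_pos
    have hy0 : y ∈ S.dom (w 0) := hy 0 n.succ_pos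
    have h1 := hlip (w 0) k (Finset.mem_range.1 hk).le _ (hbaseI (S.mapsTo_dom _ hx0)) _
      (hbaseI (S.mapsTo_dom _ hy0))
    rw [hleft _ _ hx0, hleft _ _ hy0] at h1
    have h2 : |f^[k] x - f^[k] y| ≤ C₁ * C₂ * θ ^ n * J (w 0) k :=
      calc _ ≤ _ := h1
        _ ≤ C₁ * J (w 0) k * (C₂ * θ ^ n) :=
          mul_le_mul_of_nonneg_left hdist (mul_nonneg hC₁ (hJ0 _ _))
        _ = _ := by ring
    have hI := S.base_subset
    refine (hφ.abs_sub_le (hf.mapsTo.iterate k (hI hxb)) (hf.mapsTo.iterate k (hI hyb))).trans ?_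
    rw [mul_assoc]
    refine mul_le_mul_of_nonneg_left ?_ C.coe_nonneg
    calc |f^[k] x - f^[k] y| ^ (α : ℝ) ≤ (C₁ * C₂ * θ ^ n * J (w 0) k) ^ (α : ℝ) :=
          Real.rpow_le_rpow (abs_nonneg _) h2 hα'.le
      _ = _ := by
          rw [Real.mul_rpow (by positivity) (hJ0 _ _), Real.mul_rpow (by positivity) (by positivity),
            ← Real.rpow_natCast, ← Real.rpow_natCast, ← Real.rpow_mul hθ0.le, ← Real.rpow_mul hθ0.le,
            mul_comm (α : ℝ)]
  refine (Finset.sum_le_sum hterm).trans ?_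
  rw [← Finset.mul_sum]
  calc _ ≤ C * ((C₁ * C₂) ^ (α : ℝ) * (θ ^ (α : ℝ)) ^ n) * M :=
        mul_le_mul_of_nonneg_left (hJα _) (by positivity)
    _ = _ := by ring

theorem svi_of_eq {I : Set ℝ} (S : InducingScheme f I ι) (hmaps : MapsTo f I I)
    (h : ∀ x ∈ I, ∀ y ∈ I, φ x = φ y) : S.SVI φ := by
  refine S.svi_of_exponential (M := 0) (ρ := 0) le_rfl one_pos fun w n x y _ _ hx hy => ?_
  rw [zero_mul]
  refine (Finset.sum_eq_zero fun k _ => ?_).le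
  rw [h _ (hmaps.iterate k (S.base_subset hx)) _ (hmaps.iterate k (S.base_subset hy)), sub_self,
    abs_zero]

end InducingScheme

theorem mainTheorem12 {a b : ℝ} (hab : a < b) (f : ℝ → ℝ) (hf : IsClassH f a b)
    (P : Set (Set ℝ)) (hP : IsBranchPartition f (Icc a b) P) (φ : ℝ → ℝ) :
    -- (a)
    (∑' n : ℕ, (n : ℝ≥0∞) * variation f (Icc a b) P φ n < ⊤ →
      ∀ {ι : Type*} [Countable ι] (S : InducingScheme f (Icc a b) ι),
        (S.IsSubordinate P ∨ ContinuousOn φ (Icc a b)) → S.SVI φ) ∧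
    -- (b)
    ((∀ c ∈ criticalSet f a b, c ∈ Ioo a b → IsLocalExtr f c) →
      ∀ (α C : ℝ≥0), 0 < α → HolderOnWith C α φ (Icc a b) →
      ∀ {ι : Type*} [Countable ι] (S : InducingScheme f (Icc a b) ι),
        S.CorrespondsToFirstReturn P →
        (⨆ i, ∑ k ∈ Finset.range (S.tau i), volume (f^[k] '' S.dom i) ^ (α : ℝ)) < ⊤ →
        S.SVI φ) := by
  refine ⟨fun hV ι _ S hS => hS.elim (S.svi_of_isSubordinate hf.mapsTo hV)
    (S.svi_of_continuousOn hP hf.mapsTo hf.contDiffOn.continuousOn hV),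
    fun hext α C hα hφ ι _ S hS hlen => ?_⟩
  -- For `α > 1` the length condition need not bound the sum of lengths uniformly, but then `φ` is
  -- constant.
  rcases le_or_gt α 1 with hα1 | hα1
  · exact S.svi_of_correspondsToFirstReturn hab hf hP hext hα hα1 hφ hS hlen
  · exact S.svi_of_eq hf.mapsTo fun x hx y hy => hφ.eq_of_one_lt (convex_Icc a b) hα1 hx hy
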